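/- A *plane bipartite map* is a connected map in the plane whose vertices are coloured white and black so that every edge joins a white vertex to a black one; maps are considered up to orientation-preserving isomorphisms that preserve the colours (and the infinite face). A *plane bipartite tree* is such a map with exactly one face; the two one-vertex trees (white or black) are included. A *$2^1$-map* is a plane bipartite map with exactly two faces, the infinite one and one of perimeter $2$. To a map $D$ with $V$ vertices and $E$ edges, having $k_i$ white and $l_i$ black vertices of degree $i$ ($i\ge 0$), assign the monomial $$w(D)=\prod_{i\ge0}a_i^{k_i}\prod_{i\ge0}b_i^{l_i}\;t^{V}x^{E}.$$ For a finitely supported sequence $k=(k_1,k_2,\dots)$ of nonnegative integers put $|k|=\sum_i k_i$, $\|k\|=\sum_i i\,k_i$, $k!=\prod_i k_i!$, $a^k=\prod_i a_i^{k_i}$, and let $$A(a,t,x)=\sum_{k\ne0}\frac{(|k|-1)!}{k!}\,a^k t^{|k|}x^{\|k\|},\qquad B(b,t,y)=\sum_{l\ne0}\frac{(|l|-1)!}{l!}\,b^l t^{|l|}y^{\|l\|}.$$ Let $T(a,b,t,x)$ be the formal power series over $\mathbb Q$ obtained from $A(a,t,x)\cdot B(b,t,y)$ by keeping only the terms with $\deg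 x=\deg y=\deg t-1$, setting $y=1$ in them, and adding the terms $a_0t+b_0t$. Let $$D_a=a_2x\,\frac{\partial}{\partial a_0}+\sum_{k\ge1}k\,a_{k+2}\,x\,\frac{\partial}{\partial a_k},\qquad D_b=b_2x\,\frac{\partial}{\partial b_0}+\sum_{k\ge1}k\,b_{k+2}\,x\,\frac{\partial}{\partial b_k}.$$ **Theorem 2.1.** The series $T$ is the generating function of plane bipartite trees, $$T(a,b,t,x)=\sum_{\tau}\frac{1}{\#\mathrm{Aut}(\tau)}\,w(\tau),$$ the sum being over isomorphism classes of plane bipartite trees, and the generating function $M(a,b,t,x)=\sum_{D}w(D)$ of $2^1$-maps (the sum being over isomorphism classes of $2^1$-maps) is $$M(a,b,t,x)=D_a(T)\cdot D_b(T).$$ -/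

import Mathlib

/-! ### Plane bipartite maps -/

/-- A bipartite map with white vertices `W`, black vertices `B` and edges `E`, given by its
rotation system: every edge `e` joins the white vertex `atW e` to the black vertex `atB e`, and
`rotW e` (`rotB e`) is the edge that follows `e` counterclockwise around its white (black) end.
Vertices without edges are allowed, so that the two maps with one vertex are included. -/
structure BMap (W B E : Type) where
  atW : E → W
  atB : E → B
  rotW : Equiv.Perm E
  rotB : Equiv.Perm E
  atW_eq_iff : ∀ e e', atW e = atW e' ↔ rotW.SameCycle e e'
  atB_eq_iff : ∀ e e', atB e = atB e' ↔ rotB.SameCycle e e'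

namespace BMap

variable {W B E W' B' E' W'' B'' E'' : Type}

/-- Degree of a white vertex. -/
noncomputable def degW (m : BMap W B E) (w : W) : ℕ := Nat.card {e : E // m.atW e = w}

/-- Degree of a black vertex. -/
noncomputable def degB (m : BMap W B E) (b : B) : ℕ := Nat.card {e : E // m.atB e = b}

/-- The underlying simple graph on the set of all vertices (only used for connectedness). -/
def graph (m : BMap W B E) : SimpleGraph (W ⊕ B) :=
  SimpleGraph.fromRel fun u v => ∃ e, u = Sum.inl (m.atW e) ∧ v = Sum.inr (m.atB e)

/-- Walking along the boundary of a face: go along `e` from its white end to its black end, turn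
into `rotB e`, go along it to its white end, and turn into `rotW (rotB e)`. Every face boundary is
thus described by one cycle of this permutation, which lists the edges that are passed from white
to black. -/
def facePerm (m : BMap W B E) : Equiv.Perm E := m.rotW * m.rotB

/-- The faces of a map with at least one edge. -/
def Face (m : BMap W B E) : Type := Quotient (Equiv.Perm.SameCycle.setoid m.facePerm)

/-- The face on the boundary of which `e` is passed from its white end to its black end. -/
def faceOf (m : BMap W B E) (e : E) : m.Face :=
  Quotient.mk (Equiv.Perm.SameCycle.setoid m.facePerm) e

/-- The perimeter of a face, i.e. the number of edge sides on its boundary: half of them are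
passed from white to black, the other half from black to white. -/
noncomputable def perimeter (m : BMap W B E) (f : m.Face) : ℕ :=
  2 * Nat.card {e : E // m.faceOf e = f}

open Classical in
/-- The number of faces; a one-vertex map without edges has one face. -/
noncomputable def numFaces (m : BMap W B E) : ℕ := if IsEmpty E then 1 else Nat.card m.Face

/-- `m` is a connected map on the sphere (equivalently, in the plane): it is connected, and Euler's
formula `V - E + F = 2` holds. -/
def IsPlane (m : BMap W B E) : Prop :=
  m.graph.Connected ∧ Nat.card W + Nat.card B + m.numFaces = Nat.card E + 2

/-- Isomorphisms of bipartite maps: they preserve colours, incidence and orientation. -/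
structure Iso (m : BMap W B E) (m' : BMap W' B' E') where
  onW : W ≃ W'
  onB : B ≃ B'
  onE : E ≃ E'
  map_atW : ∀ e, onW (m.atW e) = m'.atW (onE e)
  map_atB : ∀ e, onB (m.atB e) = m'.atB (onE e)
  map_rotW : ∀ e, onE (m.rotW e) = m'.rotW (onE e)
  map_rotB : ∀ e, onE (m.rotB e) = m'.rotB (onE e)

/-- The identity. -/
def Iso.refl (m : BMap W B E) : Iso m m :=
  ⟨Equiv.refl _, Equiv.refl _, Equiv.refl _, fun _ => rfl, fun _ => rfl, fun _ => rfl,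
    fun _ => rfl⟩

/-- The inverse isomorphism. -/
def Iso.symm {m : BMap W B E} {m' : BMap W' B' E'} (φ : Iso m m') : Iso m' m where
  onW := φ.onW.symm
  onB := φ.onB.symm
  onE := φ.onE.symm
  map_atW e := by rw [Equiv.symm_apply_eq, φ.map_atW, Equiv.apply_symm_apply]
  map_atB e := by rw [Equiv.symm_apply_eq, φ.map_atB, Equiv.apply_symm_apply]
  map_rotW e := by rw [Equiv.symm_apply_eq, φ.map_rotW, Equiv.apply_symm_apply]
  map_rotB e := by rw [Equiv.symm_apply_eq, φ.map_rotB, Equiv.apply_symm_apply]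

/-- Composition of isomorphisms. -/
def Iso.trans {m : BMap W B E} {m' : BMap W' B' E'} {m'' : BMap W'' B'' E''}
    (φ : Iso m m') (ψ : Iso m' m'') : Iso m m'' where
  onW := φ.onW.trans ψ.onW
  onB := φ.onB.trans ψ.onB
  onE := φ.onE.trans ψ.onE
  map_atW e := by simp [φ.map_atW, ψ.map_atW]
  map_atB e := by simp [φ.map_atB, ψ.map_atB]
  map_rotW e := by simp [φ.map_rotW, ψ.map_rotW]
  map_rotB e := by simp [φ.map_rotB, ψ.map_rotB]

instance [Finite W] [Finite B] [Finite E] : Finite (BMap W B E) :=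
  Finite.of_injective
    (fun m : BMap W B E => ((m.atW, m.atB), ((m.rotW : E → E), (m.rotB : E → E)))) (by
      rintro ⟨a, b, c, d, _, _⟩ ⟨a', b', c', d', _, _⟩ h
      simp only [Prod.mk.injEq, DFunLike.coe_fn_eq] at h
      obtain ⟨⟨rfl, rfl⟩, rfl, rfl⟩ := h
      rfl)

instance (m : BMap W B E) [Finite E] : Finite m.Face :=
  inferInstanceAs (Finite (Quotient _))

end BMap

/-- A plane bipartite tree (with labelled vertices and edges): a plane bipartite map with exactly
one face. -/
structure PlaneTree where
  nW : ℕ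
  nB : ℕ
  nE : ℕ
  map : BMap (Fin nW) (Fin nB) (Fin nE)
  isPlane : map.IsPlane
  oneFace : map.numFaces = 1

/-- Plane trees are considered up to isomorphism. -/
instance PlaneTree.isoSetoid : Setoid PlaneTree where
  r S T := Nonempty (S.map.Iso T.map)
  iseqv := ⟨fun T => ⟨BMap.Iso.refl T.map⟩, fun ⟨φ⟩ => ⟨φ.symm⟩, fun ⟨φ⟩ ⟨ψ⟩ => ⟨φ.trans ψ⟩⟩

/-- A `2^1`-map (with labelled vertices and edges): a plane bipartite map with exactly two faces,
one of which is chosen to be the infinite face and the other of which has perimeter 2. -/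
structure TwoOneMap where
  nW : ℕ
  nB : ℕ
  nE : ℕ
  map : BMap (Fin nW) (Fin nB) (Fin nE)
  outer : map.Face
  isPlane : map.IsPlane
  twoFaces : map.numFaces = 2
  perimeter_eq : ∀ f, f ≠ outer → map.perimeter f = 2

/-- `2^1`-maps are considered up to isomorphisms that preserve the infinite face. -/
instance TwoOneMap.isoSetoid : Setoid TwoOneMap where
  r S T := ∃ φ : S.map.Iso T.map,
    ∀ e, S.map.faceOf e = S.outer ↔ T.map.faceOf (φ.onE e) = T.outer
  iseqv := by
    refine ⟨fun T => ⟨BMap.Iso.refl T.map, fun _ => Iff.rfl⟩, ?_, ?_⟩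
    · rintro S T ⟨φ, h⟩
      refine ⟨φ.symm, fun e => ?_⟩
      rw [h]
      simp [BMap.Iso.symm]
    · rintro S T U ⟨φ, h⟩ ⟨ψ, h'⟩
      exact ⟨φ.trans ψ, fun e => (h e).trans (h' _)⟩

/-! ### Formal variables, passports, generating functions -/

/-- The formal variables `a_0, a_1, …`, `b_0, b_1, …`, `t`, `x`, `y`. -/
inductive Var : Type
  | a (i : ℕ)
  | b (i : ℕ)
  | t
  | x
  | y

/-- The passport of a map together with the number of vertices (exponent of `t`) and the number of
edges (exponent of `x`), as a monomial: `∏ a_{deg w} * ∏ b_{deg b} * t ^ V * x ^ E`. -/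
noncomputable def BMap.weight {p q n : ℕ} (m : BMap (Fin p) (Fin q) (Fin n)) : Var →₀ ℕ :=
  ∑ w, Finsupp.single (Var.a (m.degW w)) 1 + ∑ b, Finsupp.single (Var.b (m.degB b)) 1 +
    Finsupp.single Var.t (p + q) + Finsupp.single Var.x n

/-- The power series whose coefficient at the monomial with exponents `d` is `f d`. -/
def ofCoeff (f : (Var →₀ ℕ) → ℚ) : MvPowerSeries Var ℚ := f

/-- The formal sum `∑_{i ∈ ι} c i * (monomial with exponents wt i)`, for a family in which every
monomial occurs only finitely often. -/
noncomputable def genSeries {ι : Type} (wt : ι → Var →₀ ℕ) (c : ι → ℚ) : MvPowerSeries Var ℚ :=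
  ofCoeff fun d => ∑ᶠ i : {i : ι // wt i = d}, c i

theorem BMap.weight_t {p q n : ℕ} (m : BMap (Fin p) (Fin q) (Fin n)) :
    m.weight Var.t = p + q := by
  simp [BMap.weight]

theorem BMap.weight_x {p q n : ℕ} (m : BMap (Fin p) (Fin q) (Fin n)) : m.weight Var.x = n := by
  simp [BMap.weight]

/-- Finitely many labelled plane trees have a given weight. -/
theorem PlaneTree.finite_weight (d : Var →₀ ℕ) : Finite {T : PlaneTree // T.map.weight = d} := by
  let κ := Σ p : Fin (d Var.t + 1), Σ q : Fin (d Var.t + 1), BMap (Fin p) (Fin q) (Fin (d Var.x))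
  let g : κ → Option PlaneTree := fun s => by
    classical
    exact if h : s.2.2.IsPlane ∧ s.2.2.numFaces = 1 then some ⟨_, _, _, s.2.2, h.1, h.2⟩ else none
  have key : {T : PlaneTree | T.map.weight = d} ⊆ some ⁻¹' Set.range g := by
    rintro ⟨p, q, n, m, h1, h2⟩ (h : m.weight = d)
    have ht := m.weight_t
    have hx := m.weight_x
    rw [h] at ht hx
    subst hx
    exact ⟨⟨⟨p, by omega⟩, ⟨q, by omega⟩, m⟩, dif_pos ⟨h1, h2⟩⟩
  exact (((Set.finite_range g).preimage (Option.some_injective _).injOn).subset key).to_subtype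

/-- Finitely many labelled `2^1`-maps have a given weight. -/
theorem TwoOneMap.finite_weight (d : Var →₀ ℕ) : Finite {T : TwoOneMap // T.map.weight = d} := by
  let κ := Σ p : Fin (d Var.t + 1), Σ q : Fin (d Var.t + 1),
    Σ m : BMap (Fin p) (Fin q) (Fin (d Var.x)), m.Face
  let g : κ → Option TwoOneMap := fun s => by
    classical
    exact if h : s.2.2.1.IsPlane ∧ s.2.2.1.numFaces = 2 ∧
      ∀ f, f ≠ s.2.2.2 → s.2.2.1.perimeter f = 2 then
        some ⟨_, _, _, s.2.2.1, s.2.2.2, h.1, h.2.1, h.2.2⟩ else none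
  have key : {T : TwoOneMap | T.map.weight = d} ⊆ some ⁻¹' Set.range g := by
    rintro ⟨p, q, n, m, f, h1, h2, h3⟩ (h : m.weight = d)
    have ht := m.weight_t
    have hx := m.weight_x
    rw [h] at ht hx
    subst hx
    exact ⟨⟨⟨p, by omega⟩, ⟨q, by omega⟩, m, f⟩, dif_pos ⟨h1, h2, h3⟩⟩
  exact (((Set.finite_range g).preimage (Option.some_injective _).injOn).subset key).to_subtype

/-- The generating function of plane bipartite trees: isomorphism classes are counted by passport,
each with weight `1 / #Aut`. -/
noncomputable def planeTreeSeries : MvPowerSeries Var ℚ :=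
  genSeries (fun τ : Quotient PlaneTree.isoSetoid => τ.out.map.weight)
    fun τ => 1 / (Nat.card (τ.out.map.Iso τ.out.map) : ℚ)

/-- The generating function `M` of `2^1`-maps: isomorphism classes are counted by passport. -/
noncomputable def twoOneSeries : MvPowerSeries Var ℚ :=
  genSeries (fun μ : Quotient TwoOneMap.isoSetoid => μ.out.map.weight) fun _ => 1

/-- The exponents of `∏_i (v_i * t * z ^ i) ^ k_i`, i.e. of `v^k * t^|k| * z^||k||`. -/
noncomputable def seqWeight (v : ℕ → Var) (z : Var) (k : ℕ+ →₀ ℕ) : Var →₀ ℕ :=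
  k.sum fun i m => m • (Finsupp.single (v i) 1 + Finsupp.single Var.t 1 + Finsupp.single z (i : ℕ))

/-- The series `∑_{k ≠ 0} (|k| - 1)! / k! * v^k * t^|k| * z^||k||`, over the finitely supported
sequences `k = (k_1, k_2, …)`. -/
noncomputable def degreeSeries (v : ℕ → Var) (z : Var) : MvPowerSeries Var ℚ :=
  genSeries (fun k : {k : ℕ+ →₀ ℕ // k ≠ 0} => seqWeight v z k)
    fun k => ((k.1.degree - 1).factorial : ℚ) / (k.1.prod fun _ m => (m.factorial : ℚ))

/-- `A(a, t, x)`. -/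
noncomputable def seriesA : MvPowerSeries Var ℚ := degreeSeries Var.a Var.x

/-- `B(b, t, y)`. -/
noncomputable def seriesB : MvPowerSeries Var ℚ := degreeSeries Var.b Var.y

open Classical in
/-- `T(a, b, t, x)`: in `A(a, t, x) * B(b, t, y)` only the terms with
`deg x = deg y = deg t - 1` are kept (with `y ^ n` erased from `x ^ n * y ^ n`), and the terms
`a_0 * t` and `b_0 * t` of the two one-vertex trees are added. -/
noncomputable def seriesT : MvPowerSeries Var ℚ :=
  ofCoeff (fun d => if d Var.y = 0 ∧ d Var.t = d Var.x + 1 then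
      MvPowerSeries.coeff (d + Finsupp.single Var.y (d Var.x)) (seriesA * seriesB) else 0) +
    MvPowerSeries.X (Var.a 0) * MvPowerSeries.X Var.t +
    MvPowerSeries.X (Var.b 0) * MvPowerSeries.X Var.t

/-- The operator `v_2 x ∂/∂v_0 + ∑_{k ≥ 1} k v_{k+2} x ∂/∂v_k`. For every monomial only finitely
many summands contribute to its coefficient (those with `v_{k+2}` in the monomial). -/
noncomputable def diffOp (v : ℕ → Var) (F : MvPowerSeries Var ℚ) : MvPowerSeries Var ℚ :=
  MvPowerSeries.X (v 2) * MvPowerSeries.X Var.x * MvPowerSeries.pderiv ℚ (v 0) F +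
    ofCoeff (fun d => ∑ᶠ k : ℕ+, MvPowerSeries.coeff d
      (((k : ℕ) : MvPowerSeries Var ℚ) * MvPowerSeries.X (v (k + 2)) * MvPowerSeries.X Var.x *
        MvPowerSeries.pderiv ℚ (v k) F))

/-- `D_a`. -/
noncomputable def opDa : MvPowerSeries Var ℚ → MvPowerSeries Var ℚ := diffOp Var.a

/-- `D_b`. -/
noncomputable def opDb : MvPowerSeries Var ℚ → MvPowerSeries Var ℚ := diffOp Var.b

/-! ### Cycles of permutations -/

/-! By Euler's formula a plane map with one face is a connected map with one vertex more than edges.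
Conversely, every such map has a single face (`BMap.IsTree.sameCycle_facePerm`), so plane trees can
be counted by connectedness and cardinalities alone.

For the formula for `T`, a tree with `p` white vertices, `q` black vertices and `n` edges, all
labelled, gets weight `1 / (p! q! n!)`. By orbit-stabiliser these weights add up to `1 / #Aut` over
an isomorphism class (`labelledTreeSeries_ab`). If every vertex has a prescribed positive degree and
`n ≥ 1`, removing leaves shows that there are `n! (p-1)! (q-1)!` labelled trees, whatever the
degrees are (`BMap.card_hasDegrees`). Degrees with multiplicities `k` and `l` can be distributed
among the labelled vertices in `p!/k!` and `q!/l!` ways, so the total weight of a passport is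
`(p-1)!/k! · (q-1)!/l!`, a product of a coefficient of `A` and one of `B`. The terms kept in `A · B`
are those in which both colours have degree sum `n` and `p + q = n + 1`. The two one-vertex trees
are added separately.

For the formula for `M`, applying `D_a` amounts to choosing a corner at a white vertex, raising the
degree of that vertex by two and counting one more edge (`diffOp_genSeries`): a vertex of degree `k
≥ 1` has `k` corners, an isolated one has one. A tree with a chosen corner has no nontrivial
automorphism, so `D_a T` counts classes of rooted trees with weight one
(`diffOp_labelledTreeSeries`); `D_b T` does the same for black corners. In a `2^1`-map, merging the
two edges around the inner face leaves a tree with a distinguished edge, and deleting that edge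
leaves one tree with a white corner and one with a black corner. Joining two corners by a doubled
edge inverts this (`TwoOneMap.glueEquiv`). The two edges raise each root degree by two, which is how
the operators shift the degrees (`TwoOneMap.weight_glue`).

Cycles and connectedness are handled through invariant predicates: two elements are in one cycle
when every invariant predicate passes from one to the other. Adding or removing an edge then only
requires extending or restricting predicates. -/

theorem sameCycle_iff_forall {α : Type*} {σ : Equiv.Perm α} {x y : α} :
    σ.SameCycle x y ↔ ∀ P : α → Prop, (∀ z, P (σ z) ↔ P z) → P x → P y := by
  constructor
  · rintro ⟨i, rfl⟩ P hP hx
    induction i using Int.induction_on with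
    | zero => simpa using hx
    | succ n ih => rwa [add_comm, zpow_add, zpow_one, Equiv.Perm.mul_apply, hP]
    | pred n ih =>
      rw [← hP, ← Equiv.Perm.mul_apply, ← zpow_one_add]
      simpa using ih
  · intro h
    exact h (σ.SameCycle x) (fun z => Equiv.Perm.sameCycle_apply_right) (Equiv.Perm.SameCycle.refl _ _)

theorem sameCycle_permCongr {α β : Type*} (h : α ≃ β) (σ : Equiv.Perm α) (x y : β) :
    (h.permCongr σ).SameCycle x y ↔ σ.SameCycle (h.symm x) (h.symm y) := by
  simp only [sameCycle_iff_forall]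
  constructor
  · intro H P hP hx
    exact H (fun z => P (h.symm z)) (fun z => by simp [Equiv.permCongr_apply, hP]) hx
  · intro H P hP hx
    have := H (fun z => P (h z)) (fun z => by
      have := hP (h z)
      simpa [Equiv.permCongr_apply] using this) (by simpa using hx)
    simpa using this

/-! ### Cycles of a permutation of a disjoint sum. -/

theorem sameCycle_sumCongr_inl_inl {α β : Type*} (σ : Equiv.Perm α) (τ : Equiv.Perm β) (x y : α) :
    Equiv.Perm.SameCycle (Equiv.sumCongr σ τ : Equiv.Perm (α ⊕ β)) (.inl x) (.inl y) ↔
      σ.SameCycle x y := by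
  simp only [sameCycle_iff_forall]
  constructor
  · intro H P hP hx
    exact H (Sum.elim P fun _ => False) (by rintro (z | z) <;> simp [hP]) hx
  · intro H P hP hx
    exact H (fun z => P (.inl z)) (fun z => by simpa using hP (.inl z)) hx

theorem sameCycle_sumCongr_inr_inr {α β : Type*} (σ : Equiv.Perm α) (τ : Equiv.Perm β) (x y : β) :
    Equiv.Perm.SameCycle (Equiv.sumCongr σ τ : Equiv.Perm (α ⊕ β)) (.inr x) (.inr y) ↔
      τ.SameCycle x y := by
  simp only [sameCycle_iff_forall]
  constructor
  · intro H P hP hx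
    exact H (Sum.elim (fun _ => False) P) (by rintro (z | z) <;> simp [hP]) hx
  · intro H P hP hx
    exact H (fun z => P (.inr z)) (fun z => by simpa using hP (.inr z)) hx

theorem not_sameCycle_sumCongr_inl_inr {α β : Type*} (σ : Equiv.Perm α) (τ : Equiv.Perm β)
    (x : α) (y : β) :
    ¬ Equiv.Perm.SameCycle (Equiv.sumCongr σ τ : Equiv.Perm (α ⊕ β)) (.inl x) (.inr y) := by
  rw [sameCycle_iff_forall]
  intro H
  simpa using H (fun z => z.isLeft) (by rintro (z | z) <;> simp) (by simp)

open Classical in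
/-- Insert `none` into the cycles of a permutation: before `i` if `c = some i`, and as a fixed
point if `c = none`. -/
noncomputable def insertNone {α : Type*} (c : Option α) (σ : Equiv.Perm α) :
    Equiv.Perm (Option α) :=
  Equiv.Perm.decomposeOption.symm (c, σ)

/-! ### Splicing one element into the cycles of a permutation. -/

section insertNone

variable {α : Type*} (c : Option α) (σ : Equiv.Perm α)

theorem insertNone_none : insertNone c σ none = c := by
  simp [insertNone]

open Classical in
theorem insertNone_some (a : α) :
    insertNone c σ (some a) = if some (σ a) = c then none else some (σ a) := by
  simp only [insertNone, Equiv.Perm.decomposeOption_symm_apply, Equiv.Perm.mul_apply,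
    Equiv.optionCongr_apply, Option.map_some]
  split_ifs with h
  · rw [h, Equiv.swap_apply_right]
  · rw [Equiv.swap_apply_of_ne_of_ne (by simp) h]

theorem exists_eq_insertNone (ρ : Equiv.Perm (Option α)) : ∃ σ, ρ = insertNone (ρ none) σ := by
  classical
  refine ⟨(Equiv.Perm.decomposeOption ρ).2, ?_⟩
  have : (ρ none, (Equiv.Perm.decomposeOption ρ).2) = Equiv.Perm.decomposeOption ρ := by simp
  rw [insertNone, this]
  convert (Equiv.symm_apply_apply Equiv.Perm.decomposeOption ρ).symm

variable {c σ} in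
theorem insertNone_inj {c' : Option α} {σ' : Equiv.Perm α}
    (h : insertNone c σ = insertNone c' σ') : c = c' ∧ σ = σ' := by
  have := Equiv.injective _ h
  simpa using this

/-- Splicing replaces a step into `c` by two steps through `none`, so the only new requirement is
that `P` agrees at `none` and `c`. All same-cycle questions about `insertNone` reduce to this. -/
theorem insertNone_invariant {P : Option α → Prop} :
    (∀ z, P (insertNone c σ z) ↔ P z) ↔ (∀ a, P (some (σ a)) ↔ P (some a)) ∧ (P c ↔ P none) := by
  constructor
  · intro H
    have h0 : P c ↔ P none := by simpa [insertNone_none] using H none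
    refine ⟨fun a => ?_, h0⟩
    have h1 := H (some a)
    rw [insertNone_some] at h1
    split_ifs at h1 with h
    · rw [← h1, ← h0, h]
    · exact h1
  · rintro ⟨h1, h0⟩ (_ | a)
    · rwa [insertNone_none]
    · rw [insertNone_some]
      split_ifs with h
      · rw [← h0, ← h, h1]
      · exact h1 a

theorem sameCycle_insertNone_some_some (x y : α) :
    (insertNone c σ).SameCycle (some x) (some y) ↔ σ.SameCycle x y := by
  simp only [sameCycle_iff_forall, insertNone_invariant]
  constructor
  · intro H P hP hx
    -- `P` is extended to `none` by its value at `c`; if `none` is a fixed point, any value will do.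
    exact H (fun o => o.elim (c.elim False P) P) ⟨hP, by cases c <;> simp⟩ hx
  · intro H P hP hx
    exact H (fun z => P (some z)) hP.1 hx

theorem sameCycle_insertNone_none_some (y : α) :
    (insertNone c σ).SameCycle none (some y) ↔ ∃ i, c = some i ∧ σ.SameCycle i y := by
  have h : (insertNone c σ).SameCycle none (some y) ↔ (insertNone c σ).SameCycle c (some y) := by
    have := Equiv.Perm.sameCycle_apply_left (f := insertNone c σ) (x := none) (y := some y)
    rw [insertNone_none] at this
    exact this.symm
  rw [h]
  cases c with
  | none =>
    simp only [reduceCtorEq, false_and, exists_false, iff_false]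
    rw [sameCycle_iff_forall]
    intro H
    simpa using H (fun o => o = none) ((insertNone_invariant none σ (P := fun o => o = none)).2
      (by simp)) rfl
  | some i => simp [sameCycle_insertNone_some_some]

end insertNone

/-! ### Maps: connectedness, colour swap, relabelling -/

namespace BMap

variable {W B E W' B' E' W'' B'' E'' : Type}

@[ext]
theorem ext' {m m' : BMap W B E} (h1 : ∀ e, m.atW e = m'.atW e) (h2 : ∀ e, m.atB e = m'.atB e)
    (h3 : ∀ e, m.rotW e = m'.rotW e) (h4 : ∀ e, m.rotB e = m'.rotB e) : m = m' := by
  obtain ⟨a, b, c, d, _, _⟩ := m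
  obtain ⟨a', b', c', d', _, _⟩ := m'
  obtain rfl : a = a' := funext h1
  obtain rfl : b = b' := funext h2
  obtain rfl : c = c' := Equiv.ext h3
  obtain rfl : d = d' := Equiv.ext h4
  rfl

/-- Connectedness, as the triviality of the properties of vertices that adjacent vertices share. -/
def Conn (m : BMap W B E) : Prop :=
  Nonempty (W ⊕ B) ∧ ∀ P : W ⊕ B → Prop,
    (∀ e, P (.inl (m.atW e)) ↔ P (.inr (m.atB e))) → ∀ x y, P x → P y

/-- Shared properties propagate along walks; conversely, reachability from a vertex is itself a
property shared by adjacent vertices. -/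
theorem connected_graph_iff (m : BMap W B E) : m.graph.Connected ↔ m.Conn := by
  have hadj : ∀ e, m.graph.Adj (.inl (m.atW e)) (.inr (m.atB e)) := fun e => by
    simp only [graph, SimpleGraph.fromRel_adj]
    exact ⟨by simp, Or.inl ⟨e, rfl, rfl⟩⟩
  constructor
  · intro h
    refine ⟨h.nonempty, fun P hP x y => ?_⟩
    obtain ⟨p⟩ := h.preconnected x y
    induction p with
    | nil => exact id
    | cons hab _ ih =>
      intro hx
      apply ih
      simp only [graph, SimpleGraph.fromRel_adj] at hab
      rcases hab with ⟨_, ⟨e, rfl, rfl⟩ | ⟨e, rfl, rfl⟩⟩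
      · exact (hP e).1 hx
      · exact (hP e).2 hx
  · rintro ⟨h1, h2⟩
    refine @SimpleGraph.Connected.mk _ _ (fun x y => ?_) h1
    refine h2 (m.graph.Reachable x) (fun e => ?_) x y (SimpleGraph.Reachable.refl _)
    exact ⟨fun h => h.trans (hadj e).reachable, fun h => h.trans (hadj e).symm.reachable⟩

/-- A connected map with one vertex more than edges. -/
def IsTree (m : BMap W B E) : Prop := m.Conn ∧ Nat.card W + Nat.card B = Nat.card E + 1

/-- The map with the two colours interchanged. -/
def swap (m : BMap W B E) : BMap B W E where
  atW := m.atB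
  atB := m.atW
  rotW := m.rotB
  rotB := m.rotW
  atW_eq_iff := m.atB_eq_iff
  atB_eq_iff := m.atW_eq_iff

theorem degW_swap (m : BMap W B E) : m.swap.degW = m.degB := rfl

theorem degB_swap (m : BMap W B E) : m.swap.degB = m.degW := rfl

theorem Conn.swap {m : BMap W B E} (h : m.Conn) : m.swap.Conn := by
  refine ⟨(Equiv.sumComm W B).nonempty_congr.1 h.1, fun P hP x y => ?_⟩
  have := h.2 (fun z => P z.swap) (fun e => (hP e).symm) x.swap y.swap
  simpa using this

theorem IsTree.swap {m : BMap W B E} (h : m.IsTree) : m.swap.IsTree :=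
  ⟨h.1.swap, by rw [add_comm]; exact h.2⟩

/-- An isomorphism also respects the interchanged colours. -/
def Iso.swap {m : BMap W B E} {m' : BMap W' B' E'} (φ : Iso m m') : Iso m.swap m'.swap :=
  ⟨φ.onB, φ.onW, φ.onE, φ.map_atB, φ.map_atW, φ.map_rotB, φ.map_rotW⟩

@[ext]
theorem Iso.ext' {m : BMap W B E} {m' : BMap W' B' E'} {φ ψ : Iso m m'}
    (h1 : φ.onW = ψ.onW) (h2 : φ.onB = ψ.onB) (h3 : φ.onE = ψ.onE) : φ = ψ := by
  cases φ; cases ψ; simp_all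

/-- Transport of a map along bijections. -/
def relabel (m : BMap W B E) (f : W ≃ W') (g : B ≃ B') (h : E ≃ E') : BMap W' B' E' where
  atW e := f (m.atW (h.symm e))
  atB e := g (m.atB (h.symm e))
  rotW := h.permCongr m.rotW
  rotB := h.permCongr m.rotB
  atW_eq_iff e e' := by rw [f.apply_eq_iff_eq, m.atW_eq_iff, sameCycle_permCongr]
  atB_eq_iff e e' := by rw [g.apply_eq_iff_eq, m.atB_eq_iff, sameCycle_permCongr]

/-- A map is isomorphic to its relabellings. -/
def relabelIso (m : BMap W B E) (f : W ≃ W') (g : B ≃ B') (h : E ≃ E') :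
    Iso m (m.relabel f g h) where
  onW := f
  onB := g
  onE := h
  map_atW e := by simp [relabel]
  map_atB e := by simp [relabel]
  map_rotW e := by simp [relabel, Equiv.permCongr_apply]
  map_rotB e := by simp [relabel, Equiv.permCongr_apply]

theorem Iso.eq_relabel {m : BMap W B E} {m' : BMap W' B' E'} (φ : Iso m m') :
    m' = m.relabel φ.onW φ.onB φ.onE := by
  ext e
  · simp [relabel, φ.map_atW]
  · simp [relabel, φ.map_atB]
  · simp [relabel, Equiv.permCongr_apply, φ.map_rotW]
  · simp [relabel, Equiv.permCongr_apply, φ.map_rotB]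

theorem Iso.conn {m : BMap W B E} {m' : BMap W' B' E'} (φ : Iso m m') (h : m.Conn) : m'.Conn := by
  let s := Equiv.sumCongr φ.onW φ.onB
  refine ⟨s.nonempty_congr.1 h.1, fun P hP x y hx => ?_⟩
  have := h.2 (fun z => P (s z)) (fun e => by
    simpa [s, φ.map_atW, φ.map_atB] using hP (φ.onE e)) (s.symm x) (s.symm y)
  simp only [Equiv.apply_symm_apply] at this
  exact this hx

theorem Iso.isTree {m : BMap W B E} {m' : BMap W' B' E'} (φ : Iso m m') (h : m.IsTree) :
    m'.IsTree :=
  ⟨φ.conn h.1, by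
    rw [← Nat.card_congr φ.onW, ← Nat.card_congr φ.onB, ← Nat.card_congr φ.onE, h.2]⟩

theorem Iso.degW_eq {m : BMap W B E} {m' : BMap W' B' E'} (φ : Iso m m') (w : W) :
    m'.degW (φ.onW w) = m.degW w :=
  (Nat.card_congr (φ.onE.subtypeEquiv fun e => by
    rw [← φ.map_atW, φ.onW.apply_eq_iff_eq])).symm

theorem Iso.degB_eq {m : BMap W B E} {m' : BMap W' B' E'} (φ : Iso m m') (b : B) :
    m'.degB (φ.onB b) = m.degB b :=
  φ.swap.degW_eq b

theorem Iso.map_facePerm {m : BMap W B E} {m' : BMap W' B' E'} (φ : Iso m m') (e : E) :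
    φ.onE (m.facePerm e) = m'.facePerm (φ.onE e) := by
  simp [facePerm, φ.map_rotW, φ.map_rotB]

/-- Being an end of some edge is a property shared by adjacent vertices, and one edge is given. So a
connected map with edges has no isolated vertex. -/
theorem Conn.exists_atW_eq {m : BMap W B E} (h : m.Conn) [Nonempty E] (w : W) :
    ∃ e, m.atW e = w := by
  obtain ⟨e₀⟩ := ‹Nonempty E›
  exact h.2 (Sum.elim (fun w => ∃ e, m.atW e = w) (fun b => ∃ e, m.atB e = b))
    (fun e => by simp) (.inl (m.atW e₀)) (.inl w) ⟨e₀, rfl⟩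

theorem Conn.exists_atB_eq {m : BMap W B E} (h : m.Conn) [Nonempty E] (b : B) :
    ∃ e, m.atB e = b :=
  h.swap.exists_atW_eq b

theorem faceOf_eq_iff (m : BMap W B E) (e e' : E) :
    m.faceOf e = m.faceOf e' ↔ m.facePerm.SameCycle e e' :=
  Quotient.eq

theorem faceOf_surjective (m : BMap W B E) : Function.Surjective m.faceOf :=
  Quotient.mk_surjective

end BMap

namespace BMap

variable {W B E W' B' E' : Type}

/-! ### Trees have one face -/

/-- The coboundary map of the underlying graph. -/
def coboundary (m : BMap W B E) : (W ⊕ B → ℚ) →ₗ[ℚ] (E → ℚ) where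
  toFun g e := g (.inl (m.atW e)) - g (.inr (m.atB e))
  map_add' f g := by ext e; simp; ring
  map_smul' c g := by ext e; simp; ring

/-- A function with zero coboundary takes equal values at the ends of every edge, hence is constant
by connectedness. -/
theorem Conn.finrank_ker_coboundary {m : BMap W B E} (h : m.Conn) :
    Module.finrank ℚ (LinearMap.ker m.coboundary) ≤ 1 := by
  refine finrank_le_one (⟨fun _ => 1, ?_⟩ : LinearMap.ker m.coboundary) ?_
  · rw [LinearMap.mem_ker]
    ext e
    simp [coboundary]
  · rintro ⟨g, hg⟩
    obtain ⟨x⟩ := h.1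
    refine ⟨g x, ?_⟩
    ext y
    simp only [SetLike.mk_smul_mk, Pi.smul_apply, smul_eq_mul, mul_one]
    refine (h.2 (fun z => g z = g x) (fun e => ?_) x y rfl).symm
    have := congrFun (LinearMap.mem_ker.1 hg) e
    simp only [coboundary, LinearMap.coe_mk, AddHom.coe_mk, Pi.zero_apply, sub_eq_zero] at this
    rw [this]

/-- Rank-nullity for the coboundary: its rank is at most the number of edges and its nullity at most
one. -/
theorem Conn.card_le [Finite W] [Finite B] [Finite E] {m : BMap W B E} (h : m.Conn) :
    Nat.card W + Nat.card B ≤ Nat.card E + 1 := by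
  have := Fintype.ofFinite W
  have := Fintype.ofFinite B
  have := Fintype.ofFinite E
  have h1 := LinearMap.finrank_range_add_finrank_ker m.coboundary
  have h2 := Submodule.finrank_le (LinearMap.range m.coboundary)
  have h3 := h.finrank_ker_coboundary
  simp only [Module.finrank_fintype_fun_eq_card, Fintype.card_sum] at h1 h2
  simp only [Nat.card_eq_fintype_card]
  omega

/-- With one vertex more than edges, rank-nullity leaves no room: the rank must be the number of
edges. -/
theorem IsTree.coboundary_surjective [Finite W] [Finite B] [Finite E] {m : BMap W B E}
    (h : m.IsTree) : Function.Surjective m.coboundary := by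
  have := Fintype.ofFinite W
  have := Fintype.ofFinite B
  have := Fintype.ofFinite E
  have h1 := LinearMap.finrank_range_add_finrank_ker m.coboundary
  have h3 := h.1.finrank_ker_coboundary
  have h4 := h.2
  have h2 := Submodule.finrank_le (LinearMap.range m.coboundary)
  rw [← LinearMap.range_eq_top]
  apply Submodule.eq_top_of_finrank_eq
  simp only [Module.finrank_fintype_fun_eq_card, Fintype.card_sum, Nat.card_eq_fintype_card] at *
  omega

/-- The hypotheses say that `D` is orthogonal to every coboundary. On a tree `D` is itself a
coboundary, so it is orthogonal to itself. -/
theorem IsTree.eq_zero_of_sum_eq_zero [Finite W] [Finite B] [Fintype E] {m : BMap W B E}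
    (h : m.IsTree) (D : E → ℚ) (hW : ∀ f : W → ℚ, ∑ e, f (m.atW e) * D e = 0)
    (hB : ∀ f : B → ℚ, ∑ e, f (m.atB e) * D e = 0) (e : E) : D e = 0 := by
  obtain ⟨g, hg⟩ := h.coboundary_surjective D
  have : ∑ e, D e * D e = 0 := by
    have h1 : ∀ e, D e * D e = g (.inl (m.atW e)) * D e - g (.inr (m.atB e)) * D e := fun e => by
      rw [← sub_mul]
      conv_lhs => rw [← hg]
      simp [coboundary, ← hg]
    simp only [h1, Finset.sum_sub_distrib]
    rw [hW fun w => g (.inl w), hB fun b => g (.inr b), sub_zero]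
  rw [Finset.sum_eq_zero_iff_of_nonneg fun _ _ => mul_self_nonneg _] at this
  exact mul_self_eq_zero.1 (this e (Finset.mem_univ e))

theorem atW_rotW (m : BMap W B E) (e : E) : m.atW (m.rotW e) = m.atW e := by
  rw [m.atW_eq_iff, Equiv.Perm.sameCycle_apply_left]

theorem atB_rotB (m : BMap W B E) (e : E) : m.atB (m.rotB e) = m.atB e := by
  rw [m.atB_eq_iff, Equiv.Perm.sameCycle_apply_left]

/-- A property of edges that is invariant under both rotations is trivial on a connected map. -/
theorem Conn.edge_induction {m : BMap W B E} (h : m.Conn) (P : E → Prop)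
    (hW : ∀ e, P (m.rotW e) ↔ P e) (hB : ∀ e, P (m.rotB e) ↔ P e) (e e' : E) (he : P e) : P e' := by
  have h1 : ∀ a b, m.atW a = m.atW b → P a → P b := fun a b hab =>
    sameCycle_iff_forall.1 ((m.atW_eq_iff a b).1 hab) P hW
  have h2 : ∀ a b, m.atB a = m.atB b → P a → P b := fun a b hab =>
    sameCycle_iff_forall.1 ((m.atB_eq_iff a b).1 hab) P hB
  -- The predicate propagated through the vertices is that all edges at the vertex satisfy `P`.
  refine h.2 (Sum.elim (fun w => ∀ e, m.atW e = w → P e) (fun b => ∀ e, m.atB e = b → P e))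
    (fun e => ?_) (.inl (m.atW e)) (.inl (m.atW e')) (fun a ha => h1 _ _ ha.symm he) _ rfl
  simp only [Sum.elim_inl, Sum.elim_inr]
  exact ⟨fun H a ha => h2 _ _ ha.symm (H e rfl), fun H a ha => h1 _ _ ha.symm (H e rfl)⟩

/-- Let `f` be the indicator of a set of edges that is invariant under the face permutation. The
increment of `f` under `rotW` telescopes around each white vertex. By face invariance it is also the
increment under the inverse of `rotB`, so it telescopes around each black vertex. Hence it is
orthogonal to all coboundaries and vanishes; the set is invariant under both rotations and therefore
trivial. -/
theorem IsTree.sameCycle_facePerm [Finite W] [Finite B] [Finite E] {m : BMap W B E} (h : m.IsTree)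
    (e e' : E) : m.facePerm.SameCycle e e' := by
  classical
  have := Fintype.ofFinite E
  rw [sameCycle_iff_forall]
  intro P hP he
  let f : E → ℚ := fun e => if P e then 1 else 0
  have hf : ∀ e, f (m.rotW (m.rotB e)) = f e := fun e => by
    simp only [f]
    exact if_congr (hP e) rfl rfl
  have hPf : ∀ a b, f a = f b → (P a ↔ P b) := fun a b hab => by
    simp only [f] at hab
    split_ifs at hab with h1 h2 h2 <;> simp_all
  have hsum : ∀ (g : E → ℚ) (σ : Equiv.Perm E), (∀ e, g (σ e) = g e) →
      ∑ e, g e * (f (σ e) - f e) = 0 := fun g σ hg => by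
    simp only [mul_sub, Finset.sum_sub_distrib]
    rw [sub_eq_zero, ← Equiv.sum_comp σ fun e => g e * f e]
    simp [hg]
  -- Face invariance applied to `rotB.symm e`: turning back at the black end has the same effect on
  -- `f` as turning forward at the white end.
  have hs : ∀ e, f (m.rotB.symm e) = f (m.rotW e) := fun e => by
    rw [← hf, Equiv.apply_symm_apply]
  have hD : ∀ e, f (m.rotW e) - f e = 0 := by
    apply h.eq_zero_of_sum_eq_zero
    · exact fun g => hsum (fun e => g (m.atW e)) m.rotW fun e => by rw [m.atW_rotW]
    · intro g
      simp only [← hs]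
      refine hsum (fun e => g (m.atB e)) m.rotB.symm fun e => ?_
      conv_rhs => rw [← m.rotB.apply_symm_apply e]
      rw [m.atB_rotB]
  refine h.1.edge_induction P (fun e => hPf _ _ (sub_eq_zero.1 (hD e))) (fun e => hPf _ _ ?_) e e' he
  rw [← hf e, sub_eq_zero.1 (hD _)]

theorem IsTree.numFaces_eq_one [Finite W] [Finite B] [Finite E] {m : BMap W B E} (h : m.IsTree) :
    m.numFaces = 1 := by
  unfold numFaces
  split_ifs with hE
  · rfl
  · rw [not_isEmpty_iff] at hE
    obtain ⟨e₀⟩ := hE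
    rw [Nat.card_eq_one_iff_unique]
    refine ⟨⟨fun a b => ?_⟩, ⟨m.faceOf e₀⟩⟩
    obtain ⟨a, rfl⟩ := m.faceOf_surjective a
    obtain ⟨b, rfl⟩ := m.faceOf_surjective b
    rw [faceOf_eq_iff]
    exact h.sameCycle_facePerm a b

/-- The plane maps with one face are the connected maps with one vertex more than edges. -/
theorem isPlane_and_numFaces_eq_one_iff [Finite W] [Finite B] [Finite E] (m : BMap W B E) :
    m.IsPlane ∧ m.numFaces = 1 ↔ m.IsTree := by
  constructor
  · rintro ⟨⟨h1, h2⟩, h3⟩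
    exact ⟨m.connected_graph_iff.1 h1, by omega⟩
  · intro h
    have := h.numFaces_eq_one
    exact ⟨⟨m.connected_graph_iff.2 h.1, by have := h.2; omega⟩, this⟩

/-! ### Inserting an edge -/

/-- `c` is a corner at the vertex `u`, described by the edge that follows it; an isolated vertex
has the single corner `none`. -/
def IsCorner (f : E → W) (u : W) (c : Option E) : Prop :=
  (∀ i, c = some i → f i = u) ∧ (c = none → ∀ e, f e ≠ u)

theorem isCorner_some {f : E → W} {u : W} {i : E} : IsCorner f u (some i) ↔ f i = u := by
  simp [IsCorner]

theorem isCorner_none {f : E → W} {u : W} : IsCorner f u none ↔ ∀ e, f e ≠ u := by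
  simp [IsCorner]

/-- A new edge spliced in at a corner of `u` joins the cycle of `u`, or forms a cycle of its own if
`u` was isolated. Thus cycles still correspond to vertices. -/
theorem insertNone_eq_iff {f : E → W} {σ : Equiv.Perm E}
    (hf : ∀ e e', f e = f e' ↔ σ.SameCycle e e') {u : W} {c : Option E} (hc : IsCorner f u c)
    (x y : Option E) : x.elim u f = y.elim u f ↔ (insertNone c σ).SameCycle x y := by
  have key : ∀ e, u = f e ↔ (insertNone c σ).SameCycle none (some e) := fun e => by
    rw [sameCycle_insertNone_none_some]
    cases c with
    | none => simpa using (isCorner_none.1 hc e).symm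
    | some i => simp [← hf, isCorner_some.1 hc]
  cases x <;> cases y
  · simp [Equiv.Perm.SameCycle.refl]
  · exact key _
  · rw [Equiv.Perm.sameCycle_comm, ← key, eq_comm]; rfl
  · simp [sameCycle_insertNone_some_some, hf]

/-- Insert an edge between a white corner and a black corner. -/
noncomputable def insertEdge (m : BMap W B E) {u : W} {c : Option E} {v : B} {c' : Option E}
    (hu : IsCorner m.atW u c) (hv : IsCorner m.atB v c') : BMap W B (Option E) where
  atW o := o.elim u m.atW
  atB o := o.elim v m.atB
  rotW := insertNone c m.rotW
  rotB := insertNone c' m.rotB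
  atW_eq_iff := insertNone_eq_iff m.atW_eq_iff hu
  atB_eq_iff := insertNone_eq_iff m.atB_eq_iff hv

/-- The successor of the new edge lies at the same vertex; if the edge is its own successor, no
other edge is there. -/
theorem isCorner_of_insertNone {f : Option E → W} {c : Option E} {σ : Equiv.Perm E}
    (hf : ∀ e e', f e = f e' ↔ (insertNone c σ).SameCycle e e') :
    IsCorner (fun e => f (some e)) (f none) c := by
  cases c with
  | none =>
    rw [isCorner_none]
    intro e he
    rw [eq_comm, hf, sameCycle_insertNone_none_some] at he
    simp at he
  | some i =>
    rw [isCorner_some, eq_comm, hf, sameCycle_insertNone_none_some]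
    exact ⟨i, rfl, Equiv.Perm.SameCycle.refl _ _⟩

/-- Delete the edge `none`; its successors around the two ends record the corners in which it lay.
Together with `insertEdge_inj` this makes insertion a bijective encoding. -/
theorem exists_eq_insertEdge (m : BMap W B (Option E)) :
    ∃ (m₀ : BMap W B E) (u : W) (c : Option E) (v : B) (c' : Option E)
      (hu : IsCorner m₀.atW u c) (hv : IsCorner m₀.atB v c'), m = m₀.insertEdge hu hv := by
  obtain ⟨atW, atB, rotW, rotB, hW, hB⟩ := m
  obtain ⟨σ, hσ⟩ := exists_eq_insertNone rotW
  obtain ⟨τ, hτ⟩ := exists_eq_insertNone rotB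
  generalize rotW none = c at hσ
  generalize rotB none = c' at hτ
  subst hσ hτ
  refine ⟨⟨fun e => atW (some e), fun e => atB (some e), σ, τ, fun e e' => ?_, fun e e' => ?_⟩,
    atW none, c, atB none, c', isCorner_of_insertNone hW, isCorner_of_insertNone hB, ?_⟩
  · rw [hW, sameCycle_insertNone_some_some]
  · rw [hB, sameCycle_insertNone_some_some]
  · ext e
    · cases e <;> rfl
    · cases e <;> rfl
    · rfl
    · rfl

theorem insertEdge_inj {m m' : BMap W B E} {u u' : W} {v v' : B} {c c' d d' : Option E}
    {hu : IsCorner m.atW u c} {hv : IsCorner m.atB v d}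
    {hu' : IsCorner m'.atW u' c'} {hv' : IsCorner m'.atB v' d'}
    (h : m.insertEdge hu hv = m'.insertEdge hu' hv') :
    m = m' ∧ u = u' ∧ v = v' ∧ c = c' ∧ d = d' := by
  have h1 : ∀ o : Option E, o.elim u m.atW = o.elim u' m'.atW := fun o =>
    congrArg (fun n => n.atW o) h
  have h2 : ∀ o : Option E, o.elim v m.atB = o.elim v' m'.atB := fun o =>
    congrArg (fun n => n.atB o) h
  obtain ⟨h3, h4⟩ := insertNone_inj (congrArg (fun n => n.rotW) h)
  obtain ⟨h5, h6⟩ := insertNone_inj (congrArg (fun n => n.rotB) h)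
  refine ⟨?_, h1 none, h2 none, h3, h5⟩
  ext e
  · exact h1 (some e)
  · exact h2 (some e)
  · rw [h4]
  · rw [h6]

theorem card_option_fiber [Finite E] (f : E → W) (u w : W) [Decidable (u = w)] :
    Nat.card {o : Option E // o.elim u f = w} =
      Nat.card {e : E // f e = w} + if u = w then 1 else 0 := by
  classical
  have := Fintype.ofFinite E
  simp only [Nat.card_eq_fintype_card, Fintype.card_subtype, Finset.card_filter, Fintype.sum_option,
    Option.elim_none, Option.elim_some]
  rw [add_comm]
  congr

theorem degW_insertEdge [Finite E] (m : BMap W B E) {u : W} {c : Option E} {v : B} {c' : Option E}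
    (hu : IsCorner m.atW u c) (hv : IsCorner m.atB v c') (w : W) [Decidable (u = w)] :
    (m.insertEdge hu hv).degW w = m.degW w + if u = w then 1 else 0 :=
  card_option_fiber _ _ _

theorem degB_insertEdge [Finite E] (m : BMap W B E) {u : W} {c : Option E} {v : B} {c' : Option E}
    (hu : IsCorner m.atW u c) (hv : IsCorner m.atB v c') (b : B) [Decidable (v = b)] :
    (m.insertEdge hu hv).degB b = m.degB b + if v = b then 1 else 0 :=
  card_option_fiber _ _ _

/-- The inserted edge only adds the requirement that a shared property agrees at `u` and `v`. -/
theorem conn_insertEdge (m : BMap W B E) {u : W} {c : Option E} {v : B} {c' : Option E}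
    (hu : IsCorner m.atW u c) (hv : IsCorner m.atB v c') :
    (m.insertEdge hu hv).Conn ↔ ∀ P : W ⊕ B → Prop,
      (∀ e, P (.inl (m.atW e)) ↔ P (.inr (m.atB e))) → (P (.inl u) ↔ P (.inr v)) →
        ∀ x y, P x → P y := by
  constructor
  · intro h P hP huv
    exact h.2 P (by rintro (_ | e); exacts [huv, hP e])
  · intro h
    exact ⟨⟨.inl u⟩, fun P hP => h P (fun e => hP (some e)) (hP none)⟩

end BMap

theorem card_sigma_of_card_eq {α : Type*} {β : α → Type*} [Finite α] [∀ a, Finite (β a)] {k : ℕ}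
    (h : ∀ a, Nat.card (β a) = k) : Nat.card (Σ a, β a) = Nat.card α * k := by
  have := Fintype.ofFinite α
  rw [Nat.card_sigma, Finset.sum_const_nat fun a _ => h a, Finset.card_univ,
    Nat.card_eq_fintype_card]

namespace BMap

variable {W B E W' B' E' : Type}

/-! ### Counting trees with labelled vertices and edges by their degrees -/

/-- Relabelling as a bijection. -/
def relabelEquiv (f : W ≃ W') (g : B ≃ B') (h : E ≃ E') : BMap W B E ≃ BMap W' B' E' where
  toFun m := m.relabel f g h
  invFun m := m.relabel f.symm g.symm h.symm
  left_inv m := by ext e <;> simp [relabel, Equiv.permCongr_apply]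
  right_inv m := by ext e <;> simp [relabel, Equiv.permCongr_apply]

theorem conn_relabel (m : BMap W B E) (f : W ≃ W') (g : B ≃ B') (h : E ≃ E') :
    (m.relabel f g h).Conn ↔ m.Conn :=
  ⟨(m.relabelIso f g h).symm.conn, (m.relabelIso f g h).conn⟩

theorem degW_relabel (m : BMap W B E) (f : W ≃ W') (g : B ≃ B') (h : E ≃ E') (w : W) :
    (m.relabel f g h).degW (f w) = m.degW w :=
  (m.relabelIso f g h).degW_eq w

theorem degB_relabel (m : BMap W B E) (f : W ≃ W') (g : B ≃ B') (h : E ≃ E') (b : B) :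
    (m.relabel f g h).degB (g b) = m.degB b :=
  (m.relabelIso f g h).degB_eq b

/-- `m` is connected with the given degrees. -/
def HasDegrees (m : BMap W B E) (d : W → ℕ) (e : B → ℕ) : Prop :=
  m.Conn ∧ m.degW = d ∧ m.degB = e

theorem hasDegrees_relabel (m : BMap W B E) (f : W ≃ W') (g : B ≃ B') (h : E ≃ E')
    (d : W' → ℕ) (e : B' → ℕ) :
    (m.relabel f g h).HasDegrees d e ↔ m.HasDegrees (d ∘ f) (e ∘ g) := by
  unfold HasDegrees
  rw [conn_relabel, ← f.surjective.injective_comp_right.eq_iff,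
    ← g.surjective.injective_comp_right.eq_iff]
  simp only [Function.comp_def, degW_relabel, degB_relabel]

theorem card_hasDegrees_relabel (f : W ≃ W') (g : B ≃ B') (h : E ≃ E') (d : W' → ℕ) (e : B' → ℕ) :
    Nat.card {m : BMap W' B' E' // m.HasDegrees d e} =
      Nat.card {m : BMap W B E // m.HasDegrees (d ∘ f) (e ∘ g)} :=
  (Nat.card_congr ((relabelEquiv f g h).subtypeEquiv fun m =>
    (hasDegrees_relabel m f g h d e).symm)).symm

theorem card_hasDegrees_swap (d : W → ℕ) (e : B → ℕ) :
    Nat.card {m : BMap W B E // m.HasDegrees d e} =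
      Nat.card {m : BMap B W E // m.HasDegrees e d} :=
  Nat.card_congr ⟨fun m => ⟨m.1.swap, m.2.1.swap, m.2.2.2, m.2.2.1⟩,
    fun m => ⟨m.1.swap, m.2.1.swap, m.2.2.2, m.2.2.1⟩, fun _ => rfl, fun _ => rfl⟩

theorem sum_degW [Fintype W] [Finite E] (m : BMap W B E) : ∑ w, m.degW w = Nat.card E := by
  classical
  have := Fintype.ofFinite E
  unfold degW
  rw [← Nat.card_sigma]
  exact Nat.card_congr (Equiv.sigmaFiberEquiv m.atW)

/-- Add an isolated white vertex. -/
def addIsolated (m : BMap W B E) : BMap (Option W) B E where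
  atW e := some (m.atW e)
  atB := m.atB
  rotW := m.rotW
  rotB := m.rotB
  atW_eq_iff e e' := by rw [Option.some_inj, m.atW_eq_iff]
  atB_eq_iff := m.atB_eq_iff

theorem addIsolated_injective : Function.Injective (addIsolated : BMap W B E → _) := by
  intro m m' h
  ext e
  · exact Option.some_injective _ (congrArg (fun n => n.atW e) h)
  · exact congrArg (fun n => n.atB e) h
  · exact congrArg (fun n => n.rotW e) h
  · exact congrArg (fun n => n.rotB e) h

theorem exists_eq_addIsolated (m : BMap (Option W) B E) (h : ∀ e, m.atW e ≠ none) :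
    ∃ m', m = addIsolated m' := by
  choose f hf using fun e => Option.ne_none_iff_exists'.1 (h e)
  refine ⟨⟨f, m.atB, m.rotW, m.rotB, fun e e' => ?_, m.atB_eq_iff⟩, ?_⟩
  · rw [← m.atW_eq_iff, hf, hf, Option.some_inj]
  · ext1 e
    · exact hf e
    all_goals rfl

/-- Attach a white leaf before the edge `i` around its black end. -/
noncomputable def attachLeaf (m : BMap W B E) (i : E) : BMap (Option W) B (Option E) :=
  m.addIsolated.insertEdge (u := none) (c := none) (v := m.atB i) (c' := some i)
    (isCorner_none.2 fun _ => by simp [addIsolated]) (isCorner_some.2 rfl)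

theorem conn_attachLeaf (m : BMap W B E) (i : E) : (m.attachLeaf i).Conn ↔ m.Conn := by
  unfold attachLeaf
  rw [conn_insertEdge]
  constructor
  · intro h
    refine ⟨⟨.inl (m.atW i)⟩, fun P hP x y => ?_⟩
    -- The leaf gets the value of `P` at its only neighbour.
    have := h (Sum.elim (fun o => o.elim (P (.inr (m.atB i))) fun w => P (.inl w))
      fun b => P (.inr b)) hP (by simp) (x.map some id) (y.map some id)
    rcases x with x | x <;> rcases y with y | y <;> simpa using this
  · rintro ⟨_, h⟩ P hP h0
    have key := h (fun z => P (z.map some id)) hP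
    have h1 : ∀ x, P x → P (.inr (m.atB i)) := by
      rintro ((_ | x) | x) hx
      · exact h0.1 hx
      · exact key (.inl x) (.inr (m.atB i)) hx
      · exact key (.inr x) (.inr (m.atB i)) hx
    rintro x ((_ | y) | y) hx
    · exact h0.2 (h1 x hx)
    · exact key (.inr (m.atB i)) (.inl y) (h1 x hx)
    · exact key (.inr (m.atB i)) (.inr y) (h1 x hx)

theorem degW_addIsolated_none (m : BMap W B E) : m.addIsolated.degW none = 0 := by
  unfold degW
  have : IsEmpty {e : E // m.addIsolated.atW e = none} := ⟨fun e => by simpa [addIsolated] using e.2⟩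
  simp

theorem degW_addIsolated_some (m : BMap W B E) (w : W) : m.addIsolated.degW (some w) = m.degW w := by
  simp [degW, addIsolated]

theorem hasDegrees_attachLeaf [Finite E] [DecidableEq B] (m : BMap W B E) (i : E)
    (d : Option W → ℕ) (e : B → ℕ) :
    (m.attachLeaf i).HasDegrees d e ↔ d none = 1 ∧
      m.Conn ∧ m.degW = (fun w => d (some w)) ∧ ∀ b, m.degB b + (if m.atB i = b then 1 else 0) = e b := by
  classical
  unfold HasDegrees
  rw [conn_attachLeaf]
  have h1 : (m.attachLeaf i).degW = d ↔ d none = 1 ∧ m.degW = fun w => d (some w) := by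
    simp only [funext_iff, Option.forall, attachLeaf, degW_insertEdge, degW_addIsolated_none,
      degW_addIsolated_some]
    simp [eq_comm]
  have h2 : (m.attachLeaf i).degB = e ↔ ∀ b, m.degB b + (if m.atB i = b then 1 else 0) = e b := by
    simp only [funext_iff, attachLeaf, degB_insertEdge]
    rfl
  rw [h1, h2]
  tauto

theorem attachLeaf_inj {m m' : BMap W B E} {i i' : E} (h : m.attachLeaf i = m'.attachLeaf i') :
    m = m' ∧ i = i' := by
  obtain ⟨h1, _, _, _, h5⟩ := insertEdge_inj h
  exact ⟨addIsolated_injective h1, Option.some_injective _ h5⟩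

/-- The edge `none` is the only edge at the vertex `none`, so deleting it leaves that vertex
isolated. -/
theorem exists_eq_attachLeaf [Finite E] [Nonempty W] (m : BMap (Option W) B (Option E))
    (hm : m.Conn) (h0 : m.atW none = none) (h1 : m.degW none = 1) :
    ∃ (m' : BMap W B E) (i : E), m = m'.attachLeaf i := by
  classical
  obtain ⟨m₀, u, c, v, c', hu, hv, rfl⟩ := m.exists_eq_insertEdge
  obtain rfl : u = none := h0
  rw [degW_insertEdge] at h1
  have h2 : m₀.degW none = 0 := by simpa using h1
  have h3 : ∀ e, m₀.atW e ≠ none := fun e he => by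
    have : Nonempty {e : E // m₀.atW e = none} := ⟨⟨e, he⟩⟩
    exact Nat.card_pos.ne' h2
  obtain ⟨m', rfl⟩ := m₀.exists_eq_addIsolated h3
  obtain rfl : c = none := by
    cases c with
    | none => rfl
    | some j => exact absurd (isCorner_some.1 hu) (h3 j)
  cases c' with
  | none =>
    exfalso
    -- If the black end became isolated too, the edge and its two ends would be a whole component
    -- that misses `w`.
    obtain ⟨w⟩ := ‹Nonempty W›
    have := (conn_insertEdge _ _ _).1 hm (fun x => x = .inl none ∨ x = .inr v)
      (fun e => by simp [addIsolated, show m'.atB e ≠ v from isCorner_none.1 hv e])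
      (by simp) (.inl none) (.inl (some w)) (by simp)
    simp at this
  | some i =>
    obtain rfl := isCorner_some.1 hv
    exact ⟨m', i, rfl⟩

/-- Sort the trees by the black neighbour `b` of the leaf. Without the leaf, `b` has degree `e b -
1`, and the leaf can be put back before any of its `e b - 1` edges. For `e b = 1` the last factor
vanishes. -/
theorem card_hasDegrees_atW_none [Finite W] [Fintype B] [Finite E] [DecidableEq B] [Nonempty W]
    (d : Option W → ℕ) (e : B → ℕ) (hd : d none = 1) (he : ∀ b, 1 ≤ e b) :
    Nat.card {m : BMap (Option W) B (Option E) // m.HasDegrees d e ∧ m.atW none = none} =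
      ∑ b, Nat.card {m : BMap W B E //
        m.HasDegrees (fun w => d (some w)) (Function.update e b (e b - 1))} * (e b - 1) := by
  have key : ∀ (m : BMap W B E) (b : B),
      (∀ b', m.degB b' + (if b = b' then 1 else 0) = e b') ↔
        m.degB = Function.update e b (e b - 1) := fun m b => by
    rw [funext_iff]
    refine forall_congr' fun b' => ?_
    by_cases hb : b = b'
    · subst hb
      have := he b
      simp only [if_true, Function.update_self]
      omega
    · simp [hb, Function.update_of_ne (Ne.symm hb)]
  have e1 : Nat.card (Σ b, Σ m : {m : BMap W B E //
        m.HasDegrees (fun w => d (some w)) (Function.update e b (e b - 1))},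
          {i // m.1.atB i = b}) =
      Nat.card {m : BMap (Option W) B (Option E) // m.HasDegrees d e ∧ m.atW none = none} := by
    refine Nat.card_congr (Equiv.ofBijective (fun s => ⟨s.2.1.1.attachLeaf s.2.2.1, ?_, rfl⟩)
      ⟨?_, ?_⟩)
    · rw [hasDegrees_attachLeaf]
      refine ⟨hd, s.2.1.2.1, s.2.1.2.2.1, ?_⟩
      rw [s.2.2.2, key]
      exact s.2.1.2.2.2
    · rintro ⟨b, ⟨m, hm⟩, i, hi⟩ ⟨b', ⟨m', hm'⟩, i', hi'⟩ h
      obtain ⟨rfl, rfl⟩ := attachLeaf_inj (congrArg Subtype.val h)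
      dsimp only at hi hi'
      obtain rfl : b = b' := hi.symm.trans hi'
      rfl
    · rintro ⟨m, hm, h0⟩
      obtain ⟨m', i, rfl⟩ := exists_eq_attachLeaf m hm.1 h0 (by rw [hm.2.1, hd])
      rw [hasDegrees_attachLeaf] at hm
      exact ⟨⟨m'.atB i, ⟨m', hm.2.1, hm.2.2.1, (key _ _).1 hm.2.2.2⟩, i, rfl⟩, rfl⟩
  rw [← e1, Nat.card_sigma]
  refine Finset.sum_congr rfl fun b _ => ?_
  apply card_sigma_of_card_eq
  rintro ⟨m, hm⟩
  have := congrFun hm.2.2 b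
  rw [Function.update_self] at this
  exact this

/-- Exactly one edge ends at the leaf, and exchanging edge labels shows that each label occurs there
equally often. -/
theorem card_hasDegrees_eq_mul [Finite W] [Finite B] [Finite E]
    (d : Option W → ℕ) (e : B → ℕ) (hd : d none = 1) :
    Nat.card {m : BMap (Option W) B (Option E) // m.HasDegrees d e} = (Nat.card E + 1) *
      Nat.card {m : BMap (Option W) B (Option E) // m.HasDegrees d e ∧ m.atW none = none} := by
  classical
  have h1 : Nat.card (Σ m : {m : BMap (Option W) B (Option E) // m.HasDegrees d e},
      {i // m.1.atW i = none}) =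
        Nat.card {m : BMap (Option W) B (Option E) // m.HasDegrees d e} := by
    rw [card_sigma_of_card_eq (k := 1), mul_one]
    rintro ⟨m, hm⟩
    exact (congrFun hm.2.1 none).trans hd
  have h2 : Nat.card (Σ i : Option E,
      {m : BMap (Option W) B (Option E) // m.HasDegrees d e ∧ m.atW i = none}) =
      Nat.card (Σ m : {m : BMap (Option W) B (Option E) // m.HasDegrees d e},
        {i // m.1.atW i = none}) :=
    Nat.card_congr ⟨fun s => ⟨⟨s.2.1, s.2.2.1⟩, s.1, s.2.2.2⟩, fun s => ⟨s.2.1, s.1.1, s.1.2, s.2.2⟩,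
      fun _ => rfl, fun _ => rfl⟩
  rw [← h1, ← h2, card_sigma_of_card_eq (k := Nat.card
    {m : BMap (Option W) B (Option E) // m.HasDegrees d e ∧ m.atW none = none}),
    Finite.card_option]
  intro i
  refine Nat.card_congr ((relabelEquiv (Equiv.refl _) (Equiv.refl _)
    (Equiv.swap none i)).subtypeEquiv fun m => ?_)
  change _ ↔ (m.relabel _ _ _).HasDegrees d e ∧ _
  rw [hasDegrees_relabel]
  simp [relabelEquiv, relabel]

theorem card_hasDegrees_of_card_eq_one [Fintype W] [Fintype B] [Finite E] (d : W → ℕ) (e : B → ℕ)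
    (hE : Nat.card E = 1) (hW : Nat.card W = 1) (hB : Nat.card B = 1)
    (hsd : ∑ w, d w = 1) (hse : ∑ b, e b = 1) :
    Nat.card {m : BMap W B E // m.HasDegrees d e} = 1 := by
  rw [Nat.card_eq_one_iff_unique] at hE hW hB
  obtain ⟨_, ⟨i⟩⟩ := hE
  obtain ⟨_, ⟨w⟩⟩ := hW
  obtain ⟨_, ⟨b⟩⟩ := hB
  rw [Nat.card_eq_one_iff_unique]
  refine ⟨⟨fun m m' => Subtype.ext (ext' ?_ ?_ ?_ ?_)⟩, ⟨⟨⟨fun _ => w, fun _ => b, 1, 1,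
    fun e e' => ?_, fun e e' => ?_⟩, ⟨⟨.inl w⟩, fun P hP x y hx => ?_⟩, ?_, ?_⟩⟩⟩
  any_goals intro _; exact Subsingleton.elim _ _
  · simp [Subsingleton.elim e e', Equiv.Perm.SameCycle.refl]
  · simp [Subsingleton.elim e e', Equiv.Perm.SameCycle.refl]
  · have h := hP i
    dsimp only at h
    rcases x with x | x <;> rcases y with y | y <;>
      first
        | rwa [Subsingleton.elim y x]
        | (rw [Subsingleton.elim x w] at hx; rw [Subsingleton.elim y b]; exact h.1 hx)
        | (rw [Subsingleton.elim x b] at hx; rw [Subsingleton.elim y w]; exact h.2 hx)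
  · have := Fintype.ofFinite E
    rw [Fintype.sum_subsingleton _ w] at hsd
    ext w'
    rw [Subsingleton.elim w' w, hsd]
    simp only [degW]
    exact Nat.card_eq_one_iff_unique.2 ⟨inferInstance, ⟨i, trivial⟩⟩
  · rw [Fintype.sum_subsingleton _ b] at hse
    ext b'
    rw [Subsingleton.elim b' b, hse]
    simp only [degB]
    exact Nat.card_eq_one_iff_unique.2 ⟨inferInstance, ⟨i, trivial⟩⟩

/-- The number of plane trees with labelled vertices and edges depends on the degrees only through
the numbers of vertices. -/
theorem card_hasDegrees (n : ℕ) : ∀ (W B E : Type) [Fintype W] [Fintype B] [Finite E]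
    (d : W → ℕ) (e : B → ℕ), Nat.card E = n + 1 → Nat.card W + Nat.card B = n + 2 →
    (∀ w, 1 ≤ d w) → (∀ b, 1 ≤ e b) → ∑ w, d w = n + 1 → ∑ b, e b = n + 1 →
    Nat.card {m : BMap W B E // m.HasDegrees d e} =
      (n + 1).factorial * (Nat.card W - 1).factorial * (Nat.card B - 1).factorial := by
  induction n with
  | zero =>
    intro W B E _ _ _ d e hE hV hd he hsd hse
    have hW : Nat.card W ≠ 0 := fun h => by
      rw [Nat.card_eq_fintype_card, Fintype.card_eq_zero_iff] at h
      simp at hsd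
    have hB : Nat.card B ≠ 0 := fun h => by
      rw [Nat.card_eq_fintype_card, Fintype.card_eq_zero_iff] at h
      simp at hse
    have hW1 : Nat.card W = 1 := by omega
    have hB1 : Nat.card B = 1 := by omega
    rw [card_hasDegrees_of_card_eq_one d e hE hW1 hB1 hsd hse, hW1, hB1]
    rfl
  | succ n ih =>
    -- The recursion needs a white leaf. A black one is handled afterwards by interchanging the
    -- colours.
    have main : ∀ (W B E : Type) [Fintype W] [Fintype B] [Finite E]
        (d : W → ℕ) (e : B → ℕ), Nat.card E = n + 2 → Nat.card W + Nat.card B = n + 3 →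
        (∀ w, 1 ≤ d w) → (∀ b, 1 ≤ e b) → ∑ w, d w = n + 2 → ∑ b, e b = n + 2 →
        (∃ w, d w = 1) → Nat.card {m : BMap W B E // m.HasDegrees d e} =
          (n + 2).factorial * (Nat.card W - 1).factorial * (Nat.card B - 1).factorial := by
      classical
      intro W B E _ _ _ d e hE hV hd he hsd hse ⟨w₀, hw₀⟩
      -- The leaf contributes only one to a degree sum of at least two, so there is another white
      -- vertex.
      have hne : Nonempty {w // w ≠ w₀} := by
        by_contra hcon
        rw [not_nonempty_iff] at hcon
        have : ∀ w, w = w₀ := fun w => by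
          by_contra h
          exact hcon.false ⟨w, h⟩
        rw [Fintype.sum_eq_single w₀ fun w h => absurd (this w) h] at hsd
        omega
      obtain ⟨i₀⟩ : Nonempty E := (Nat.card_pos_iff.1 (by omega)).1
      let f : Option {w // w ≠ w₀} ≃ W := Equiv.optionSubtypeNe w₀
      let h : Option {i // i ≠ i₀} ≃ E := Equiv.optionSubtypeNe i₀
      have hcE : Nat.card {i // i ≠ i₀} = n + 1 := by
        have := Nat.card_congr h
        rw [Finite.card_option] at this
        omega
      have hcW : Nat.card {w // w ≠ w₀} + 1 = Nat.card W := by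
        rw [← Nat.card_congr f, Finite.card_option]
      have hdf : (d ∘ f) none = 1 := by simp [f, hw₀]
      have hcW' : 0 < Nat.card {w // w ≠ w₀} := Nat.card_pos
      rw [card_hasDegrees_relabel f (Equiv.refl B) h, card_hasDegrees_eq_mul _ _ hdf,
        card_hasDegrees_atW_none _ _ hdf (show ∀ b, 1 ≤ (e ∘ Equiv.refl B) b from he), hcE]
      -- For `e b = 1` both sides vanish because of the last factor; otherwise the lowered degrees
      -- are still positive and the induction hypothesis applies.
      have hterm : ∀ b, Nat.card {m : BMap {w // w ≠ w₀} B {i // i ≠ i₀} //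
          m.HasDegrees (fun w => (d ∘ f) (some w)) (Function.update (e ∘ Equiv.refl B) b
            ((e ∘ Equiv.refl B) b - 1))} * ((e ∘ Equiv.refl B) b - 1) =
          ((n + 1).factorial * (Nat.card {w // w ≠ w₀} - 1).factorial *
            (Nat.card B - 1).factorial) * (e b - 1) := fun b => by
        simp only [Equiv.coe_refl, Function.comp_id]
        rcases Nat.eq_zero_or_pos (e b - 1) with h0 | h0
        · simp [h0]
        · congr 1
          apply ih
          · exact hcE
          · omega
          · exact fun w => hd _
          · intro b'
            by_cases hb : b' = b
            · subst hb; rw [Function.update_self]; exact h0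
            · rw [Function.update_of_ne hb]; exact he b'
          · rw [← Equiv.sum_comp f d, Fintype.sum_option] at hsd
            simp only [Function.comp_apply] at hdf ⊢
            omega
          · have h1 := Finset.add_sum_erase Finset.univ e (Finset.mem_univ b)
            have h2 := Finset.add_sum_erase Finset.univ (Function.update e b (e b - 1))
              (Finset.mem_univ b)
            rw [Function.update_self, Finset.sum_congr rfl fun x hx =>
              Function.update_of_ne (Finset.ne_of_mem_erase hx) _ _] at h2
            omega
      rw [Finset.sum_congr rfl fun b _ => hterm b, ← Finset.mul_sum]
      -- With `p` white and `q` black vertices, the sum is `(n + 2) - q = p - 1`, the factor that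
      -- turns `(p-2)!` into `(p-1)!`.
      have hsum : ∑ b, (e b - 1) = Nat.card {w // w ≠ w₀} := by
        have h1 : ∑ b, (e b - 1) + ∑ _b : B, 1 = ∑ b, e b := by
          rw [← Finset.sum_add_distrib]
          exact Finset.sum_congr rfl fun b _ => Nat.sub_add_cancel (he b)
        rw [Finset.sum_const, Finset.card_univ, smul_eq_mul, mul_one, ← Nat.card_eq_fintype_card]
          at h1
        omega
      rw [hsum, ← hcW, Nat.add_sub_cancel]
      obtain ⟨k, hk⟩ : ∃ k, Nat.card {w // w ≠ w₀} = k + 1 := ⟨_, (Nat.sub_add_cancel hcW').symm⟩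
      rw [hk, Nat.add_sub_cancel, Nat.factorial_succ k, Nat.factorial_succ (n + 1)]
      ring
    intro W B E _ _ _ d e hE hV hd he hsd hse
    by_cases hleaf : ∃ w, d w = 1
    · exact main W B E d e hE hV hd he hsd hse hleaf
    · rw [card_hasDegrees_swap, main B W E e d hE (by omega) he hd hse hsd ?_]
      · ring
      · by_contra hleaf'
        -- Without leaves all degrees are at least two, so there are at most `n + 2` vertices in
        -- total instead of `n + 3`.
        push Not at hleaf hleaf'
        have h1 : ∑ w : W, 2 ≤ ∑ w, d w := Finset.sum_le_sum fun w _ => by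
          have := hd w; have := hleaf w; omega
        have h2 : ∑ b : B, 2 ≤ ∑ b, e b := Finset.sum_le_sum fun b _ => by
          have := he b; have := hleaf' b; omega
        simp only [Finset.sum_const, Finset.card_univ, smul_eq_mul, ← Nat.card_eq_fintype_card]
          at h1 h2
        omega

end BMap

/-! ### Formal sums of monomials -/

theorem finsum_fiberwise {α β : Type*} [Finite α] (g : α → β) (f : α → ℚ) :
    ∑ᶠ a, f a = ∑ᶠ b, ∑ᶠ a : {a // g a = b}, f a := by
  classical
  have := Fintype.ofFinite α
  have h : ∀ b, ∑ᶠ a : {a // g a = b}, f a = ∑ a with g a = b, f a := fun b => by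
    rw [finsum_eq_sum_of_fintype]
    exact (Finset.sum_subtype _ (by simp) _).symm
  simp only [h]
  rw [finsum_eq_sum_of_fintype, finsum_eq_sum_of_support_subset (s := Finset.univ.image g)]
  · exact (Finset.sum_fiberwise_of_maps_to (fun a _ => Finset.mem_image_of_mem g (Finset.mem_univ a))
      f).symm
  · intro b hb
    obtain ⟨a, ha, -⟩ := Finset.exists_ne_zero_of_sum_ne_zero hb
    simp only [Finset.coe_image, Finset.coe_univ, Set.image_univ, Set.mem_range]
    exact ⟨a, (Finset.mem_filter.1 ha).2⟩

theorem finsum_const_eq {α : Type*} [Finite α] (c : ℚ) : ∑ᶠ _ : α, c = Nat.card α * c := by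
  have := Fintype.ofFinite α
  rw [finsum_eq_sum_of_fintype, Finset.sum_const, Finset.card_univ, Nat.card_eq_fintype_card,
    nsmul_eq_mul]

theorem finsum_sigma_eq {α : Type*} {β : α → Type*} [Finite α] [∀ a, Finite (β a)]
    (f : (Σ a, β a) → ℚ) : ∑ᶠ s, f s = ∑ᶠ a, ∑ᶠ b : β a, f ⟨a, b⟩ := by
  have := Fintype.ofFinite α
  have := fun a => Fintype.ofFinite (β a)
  simp only [finsum_eq_sum_of_fintype, Fintype.sum_sigma]

theorem coeff_genSeries {ι : Type} (wt : ι → Var →₀ ℕ) (c : ι → ℚ) (d : Var →₀ ℕ) :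
    MvPowerSeries.coeff d (genSeries wt c) = ∑ᶠ i : {i : ι // wt i = d}, c i := rfl

theorem coeff_ofCoeff (f : (Var →₀ ℕ) → ℚ) (d : Var →₀ ℕ) :
    MvPowerSeries.coeff d (ofCoeff f) = f d := rfl

/-- The sum is regrouped along `g`, which preserves monomials. `hfin` makes every coefficient a
genuinely finite sum. This passes from labelled objects to isomorphism classes and to passports. -/
theorem genSeries_fiberwise {ι κ : Type} {wt : ι → Var →₀ ℕ}
    (hfin : ∀ d, Finite {i // wt i = d}) (c : ι → ℚ) (g : ι → κ) {wt' : κ → Var →₀ ℕ}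
    (hg : ∀ i, wt' (g i) = wt i) {c' : κ → ℚ} (hc : ∀ k, c' k = ∑ᶠ i : {i // g i = k}, c i) :
    genSeries wt c = genSeries wt' c' := by
  ext d
  have := hfin d
  rw [coeff_genSeries, coeff_genSeries, finsum_fiberwise (β := {k // wt' k = d})
    (fun i => ⟨g i.1, by rw [hg, i.2]⟩)]
  refine finsum_congr fun k => ?_
  rw [hc]
  exact finsum_eq_of_bijective
    (fun a : {a : {i // wt i = d} // (⟨g a.1, _⟩ : {k // wt' k = d}) = k} =>
      (⟨a.1.1, congrArg Subtype.val a.2⟩ : {i // g i = k}))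
    ⟨fun a b h => Subtype.ext (Subtype.ext (congrArg (fun z => z.1) h)),
      fun b => ⟨⟨⟨b.1, by rw [← hg, b.2, k.2]⟩, Subtype.ext b.2⟩, rfl⟩⟩ fun _ => rfl

theorem genSeries_equiv {ι κ : Type} {wt : ι → Var →₀ ℕ} {wt' : κ → Var →₀ ℕ} {c : ι → ℚ}
    {c' : κ → ℚ} (g : ι ≃ κ) (hg : ∀ i, wt' (g i) = wt i) (hc : ∀ i, c' (g i) = c i) :
    genSeries wt c = genSeries wt' c' := by
  ext d
  rw [coeff_genSeries, coeff_genSeries]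
  exact finsum_eq_of_bijective _ (g.subtypeEquiv fun i => by rw [hg]).bijective fun i => (hc i).symm

theorem finite_add_weight {ι κ : Type} {wt : ι → Var →₀ ℕ} {wt' : κ → Var →₀ ℕ}
    (h : ∀ d, Finite {i // wt i = d}) (h' : ∀ d, Finite {k // wt' k = d}) (d : Var →₀ ℕ) :
    Finite {p : ι × κ // wt p.1 + wt' p.2 = d} := by
  classical
  have key : {p : ι × κ | wt p.1 + wt' p.2 = d} ⊆ ⋃ q ∈ Finset.HasAntidiagonal.antidiagonal d,
      {i | wt i = q.1} ×ˢ {k | wt' k = q.2} := by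
    intro p hp
    simp only [Set.mem_iUnion]
    exact ⟨(wt p.1, wt' p.2), Finset.HasAntidiagonal.mem_antidiagonal.2 hp, rfl, rfl⟩
  refine (Set.Finite.subset (Set.Finite.biUnion (Finset.finite_toSet _) fun q _ => ?_)
    key).to_subtype
  exact Set.Finite.prod (Set.finite_coe_iff.1 (h q.1)) (Set.finite_coe_iff.1 (h' q.2))

/-- For each monomial the pairs of indices are grouped by how their two monomials split it; local
finiteness allows the product of two finite sums to be expanded. -/
theorem genSeries_mul {ι κ : Type} {wt : ι → Var →₀ ℕ} {wt' : κ → Var →₀ ℕ}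
    (h : ∀ d, Finite {i // wt i = d}) (h' : ∀ d, Finite {k // wt' k = d}) (c : ι → ℚ) (c' : κ → ℚ) :
    genSeries wt c * genSeries wt' c' =
      genSeries (fun p : ι × κ => wt p.1 + wt' p.2) fun p => c p.1 * c' p.2 := by
  classical
  ext d
  have := finite_add_weight h h' d
  rw [MvPowerSeries.coeff_mul, coeff_genSeries,
    finsum_fiberwise (fun p : {p : ι × κ // wt p.1 + wt' p.2 = d} => (wt p.1.1, wt' p.1.2)),
    finsum_eq_sum_of_support_subset (s := Finset.HasAntidiagonal.antidiagonal d)]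
  · refine Finset.sum_congr rfl fun q hq => ?_
    have := h q.1
    have := h' q.2
    have := Fintype.ofFinite {i // wt i = q.1}
    have := Fintype.ofFinite {k // wt' k = q.2}
    rw [coeff_genSeries, coeff_genSeries, finsum_eq_sum_of_fintype, finsum_eq_sum_of_fintype,
      Finset.sum_mul_sum, ← Fintype.sum_prod_type', ← finsum_eq_sum_of_fintype]
    refine finsum_eq_of_bijective (fun p => ⟨⟨(p.1.1, p.2.1), ?_⟩, ?_⟩) ⟨?_, ?_⟩ ?_
    · rw [p.1.2, p.2.2]; exact Finset.HasAntidiagonal.mem_antidiagonal.1 hq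
    · dsimp only; rw [p.1.2, p.2.2]
    · rintro ⟨⟨a, _⟩, ⟨b, _⟩⟩ ⟨⟨a', _⟩, ⟨b', _⟩⟩ hab
      simpa using hab
    · rintro ⟨⟨⟨a, b⟩, h1⟩, h2⟩
      obtain rfl := h2
      exact ⟨(⟨a, rfl⟩, ⟨b, rfl⟩), rfl⟩
    · intro p; rfl
  · intro q hq
    rw [Function.mem_support] at hq
    by_contra hcon
    apply hq
    have : IsEmpty {p : {p : ι × κ // wt p.1 + wt' p.2 = d} // (wt p.1.1, wt' p.1.2) = q} :=
      ⟨fun p => hcon (by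
        rw [Finset.mem_coe, Finset.HasAntidiagonal.mem_antidiagonal, ← p.2]
        exact p.1.2)⟩
    exact finsum_of_isEmpty _

/-- The number of corners of a vertex of degree `k`. -/
def cornerCount (k : ℕ) : ℕ := if k = 0 then 1 else k

theorem cornerCount_coe (k : ℕ+) : cornerCount k = k := if_neg k.ne_zero

theorem finsum_nat_eq_add_finsum_pnat (f : ℕ → ℚ) (hf : (Function.support f).Finite) :
    ∑ᶠ k, f k = f 0 + ∑ᶠ k : ℕ+, f k := by
  rw [← finsum_mem_univ, ← Set.union_compl_self {0}, finsum_mem_union' disjoint_compl_right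
    (hf.subset Set.inter_subset_right) (hf.subset Set.inter_subset_right), finsum_mem_singleton]
  congr 1
  rw [← finsum_set_coe_eq_finsum_mem]
  exact (finsum_eq_of_bijective (fun k : ℕ+ => (⟨k, k.ne_zero⟩ : ({0}ᶜ : Set ℕ)))
    ⟨fun a b h => PNat.coe_injective (congrArg (fun z : ({0}ᶜ : Set ℕ) => z.1) h), fun b =>
      ⟨⟨b.1, Nat.pos_of_ne_zero b.2⟩, rfl⟩⟩ fun _ => rfl).symm

theorem finite_setOf_apply_ne_zero {v : ℕ → Var} (hv : Function.Injective v) (d : Var →₀ ℕ) :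
    {k | d (v (k + 2)) ≠ 0}.Finite := by
  have : {k | d (v (k + 2)) ≠ 0} = (fun k => v (k + 2)) ⁻¹' (d.support : Set Var) := by
    ext k; simp
  rw [this]
  exact (Finset.finite_toSet _).preimage fun a _ b _ h => by simpa using hv h

/-- The monomial `v_{k+2} x` by which `diffOp` replaces `v_k`. -/
noncomputable def cornerShift (v : ℕ → Var) (k : ℕ) : Var →₀ ℕ :=
  Finsupp.single (v (k + 2)) 1 + Finsupp.single Var.x 1

theorem coeff_X_mul_X_mul_pderiv (v : ℕ → Var) (F : MvPowerSeries Var ℚ) (d : Var →₀ ℕ) (k : ℕ) :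
    MvPowerSeries.coeff d (MvPowerSeries.X (v (k + 2)) * MvPowerSeries.X Var.x *
      MvPowerSeries.pderiv ℚ (v k) F) = if cornerShift v k ≤ d then
        MvPowerSeries.coeff (d - cornerShift v k + Finsupp.single (v k) 1) F *
          ((d - cornerShift v k) (v k) + 1) else 0 := by
  rw [MvPowerSeries.X_def, MvPowerSeries.X_def, MvPowerSeries.monomial_mul_monomial, one_mul,
    MvPowerSeries.coeff_monomial_mul]
  simp only [MvPowerSeries.coeff_pderiv, one_mul]
  rfl

/-- The separate term for `v 0` has the coefficient `cornerCount 0 = 1`, so it merges with the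
others into one sum over all degrees. -/
theorem coeff_diffOp {v : ℕ → Var} (hv : Function.Injective v) (F : MvPowerSeries Var ℚ)
    (d : Var →₀ ℕ) : MvPowerSeries.coeff d (diffOp v F) =
      ∑ᶠ k, if cornerShift v k ≤ d then (cornerCount k : ℚ) *
        (MvPowerSeries.coeff (d - cornerShift v k + Finsupp.single (v k) 1) F *
          ((d - cornerShift v k) (v k) + 1)) else 0 := by
  have hcoeff : ∀ k : ℕ+, MvPowerSeries.coeff d (((k : ℕ) : MvPowerSeries Var ℚ) *
      MvPowerSeries.X (v (k + 2)) * MvPowerSeries.X Var.x * MvPowerSeries.pderiv ℚ (v k) F) =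
      (cornerCount k : ℚ) * MvPowerSeries.coeff d (MvPowerSeries.X (v (k + 2)) *
        MvPowerSeries.X Var.x * MvPowerSeries.pderiv ℚ (v k) F) := fun k => by
    rw [cornerCount_coe, mul_assoc, mul_assoc, ← mul_assoc (MvPowerSeries.X _), ← nsmul_eq_mul,
      map_nsmul, nsmul_eq_mul]
  rw [finsum_nat_eq_add_finsum_pnat, diffOp, map_add, coeff_ofCoeff]
  · congr 1
    · rw [show MvPowerSeries.X (v 2) = MvPowerSeries.X (R := ℚ) (v (0 + 2)) from rfl,
        coeff_X_mul_X_mul_pderiv]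
      simp [cornerCount]
    · refine finsum_congr fun k => ?_
      rw [hcoeff, coeff_X_mul_X_mul_pderiv, mul_ite, mul_zero]
  · refine (finite_setOf_apply_ne_zero hv d).subset fun k hk => ?_
    rw [Function.mem_support] at hk
    have h1 : cornerShift v k ≤ d := by
      by_contra h
      exact hk (if_neg h)
    have h2 := h1 (v (k + 2))
    simp only [cornerShift, Finsupp.add_apply, Finsupp.single_eq_same] at h2
    exact (by omega : d (v (k + 2)) ≠ 0)

/-- The raised degree `k + 2` occurs in `d`, which leaves finitely many `k`. Given `k`, the original
monomial is determined, and each of the finitely many objects with that monomial has finitely many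
roots. -/
theorem finite_rooted_weight {ι : Type} {K : ι → Type} [∀ i, Finite (K i)] {wt : ι → Var →₀ ℕ}
    (hfin : ∀ d, Finite {i // wt i = d}) {v : ℕ → Var} (hv : Function.Injective v)
    {deg : ∀ i, K i → ℕ} {wt' : (Σ i, K i) → Var →₀ ℕ}
    (hwt : ∀ s, wt' s + Finsupp.single (v (deg s.1 s.2)) 1 = wt s.1 + cornerShift v (deg s.1 s.2))
    (d : Var →₀ ℕ) : Finite {s // wt' s = d} := by
  have key : {s | wt' s = d} ⊆ ⋃ k ∈ {k | d (v (k + 2)) ≠ 0},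
      ⋃ i ∈ {i | wt i = d + Finsupp.single (v k) 1 - cornerShift v k},
        Set.range (Sigma.mk i : K i → Σ i, K i) := by
    rintro ⟨i, κ⟩ (rfl : wt' ⟨i, κ⟩ = d)
    simp only [Set.mem_iUnion]
    have h := hwt ⟨i, κ⟩
    dsimp only at h
    refine ⟨deg i κ, ?_, i, ?_, κ, rfl⟩
    · have h1 := DFunLike.congr_fun h (v (deg i κ + 2))
      simp only [Finsupp.add_apply, cornerShift, Finsupp.single_eq_same] at h1
      rw [Finsupp.single_eq_of_ne (fun h => by simpa using hv h)] at h1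
      exact (by omega : wt' ⟨i, κ⟩ (v (deg i κ + 2)) ≠ 0)
    · exact (by rw [h, add_tsub_cancel_right] :
        wt i = wt' ⟨i, κ⟩ + Finsupp.single (v (deg i κ)) 1 - cornerShift v (deg i κ))
  refine (Set.Finite.subset ((finite_setOf_apply_ne_zero hv d).biUnion fun k _ =>
    Set.Finite.biUnion (Set.finite_coe_iff.1 (hfin _)) fun i _ => Set.finite_range _)
      key).to_subtype

/-- Applying `diffOp` to a formal sum of monomials amounts to choosing a corner in all possible
ways. -/
theorem diffOp_genSeries {ι : Type} {K : ι → Type} [∀ i, Finite (K i)] {wt : ι → Var →₀ ℕ}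
    (hfin : ∀ d, Finite {i // wt i = d}) {v : ℕ → Var} (hv : Function.Injective v)
    {deg : ∀ i, K i → ℕ} {wt' : (Σ i, K i) → Var →₀ ℕ}
    (hwt : ∀ s, wt' s + Finsupp.single (v (deg s.1 s.2)) 1 = wt s.1 + cornerShift v (deg s.1 s.2))
    (hK : ∀ i k, Nat.card {κ : K i // deg i κ = k} = cornerCount k * wt i (v k)) (c : ι → ℚ) :
    diffOp v (genSeries wt c) = genSeries wt' fun s => c s.1 := by
  ext d
  have := finite_rooted_weight hfin hv hwt d
  rw [coeff_diffOp hv, coeff_genSeries,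
    finsum_fiberwise fun s : {s // wt' s = d} => deg s.1.1 s.1.2]
  refine finsum_congr fun k => ?_
  split_ifs with hk
  · set d₁ := d - cornerShift v k + Finsupp.single (v k) 1 with hd₁
    have := hfin d₁
    have hd : d₁ + cornerShift v k = d + Finsupp.single (v k) 1 := by
      rw [hd₁, add_right_comm, tsub_add_cancel_of_le hk]
    -- For a root of degree `k`, the rooted monomial is `d` exactly when the unrooted one is `d₁`;
    -- comparing after adding `v k` avoids truncated subtraction.
    have hiff : ∀ s, deg s.1 s.2 = k → (wt' s = d ↔ wt s.1 = d₁) := by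
      rintro s rfl
      rw [← add_left_inj (Finsupp.single (v (deg s.1 s.2)) 1), hwt, ← hd, add_left_inj]
    have e : ∑ᶠ s : {s : {s // wt' s = d} // deg s.1.1 s.1.2 = k}, c s.1.1.1 =
        ∑ᶠ s : Σ i : {i // wt i = d₁}, {κ : K i // deg i κ = k}, c s.1 :=
      finsum_eq_of_bijective
        (fun s => ⟨⟨s.1.1.1, (hiff _ s.2).1 s.1.2⟩, ⟨s.1.1.2, s.2⟩⟩)
        ⟨by
          rintro ⟨⟨⟨i, κ⟩, h1⟩, h2⟩ ⟨⟨⟨i', κ'⟩, h1'⟩, h2'⟩ h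
          simp only [Sigma.mk.injEq, Subtype.mk.injEq] at h
          obtain ⟨rfl, h⟩ := h
          simp only [heq_eq_eq, Subtype.mk.injEq] at h
          subst h
          rfl,
        by
          rintro ⟨⟨i, h1⟩, ⟨κ, h2⟩⟩
          exact ⟨⟨⟨⟨i, κ⟩, (hiff ⟨i, κ⟩ h2).2 h1⟩, h2⟩, rfl⟩⟩ fun _ => rfl
    rw [e, finsum_sigma_eq, coeff_genSeries, ← mul_assoc, mul_comm, ← mul_assoc, mul_finsum]
    refine finsum_congr fun i => ?_
    dsimp only
    rw [finsum_const_eq, hK, i.2]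
    have : d₁ (v k) = (d - cornerShift v k) (v k) + 1 := by simp [hd₁]
    rw [this]
    push_cast
    ring
  -- By `hK`, a root of degree `k` forces `v k` to occur in the original monomial. Cancelling it
  -- shows that `d` is a multiple of the shift, contrary to the case at hand.
  · have : IsEmpty {s : {s // wt' s = d} // deg s.1.1 s.1.2 = k} := ⟨by
      rintro ⟨⟨⟨i, κ⟩, rfl⟩, rfl⟩
      apply hk
      have h := hwt ⟨i, κ⟩
      dsimp only at h ⊢
      have hne : Nonempty {κ' : K i // deg i κ' = deg i κ} := ⟨⟨κ, rfl⟩⟩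
      have hpos := Nat.card_pos (α := {κ' : K i // deg i κ' = deg i κ})
      rw [hK] at hpos
      have hle : Finsupp.single (v (deg i κ)) 1 ≤ wt i := by
        rw [Finsupp.single_le_iff]
        exact Nat.pos_of_mul_pos_left hpos
      rw [← tsub_add_cancel_of_le hle, add_right_comm, add_left_inj] at h
      rw [h]
      exact le_add_self⟩
    rw [finsum_of_isEmpty]

/-! ### Isomorphism classes and labelled objects -/

namespace BMap

variable {W B E W' B' E' : Type}

/-- The monomial of a map, with arbitrary variables for the degrees of the two colours. -/
noncomputable def colWeight (v₁ v₂ : ℕ → Var) [Fintype W] [Fintype B] (m : BMap W B E) :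
    Var →₀ ℕ :=
  ∑ w, Finsupp.single (v₁ (m.degW w)) 1 + ∑ b, Finsupp.single (v₂ (m.degB b)) 1 +
    Finsupp.single Var.t (Nat.card W + Nat.card B) + Finsupp.single Var.x (Nat.card E)

theorem weight_eq_colWeight {p q n : ℕ} (m : BMap (Fin p) (Fin q) (Fin n)) :
    m.weight = m.colWeight Var.a Var.b := by
  simp [weight, colWeight]

theorem colWeight_swap (v₁ v₂ : ℕ → Var) [Fintype W] [Fintype B] (m : BMap W B E) :
    m.swap.colWeight v₁ v₂ = m.colWeight v₂ v₁ := by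
  simp only [colWeight, degW_swap, degB_swap]
  rw [add_comm (∑ b, _), add_comm (Nat.card B)]

theorem Iso.colWeight_eq (v₁ v₂ : ℕ → Var) [Fintype W] [Fintype B] [Fintype W'] [Fintype B']
    {m : BMap W B E} {m' : BMap W' B' E'} (φ : Iso m m') :
    m'.colWeight v₁ v₂ = m.colWeight v₁ v₂ := by
  unfold colWeight
  rw [← Equiv.sum_comp φ.onW, ← Equiv.sum_comp φ.onB, Nat.card_congr φ.onW, Nat.card_congr φ.onB,
    Nat.card_congr φ.onE]
  simp only [φ.degW_eq, φ.degB_eq]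

/-- The corners at the white vertices. -/
def Corner (m : BMap W B E) : Type := {p : W × Option E // IsCorner m.atW p.1 p.2}

instance [Finite W] [Finite E] (m : BMap W B E) : Finite m.Corner :=
  inferInstanceAs (Finite {p : W × Option E // IsCorner m.atW p.1 p.2})

/-- The corners of a vertex with edges correspond to the edges that follow them; an isolated vertex
has the single corner `none`. -/
theorem card_isCorner [Finite E] (m : BMap W B E) (w : W) :
    Nat.card {c // IsCorner m.atW w c} = cornerCount (m.degW w) := by
  unfold cornerCount
  split_ifs with h
  · have h0 : ∀ e, m.atW e ≠ w := fun e he => by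
      have : Nonempty {e // m.atW e = w} := ⟨⟨e, he⟩⟩
      exact Nat.card_pos.ne' h
    rw [Nat.card_eq_one_iff_unique]
    refine ⟨⟨?_⟩, ⟨⟨none, isCorner_none.2 h0⟩⟩⟩
    rintro ⟨_ | i, hi⟩ ⟨_ | j, hj⟩
    · rfl
    · exact absurd (isCorner_some.1 hj) (h0 j)
    · exact absurd (isCorner_some.1 hi) (h0 i)
    · exact absurd (isCorner_some.1 hi) (h0 i)
  · have : Nonempty {e // m.atW e = w} := (Nat.card_pos_iff.1 (Nat.pos_of_ne_zero h)).1
    obtain ⟨e, he⟩ := this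
    refine (Nat.card_congr (Equiv.ofBijective
      (fun e : {e // m.atW e = w} => ⟨some e.1, isCorner_some.2 e.2⟩) ⟨?_, ?_⟩)).symm
    · intro a b hab
      exact Subtype.ext (Option.some_injective _ (congrArg Subtype.val hab))
    · rintro ⟨_ | i, hi⟩
      · exact absurd he (isCorner_none.1 hi e)
      · exact ⟨⟨i, isCorner_some.1 hi⟩, rfl⟩

theorem card_corner_degW [Finite W] [Finite E] (m : BMap W B E) (k : ℕ) :
    Nat.card {κ : m.Corner // m.degW κ.1.1 = k} =
      cornerCount k * Nat.card {w // m.degW w = k} := by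
  rw [mul_comm, ← card_sigma_of_card_eq (β := fun w : {w // m.degW w = k} =>
    {c // IsCorner m.atW w.1 c})]
  · exact Nat.card_congr ⟨fun κ => ⟨⟨κ.1.1.1, κ.2⟩, κ.1.1.2, κ.1.2⟩,
      fun s => ⟨⟨(s.1.1, s.2.1), s.2.2⟩, s.1.2⟩, fun _ => rfl, fun _ => rfl⟩
  · rintro ⟨w, rfl⟩
    exact m.card_isCorner w

theorem isCorner_map {m : BMap W B E} {m' : BMap W' B' E'} (φ : Iso m m') {u : W} {c : Option E}
    (h : IsCorner m.atW u c) : IsCorner m'.atW (φ.onW u) (c.map φ.onE) := by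
  cases c with
  | none =>
    refine isCorner_none.2 fun e he => isCorner_none.1 h (φ.onE.symm e) ?_
    rw [← φ.onW.apply_eq_iff_eq, φ.map_atW, Equiv.apply_symm_apply, he]
  | some i => exact isCorner_some.2 (by rw [← φ.map_atW, isCorner_some.1 h])

/-- An isomorphism of connected maps is determined by the image of a corner. -/
theorem Conn.iso_eq {m : BMap W B E} {m' : BMap W' B' E'} (h : m.Conn) {φ ψ : Iso m m'}
    (κ : m.Corner) (hu : φ.onW κ.1.1 = ψ.onW κ.1.1)
    (hc : κ.1.2.map φ.onE = κ.1.2.map ψ.onE) : φ = ψ := by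
  obtain ⟨⟨u, c⟩, hκ⟩ := κ
  cases c with
  | none =>
    -- The corner `none` sits at an isolated vertex, which by connectedness is the whole map.
    have key : ∀ x : W ⊕ B, x = .inl u := fun x =>
      h.2 (fun x => x = .inl u) (fun e => by simp [show m.atW e ≠ u from isCorner_none.1 hκ e])
        (.inl u) x rfl
    have hB : ∀ b : B, False := fun b => by simpa using key (.inr b)
    ext e
    · obtain rfl : e = u := by simpa using key (.inl e)
      exact hu
    · exact (hB e).elim
    · exact (hB (m.atB e)).elim
  | some i =>
    -- Agreement at an edge spreads through both rotations, hence to all edges.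
    have hE : ∀ e, φ.onE e = ψ.onE e := fun e =>
      h.edge_induction (fun e => φ.onE e = ψ.onE e)
        (fun e => by rw [φ.map_rotW, ψ.map_rotW, Equiv.apply_eq_iff_eq])
        (fun e => by rw [φ.map_rotB, ψ.map_rotB, Equiv.apply_eq_iff_eq]) i e (by simpa using hc)
    have : Nonempty E := ⟨i⟩
    ext x
    · obtain ⟨e, rfl⟩ := h.exists_atW_eq x
      rw [φ.map_atW, ψ.map_atW, hE]
    · obtain ⟨e, rfl⟩ := h.exists_atB_eq x
      rw [φ.map_atB, ψ.map_atB, hE]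
    · exact hE x

end BMap

/-! ### Relabellings and the sizes of isomorphism classes of labelled trees. -/

namespace PlaneTree

theorem isTree (S : PlaneTree) : S.map.IsTree :=
  S.map.isPlane_and_numFaces_eq_one_iff.1 ⟨S.isPlane, S.oneFace⟩

/-- The plane tree given by a labelled tree. -/
def ofIsTree {p q n : ℕ} (m : BMap (Fin p) (Fin q) (Fin n)) (h : m.IsTree) : PlaneTree :=
  ⟨p, q, n, m, (m.isPlane_and_numFaces_eq_one_iff.2 h).1,
    (m.isPlane_and_numFaces_eq_one_iff.2 h).2⟩

/-- The number of relabellings of a plane tree. -/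
def labellings (S : PlaneTree) : ℕ := S.nW.factorial * S.nB.factorial * S.nE.factorial

/-- Relabelling of a plane tree. -/
def relabel (S : PlaneTree) (f : Equiv.Perm (Fin S.nW)) (g : Equiv.Perm (Fin S.nB))
    (h : Equiv.Perm (Fin S.nE)) : PlaneTree :=
  ofIsTree (S.map.relabel f g h) ((S.map.relabelIso f g h).isTree S.isTree)

/-- Bijections on the labels correspond to isomorphisms onto labelled trees. -/
noncomputable def permEquivIso (S : PlaneTree) :
    (Equiv.Perm (Fin S.nW) × Equiv.Perm (Fin S.nB) × Equiv.Perm (Fin S.nE)) ≃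
      Σ T : PlaneTree, S.map.Iso T.map :=
  Equiv.ofBijective (fun s => ⟨S.relabel s.1 s.2.1 s.2.2, S.map.relabelIso s.1 s.2.1 s.2.2⟩)
    ⟨by
      rintro ⟨f, g, h⟩ ⟨f', g', h'⟩ H
      have h1 := congrArg (fun (z : Σ T : PlaneTree, S.map.Iso T.map) i => (z.2.onW i : ℕ)) H
      have h2 := congrArg (fun (z : Σ T : PlaneTree, S.map.Iso T.map) i => (z.2.onB i : ℕ)) H
      have h3 := congrArg (fun (z : Σ T : PlaneTree, S.map.Iso T.map) i => (z.2.onE i : ℕ)) H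
      obtain rfl : f = f' := Equiv.ext fun i => Fin.ext (congrFun h1 i)
      obtain rfl : g = g' := Equiv.ext fun i => Fin.ext (congrFun h2 i)
      obtain rfl : h = h' := Equiv.ext fun i => Fin.ext (congrFun h3 i)
      rfl,
    by
      obtain ⟨p, q, n, m, hm, hf⟩ := S
      rintro ⟨⟨p', q', n', m', hm', hf'⟩, φ⟩
      dsimp only at φ
      obtain rfl : p = p' := Fin.equiv_iff_eq.1 ⟨φ.onW⟩
      obtain rfl : q = q' := Fin.equiv_iff_eq.1 ⟨φ.onB⟩
      obtain rfl : n = n' := Fin.equiv_iff_eq.1 ⟨φ.onE⟩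
      have H := φ.eq_relabel
      obtain ⟨f, g, h, _, _, _, _⟩ := φ
      dsimp only at H
      subst H
      exact ⟨(f, g, h), rfl⟩⟩

theorem card_iso (S : PlaneTree) : Nat.card (Σ T : PlaneTree, S.map.Iso T.map) = S.labellings := by
  rw [← Nat.card_congr S.permEquivIso, labellings]
  simp [Fintype.card_perm, mul_assoc]

instance (S : PlaneTree) : Finite (Σ T : PlaneTree, S.map.Iso T.map) :=
  Finite.of_equiv _ S.permEquivIso

instance (S T : PlaneTree) : Finite (S.map.Iso T.map) :=
  Finite.of_injective (fun φ => (⟨T, φ⟩ : Σ T : PlaneTree, S.map.Iso T.map))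
    fun φ ψ h => by simpa using h

instance (S : PlaneTree) : Finite {T : PlaneTree // S ≈ T} :=
  Finite.of_surjective (fun s : Σ T : PlaneTree, S.map.Iso T.map =>
    (⟨s.1, ⟨s.2⟩⟩ : {T : PlaneTree // S ≈ T})) fun ⟨T, ⟨φ⟩⟩ => ⟨⟨T, φ⟩, rfl⟩

/-- Orbit-stabiliser: for each `T` in the class, the isomorphisms from `S` to `T` are as numerous as
the automorphisms of `S`, and all isomorphisms out of `S` correspond to relabellings. -/
theorem card_class (S : PlaneTree) :
    Nat.card {T : PlaneTree // S ≈ T} * Nat.card (S.map.Iso S.map) = S.labellings := by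
  rw [← S.card_iso, ← card_sigma_of_card_eq (β := fun T : {T : PlaneTree // S ≈ T} =>
    S.map.Iso T.1.map)]
  · exact Nat.card_congr ⟨fun s => ⟨s.1.1, s.2⟩, fun s => ⟨⟨s.1, ⟨s.2⟩⟩, s.2⟩, fun _ => rfl,
      fun _ => rfl⟩
  · rintro ⟨T, ⟨φ⟩⟩
    refine Nat.card_congr ⟨fun ψ => ψ.trans φ.symm, fun ψ => ψ.trans φ, fun ψ => ?_, fun ψ => ?_⟩ <;>
    ext <;> simp [BMap.Iso.trans, BMap.Iso.symm]

theorem labellings_eq {S T : PlaneTree} (h : S ≈ T) : S.labellings = T.labellings := by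
  obtain ⟨φ⟩ := h
  rw [labellings, labellings, Fin.equiv_iff_eq.1 ⟨φ.onW⟩, Fin.equiv_iff_eq.1 ⟨φ.onB⟩,
    Fin.equiv_iff_eq.1 ⟨φ.onE⟩]

theorem labellings_ne_zero (S : PlaneTree) : S.labellings ≠ 0 := by
  simp [labellings, Nat.factorial_ne_zero]

/-- The monomial of a plane tree, with arbitrary variables for the degrees of the two colours. -/
noncomputable def colWeight (v₁ v₂ : ℕ → Var) (S : PlaneTree) : Var →₀ ℕ :=
  S.map.colWeight v₁ v₂

/-- Interchange of the colours. -/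
def swap (S : PlaneTree) : PlaneTree := ofIsTree S.map.swap S.isTree.swap

/-- Interchange of the colours as a bijection. -/
def swapEquiv : PlaneTree ≃ PlaneTree := ⟨swap, swap, fun _ => rfl, fun _ => rfl⟩

theorem finite_colWeight_ab (d : Var →₀ ℕ) :
    Finite {S : PlaneTree // S.colWeight Var.a Var.b = d} := by
  simp only [colWeight, ← BMap.weight_eq_colWeight]
  exact finite_weight d

theorem finite_colWeight_ba (d : Var →₀ ℕ) :
    Finite {S : PlaneTree // S.colWeight Var.b Var.a = d} :=
  have := finite_colWeight_ab d
  Finite.of_equiv {S : PlaneTree // S.colWeight Var.a Var.b = d}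
    (swapEquiv.subtypeEquiv fun S => by
      rw [colWeight, ← S.map.colWeight_swap]
      exact Iff.rfl)

theorem finite_class (τ : Quotient isoSetoid) : Finite {S : PlaneTree // ⟦S⟧ = τ} := by
  induction τ using Quotient.inductionOn with
  | h S =>
    refine Finite.of_equiv {T : PlaneTree // S ≈ T} (Equiv.subtypeEquivRight fun T => ?_)
    rw [eq_comm, Quotient.eq]

end PlaneTree

/-- The generating function of plane trees, in terms of labelled trees. -/
noncomputable def labelledTreeSeries (v₁ v₂ : ℕ → Var) : MvPowerSeries Var ℚ :=
  genSeries (fun S : PlaneTree => S.colWeight v₁ v₂) fun S => 1 / (S.labellings : ℚ)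

/-- A class contains `labellings / #Aut` labelled trees of weight `1 / labellings` each, which adds
up to `1 / #Aut`. -/
theorem labelledTreeSeries_ab : labelledTreeSeries Var.a Var.b = planeTreeSeries := by
  refine genSeries_fiberwise PlaneTree.finite_colWeight_ab _ (fun S => ⟦S⟧) (fun S => ?_)
    fun τ => ?_
  · obtain ⟨φ⟩ : (⟦S⟧ : Quotient PlaneTree.isoSetoid).out ≈ S := Quotient.mk_out S
    rw [BMap.weight_eq_colWeight, PlaneTree.colWeight]
    exact (φ.colWeight_eq _ _).symm
  · have h1 : ∀ S : {S : PlaneTree // ⟦S⟧ = τ}, 1 / (S.1.labellings : ℚ) =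
        1 / (τ.out.labellings : ℚ) := fun S => by
      have : S.1 ≈ τ.out := Quotient.exact (by rw [S.2, Quotient.out_eq])
      rw [PlaneTree.labellings_eq this]
    have := PlaneTree.finite_class τ
    rw [finsum_congr h1, finsum_const_eq]
    have h2 : Nat.card {S : PlaneTree // ⟦S⟧ = τ} = Nat.card {T : PlaneTree // τ.out ≈ T} :=
      Nat.card_congr (Equiv.subtypeEquivRight fun T => by
        conv_lhs => rw [← τ.out_eq, eq_comm, Quotient.eq])
    have h3 := τ.out.card_class
    have h4 := τ.out.labellings_ne_zero
    rw [h2, ← h3]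
    rw [← h3] at h4
    have h5 := Nat.cast_ne_zero (R := ℚ).2 (left_ne_zero_of_mul h4)
    have h6 := Nat.cast_ne_zero (R := ℚ).2 (right_ne_zero_of_mul h4)
    push_cast
    field_simp

theorem labelledTreeSeries_ba : labelledTreeSeries Var.b Var.a = planeTreeSeries := by
  rw [← labelledTreeSeries_ab]
  refine genSeries_equiv PlaneTree.swapEquiv (fun S => S.map.colWeight_swap _ _) fun S => ?_
  change 1 / ((S.nB.factorial * S.nW.factorial * S.nE.factorial : ℕ) : ℚ) = 1 /
    ((S.nW.factorial * S.nB.factorial * S.nE.factorial : ℕ) : ℚ)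
  rw [mul_comm S.nB.factorial]

/-! ### Trees rooted at a white corner -/

/-- A plane tree with a chosen corner at a white vertex. -/
abbrev CornerTree : Type := Σ S : PlaneTree, S.map.Corner

namespace CornerTree

/-- Isomorphisms of rooted trees. -/
def Iso (S T : CornerTree) : Type :=
  {φ : S.1.map.Iso T.1.map // φ.onW S.2.1.1 = T.2.1.1 ∧ S.2.1.2.map φ.onE = T.2.1.2}

instance isoSetoid : Setoid CornerTree where
  r S T := Nonempty (Iso S T)
  iseqv := by
    refine ⟨fun S => ⟨BMap.Iso.refl _, rfl, by simp [BMap.Iso.refl]⟩, ?_, ?_⟩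
    · rintro S T ⟨φ, h1, h2⟩
      refine ⟨φ.symm, by simp [BMap.Iso.symm, ← h1], ?_⟩
      rw [← h2]
      simp [BMap.Iso.symm]
    · rintro S T U ⟨φ, h1, h2⟩ ⟨ψ, h3, h4⟩
      refine ⟨φ.trans ψ, by simp [BMap.Iso.trans, h1, h3], ?_⟩
      rw [← h4, ← h2, Option.map_map]
      rfl

/-- Rooted trees are rigid, because an isomorphism of connected maps is determined by its value on
one corner. -/
instance (S T : CornerTree) : Subsingleton (Iso S T) :=
  ⟨fun φ ψ => Subtype.ext (S.1.isTree.1.iso_eq S.2 (φ.2.1.trans ψ.2.1.symm)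
    (φ.2.2.trans ψ.2.2.symm))⟩

/-- The isomorphisms from a rooted tree are those from the underlying tree. -/
def classEquiv (S : CornerTree) :
    (Σ T : PlaneTree, S.1.map.Iso T.map) ≃ Σ T : CornerTree, Iso S T where
  toFun s := ⟨⟨s.1, ⟨(s.2.onW S.2.1.1, S.2.1.2.map s.2.onE), BMap.isCorner_map s.2 S.2.2⟩⟩,
    s.2, rfl, rfl⟩
  invFun s := ⟨s.1.1, s.2.1⟩
  left_inv s := rfl
  right_inv := by
    rintro ⟨⟨T, ⟨⟨u, c⟩, h⟩⟩, ⟨φ, h1, h2⟩⟩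
    change S.1.map.Iso T.map at φ
    change φ.onW S.2.1.1 = u at h1
    change S.2.1.2.map φ.onE = c at h2
    subst h1 h2
    rfl

/-- By rigidity a class has as many members as there are isomorphisms out of `S`, and those do not
depend on the root. -/
theorem card_class (S : CornerTree) : Nat.card {T : CornerTree // S ≈ T} = S.1.labellings := by
  rw [← S.1.card_iso, Nat.card_congr S.classEquiv]
  refine (Nat.card_congr (Equiv.ofBijective (fun s => ⟨s.1, ⟨s.2⟩⟩) ⟨?_, ?_⟩)).symm
  · rintro ⟨T, φ⟩ ⟨T', φ'⟩ h
    obtain rfl : T = T' := congrArg Subtype.val h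
    rw [Subsingleton.elim φ φ']
  · rintro ⟨T, ⟨φ⟩⟩
    exact ⟨⟨T, φ⟩, rfl⟩

/-- The monomial of a rooted tree, with the degree of the root raised by two and one additional
edge. -/
noncomputable def rootWeight (v₁ v₂ : ℕ → Var) (S : CornerTree) : Var →₀ ℕ :=
  ∑ w, Finsupp.single (v₁ (S.1.map.degW w + if S.2.1.1 = w then 2 else 0)) 1 +
    ∑ b, Finsupp.single (v₂ (S.1.map.degB b)) 1 +
      Finsupp.single Var.t (S.1.nW + S.1.nB) + Finsupp.single Var.x (S.1.nE + 1)

theorem rootWeight_add (v₁ v₂ : ℕ → Var) (S : CornerTree) :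
    S.rootWeight v₁ v₂ + Finsupp.single (v₁ (S.1.map.degW S.2.1.1)) 1 =
      S.1.colWeight v₁ v₂ + cornerShift v₁ (S.1.map.degW S.2.1.1) := by
  rw [rootWeight, PlaneTree.colWeight, BMap.colWeight,
    ← Finset.add_sum_erase Finset.univ _ (Finset.mem_univ S.2.1.1),
    ← Finset.add_sum_erase Finset.univ (fun w => Finsupp.single (v₁ (S.1.map.degW w)) 1)
      (Finset.mem_univ S.2.1.1), if_pos rfl]
  rw [Finset.sum_congr rfl fun w hw => by
    rw [if_neg (Finset.ne_of_mem_erase hw).symm, add_zero], cornerShift, Finsupp.single_add Var.x]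
  simp only [Nat.card_eq_fintype_card, Fintype.card_fin]
  abel

theorem rootWeight_eq (v₁ v₂ : ℕ → Var) {S T : CornerTree} (h : S ≈ T) :
    S.rootWeight v₁ v₂ = T.rootWeight v₁ v₂ := by
  obtain ⟨φ, h1, -⟩ := h
  rw [← add_left_inj (Finsupp.single (v₁ (S.1.map.degW S.2.1.1)) 1), rootWeight_add,
    ← φ.degW_eq, h1, rootWeight_add, PlaneTree.colWeight, ← φ.colWeight_eq]
  rfl

theorem finite_rootWeight {v₁ v₂ : ℕ → Var} (hv : Function.Injective v₁)
    (hfin : ∀ d, Finite {S : PlaneTree // S.colWeight v₁ v₂ = d}) (d : Var →₀ ℕ) :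
    Finite {S : CornerTree // S.rootWeight v₁ v₂ = d} :=
  finite_rooted_weight (ι := PlaneTree) (K := fun S => S.map.Corner) hfin hv
    (deg := fun S κ => S.map.degW κ.1.1) (wt' := fun S => rootWeight v₁ v₂ S)
    (fun S => rootWeight_add v₁ v₂ S) d

theorem finite_class (τ : Quotient isoSetoid) : Finite {S : CornerTree // ⟦S⟧ = τ} := by
  induction τ using Quotient.inductionOn with
  | h S =>
    have : Finite {T : CornerTree // S ≈ T} := by
      have h := S.card_class
      exact Nat.finite_of_card_ne_zero (by rw [h]; exact S.1.labellings_ne_zero)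
    refine Finite.of_equiv {T : CornerTree // S ≈ T} (Equiv.subtypeEquivRight fun T => ?_)
    rw [eq_comm, Quotient.eq]

end CornerTree

/-- The generating function of the isomorphism classes of rooted trees. -/
noncomputable def rootedSeries (v₁ v₂ : ℕ → Var) : MvPowerSeries Var ℚ :=
  genSeries (fun τ : Quotient CornerTree.isoSetoid => τ.out.rootWeight v₁ v₂) fun _ => 1

/-- The operator sums over corners of labelled trees, each with weight `1 / labellings`. By rigidity
every class of rooted trees has exactly `labellings` members, so it contributes one. -/
theorem diffOp_labelledTreeSeries {v₁ v₂ : ℕ → Var} (hv : Function.Injective v₁)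
    (hfin : ∀ d, Finite {S : PlaneTree // S.colWeight v₁ v₂ = d})
    (h₁₂ : ∀ i j, v₂ i ≠ v₁ j) (ht : ∀ j, Var.t ≠ v₁ j) (hx : ∀ j, Var.x ≠ v₁ j) :
    diffOp v₁ (labelledTreeSeries v₁ v₂) = rootedSeries v₁ v₂ := by
  rw [labelledTreeSeries, diffOp_genSeries (ι := PlaneTree) (K := fun S => S.map.Corner) hfin hv
    (deg := fun S κ => S.map.degW κ.1.1) (wt' := fun S => CornerTree.rootWeight v₁ v₂ S)
    (fun S => CornerTree.rootWeight_add v₁ v₂ S)]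
  · refine genSeries_fiberwise (CornerTree.finite_rootWeight hv hfin) _ (fun S => ⟦S⟧)
      (fun S => CornerTree.rootWeight_eq _ _ (Quotient.mk_out S)) fun τ => ?_
    have h1 : ∀ S : {S : CornerTree // ⟦S⟧ = τ}, 1 / (S.1.1.labellings : ℚ) =
        1 / (τ.out.1.labellings : ℚ) := fun S => by
      have : S.1 ≈ τ.out := Quotient.exact (by rw [S.2, Quotient.out_eq])
      obtain ⟨φ, -⟩ := this
      rw [PlaneTree.labellings_eq ⟨φ⟩]
    have := CornerTree.finite_class τ
    rw [finsum_congr h1, finsum_const_eq]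
    have h2 : Nat.card {S : CornerTree // ⟦S⟧ = τ} = Nat.card {T : CornerTree // τ.out ≈ T} :=
      Nat.card_congr (Equiv.subtypeEquivRight fun T => by
        conv_lhs => rw [← τ.out_eq, eq_comm, Quotient.eq])
    rw [h2, CornerTree.card_class]
    have := Nat.cast_ne_zero (R := ℚ).2 τ.out.1.labellings_ne_zero
    field_simp
  · intro S k
    rw [BMap.card_corner_degW]
    congr 1
    classical
    rw [PlaneTree.colWeight, BMap.colWeight]
    -- The variables are distinct, so the exponent of `v₁ k` counts only the vertices of the first
    -- colour of degree `k`.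
    simp only [Finsupp.add_apply, Finsupp.finsetSum_apply, Finsupp.single_apply, h₁₂, ht, hx,
      if_false, Finset.sum_const_zero, add_zero, hv.eq_iff]
    rw [Nat.card_eq_fintype_card, Fintype.card_subtype, Finset.card_filter]

/-! ### Multinomial counts -/

theorem finite_sum_single_eq {α : Type} (p : ℕ) (k : α →₀ ℕ) :
    Finite {f : Fin p → α // ∑ i, Finsupp.single (f i) 1 = k} := by
  classical
  have h : ∀ f : Fin p → α, ∑ i, Finsupp.single (f i) 1 = k → ∀ i, f i ∈ k.support := by
    rintro f rfl i
    rw [Finsupp.mem_support_iff, Finsupp.finsetSum_apply]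
    refine (Finset.sum_pos' (fun _ _ => Nat.zero_le _) ⟨i, Finset.mem_univ i, ?_⟩).ne'
    simp
  refine Finite.of_injective (β := Fin p → k.support) (fun f i => ⟨f.1 i, h f.1 f.2 i⟩) ?_
  intro f g h
  exact Subtype.ext (funext fun i => congrArg Subtype.val (congrFun h i))

/-- The number of words with given multiplicities of letters. -/
theorem card_sum_single_eq {α : Type} (p : ℕ) : ∀ k : α →₀ ℕ, k.degree = p →
    Nat.card {f : Fin p → α // ∑ i, Finsupp.single (f i) 1 = k} *
      (k.prod fun _ m => m.factorial) = p.factorial := by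
  classical
  induction p with
  | zero =>
    intro k hk
    obtain rfl : k = 0 := (Finsupp.degree_eq_zero_iff k).1 hk
    simp
  | succ p ih =>
    intro k hk
    -- The words are sorted by their first letter, which must occur in `k`.
    have e : Nat.card {f : Fin (p + 1) → α // ∑ i, Finsupp.single (f i) 1 = k} =
        ∑ a : k.support, Nat.card {f : Fin p → α //
          ∑ i, Finsupp.single (f i) 1 = k - Finsupp.single a.1 1} := by
      have := fun a : k.support => finite_sum_single_eq p (k - Finsupp.single a.1 1)
      rw [← Nat.card_sigma]
      have hcons : ∀ s : Σ a : k.support, {f : Fin p → α //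
          ∑ i, Finsupp.single (f i) 1 = k - Finsupp.single a.1 1},
          ∑ i, Finsupp.single ((Fin.cons s.1.1 s.2.1 : Fin (p + 1) → α) i) 1 = k := by
        rintro ⟨a, f, hf⟩
        rw [Fin.sum_univ_succ]
        simp only [Fin.cons_zero, Fin.cons_succ]
        rw [hf, add_tsub_cancel_of_le]
        rw [Finsupp.single_le_iff]
        exact Nat.one_le_iff_ne_zero.2 (Finsupp.mem_support_iff.1 a.2)
      refine (Nat.card_congr (Equiv.ofBijective
        (fun s => ⟨Fin.cons s.1.1 s.2.1, hcons s⟩) ⟨?_, ?_⟩)).symm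
      · rintro ⟨⟨a, ha⟩, ⟨f, hf⟩⟩ ⟨⟨a', ha'⟩, ⟨f', hf'⟩⟩ h
        simp only [Subtype.mk.injEq, Fin.cons_inj] at h
        obtain ⟨rfl, rfl⟩ := h
        rfl
      · rintro ⟨f, hf⟩
        rw [Fin.sum_univ_succ] at hf
        refine ⟨⟨⟨f 0, ?_⟩, ⟨fun i => f i.succ, ?_⟩⟩, Subtype.ext (Fin.cons_self_tail f)⟩
        · rw [← hf, Finsupp.mem_support_iff, Finsupp.add_apply, Finsupp.single_eq_same]
          omega
        · exact (by rw [← hf, add_tsub_cancel_left] :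
            ∑ i : Fin p, Finsupp.single (f i.succ) 1 = k - Finsupp.single (f 0) 1)
    rw [e, Finset.sum_mul]
    have hterm : ∀ a : k.support, Nat.card {f : Fin p → α //
        ∑ i, Finsupp.single (f i) 1 = k - Finsupp.single a.1 1} *
          (k.prod fun _ m => m.factorial) = k a * p.factorial := by
      rintro ⟨a, ha⟩
      have hle : Finsupp.single a 1 ≤ k := by
        rw [Finsupp.single_le_iff]
        exact Nat.one_le_iff_ne_zero.2 (Finsupp.mem_support_iff.1 ha)
      have hdeg : (k - Finsupp.single a 1).degree = p := by
        have h1 := congrArg Finsupp.degree (tsub_add_cancel_of_le hle)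
        rw [map_add, hk, Finsupp.degree_single] at h1
        omega
      -- Lowering the multiplicity of `a` by one divides the product of factorials by `k a`; summing
      -- these factors over `a` later gives `p + 1`.
      have hprod : (k.prod fun _ m => m.factorial) =
          k a * ((k - Finsupp.single a 1).prod fun _ m => m.factorial) := by
        rw [Finsupp.prod, ← Finset.mul_prod_erase _ _ ha,
          Finsupp.prod_of_support_subset (s := k.support) _
            (Finsupp.support_mono tsub_le_self) _ (by simp),
          ← Finset.mul_prod_erase k.support _ ha, ← mul_assoc]
        congr 1
        · simp only [Finsupp.coe_tsub, Pi.sub_apply, Finsupp.single_eq_same]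
          exact (Nat.mul_factorial_pred (Finsupp.mem_support_iff.1 ha)).symm
        · refine Finset.prod_congr rfl fun b hb => ?_
          simp [Finsupp.single_eq_of_ne (Finset.ne_of_mem_erase hb)]
      rw [hprod, mul_left_comm, ih _ hdeg]
    rw [Finset.sum_congr rfl fun a _ => hterm a, ← Finset.sum_mul, Nat.factorial_succ, ← hk,
      Finset.sum_coe_sort k.support fun a => k a, Finsupp.degree_apply]

/-! ### Degree sequences -/

/-- `‖k‖ = ∑ i k_i`. -/
noncomputable def seqNorm (k : ℕ+ →₀ ℕ) : ℕ := k.sum fun i m => m * (i : ℕ)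

/-- The exponents of `v^k t^|k|`. -/
noncomputable def seqWeightCore (v : ℕ → Var) (k : ℕ+ →₀ ℕ) : Var →₀ ℕ :=
  k.sum fun i m => m • (Finsupp.single (v i) 1 + Finsupp.single Var.t 1)

theorem seqWeight_eq (v : ℕ → Var) (z : Var) (k : ℕ+ →₀ ℕ) :
    seqWeight v z k = seqWeightCore v k + Finsupp.single z (seqNorm k) := by
  simp only [seqWeight, seqWeightCore, seqNorm, Finsupp.sum, Finsupp.single_finsetSum]
  rw [← Finset.sum_add_distrib]
  refine Finset.sum_congr rfl fun i _ => ?_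
  rw [smul_add, Finsupp.smul_single, smul_eq_mul]

theorem seqWeightCore_sum_single {ι : Type} [Fintype ι] (v : ℕ → Var) (f : ι → ℕ+) :
    seqWeightCore v (∑ i, Finsupp.single (f i) 1) =
      ∑ i, (Finsupp.single (v (f i)) 1 + Finsupp.single Var.t 1) := by
  unfold seqWeightCore
  rw [← Finsupp.sum_finsetSum_index (by simp) (by intros; rw [add_smul])]
  refine Finset.sum_congr rfl fun i _ => ?_
  rw [Finsupp.sum_single_index (by simp), one_smul]

theorem seqNorm_sum_single {ι : Type} [Fintype ι] (f : ι → ℕ+) :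
    seqNorm (∑ i, Finsupp.single (f i) 1) = ∑ i, (f i : ℕ) := by
  unfold seqNorm
  rw [← Finsupp.sum_finsetSum_index (by simp) (by intros; rw [add_mul])]
  refine Finset.sum_congr rfl fun i _ => ?_
  rw [Finsupp.sum_single_index (by simp), one_mul]

theorem degree_sum_single {ι α : Type} [Fintype ι] (f : ι → α) :
    (∑ i, Finsupp.single (f i) 1 : α →₀ ℕ).degree = Fintype.card ι := by
  rw [map_sum]
  simp

theorem seqWeightCore_apply_of_ne (v : ℕ → Var) (k : ℕ+ →₀ ℕ) {s : Var} (hs : ∀ i, s ≠ v i)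
    (ht : s ≠ Var.t) : seqWeightCore v k s = 0 := by
  simp [seqWeightCore, Finsupp.sum, Finsupp.finsetSum_apply, Finsupp.single_eq_of_ne (hs _),
    Finsupp.single_eq_of_ne ht]

theorem seqWeightCore_apply_t (v : ℕ → Var) (k : ℕ+ →₀ ℕ) (hv : ∀ i, Var.t ≠ v i) :
    seqWeightCore v k Var.t = k.degree := by
  simp [seqWeightCore, Finsupp.sum, Finsupp.finsetSum_apply, Finsupp.single_eq_of_ne (hv _),
    Finsupp.degree_apply]

theorem seqWeightCore_apply_self {v : ℕ → Var} (hv : Function.Injective v) (hvt : ∀ i, v i ≠ Var.t)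
    (k : ℕ+ →₀ ℕ) (i : ℕ+) : seqWeightCore v k (v i) = k i := by
  classical
  simp only [seqWeightCore, Finsupp.sum, Finsupp.finsetSum_apply, Finsupp.smul_apply,
    Finsupp.add_apply, Finsupp.single_eq_of_ne (hvt i), add_zero, smul_eq_mul]
  rw [Finset.sum_eq_single i]
  · simp
  · intro j _ hj
    rw [Finsupp.single_eq_of_ne fun h => hj (PNat.coe_injective (hv h)).symm, mul_zero]
  · intro hi
    simp [Finsupp.notMem_support_iff.1 hi]

theorem seqWeight_injective {v : ℕ → Var} (hv : Function.Injective v) (hvt : ∀ i, v i ≠ Var.t)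
    {z : Var} (hvz : ∀ i, v i ≠ z) : Function.Injective (seqWeight v z) := by
  intro k l h
  ext i
  have := DFunLike.congr_fun h (v i)
  simpa [seqWeight_eq, seqWeightCore_apply_self hv hvt, Finsupp.single_eq_of_ne (hvz i)] using this

theorem finite_seqWeight {v : ℕ → Var} (hv : Function.Injective v) (hvt : ∀ i, v i ≠ Var.t)
    {z : Var} (hvz : ∀ i, v i ≠ z) (d : Var →₀ ℕ) :
    Finite {k : {k : ℕ+ →₀ ℕ // k ≠ 0} // seqWeight v z k = d} := by
  have : Subsingleton {k : {k : ℕ+ →₀ ℕ // k ≠ 0} // seqWeight v z k = d} :=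
    ⟨fun a b => Subtype.ext (Subtype.ext (seqWeight_injective hv hvt hvz (a.2.trans b.2.symm)))⟩
  infer_instance

theorem Var.a_injective : Function.Injective Var.a := fun _ _ h => by injection h

theorem Var.b_injective : Function.Injective Var.b := fun _ _ h => by injection h

theorem finsum_subtype_eq_finsum_ite {α : Type*} (p : α → Prop) [DecidablePred p] (f : α → ℚ) :
    ∑ᶠ a : {a // p a}, f a = ∑ᶠ a, if p a then f a else 0 := by
  rw [finsum_subtype_eq_finsum_cond]
  exact finsum_congr fun a => finsum_eq_if

theorem coeff_genSeries_eq_finsum_ite {ι : Type} (wt : ι → Var →₀ ℕ) (c : ι → ℚ) (d : Var →₀ ℕ)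
    [DecidablePred fun i => wt i = d] :
    MvPowerSeries.coeff d (genSeries wt c) = ∑ᶠ i, if wt i = d then c i else 0 := by
  rw [coeff_genSeries, finsum_subtype_eq_finsum_ite]

/-- The number `(|k| - 1)! / k!`. -/
noncomputable def seqCoeff (k : ℕ+ →₀ ℕ) : ℚ :=
  ((k.degree - 1).factorial : ℚ) / (k.prod fun _ m => (m.factorial : ℚ))

/-- Pairs of degree sequences. -/
abbrev DegreePair : Type := {k : ℕ+ →₀ ℕ // k ≠ 0} × {k : ℕ+ →₀ ℕ // k ≠ 0}

/-- The pairs of degree sequences of trees. -/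
def DegreePair.IsAdmissible (p : DegreePair) : Prop :=
  seqNorm p.1 = seqNorm p.2 ∧ p.1.1.degree + p.2.1.degree = seqNorm p.1 + 1

/-- The monomial of a tree with given degree sequences. -/
noncomputable def DegreePair.weight (p : DegreePair) : Var →₀ ℕ :=
  seqWeight Var.a Var.x p.1 + seqWeightCore Var.b p.2

/-- Restoring the erased power of `y` turns the degree conditions on a term of `A · B` into equality
of the two degree sums and the count of vertices against edges. -/
theorem DegreePair.weight_eq_iff (p : DegreePair) (d : Var →₀ ℕ) :
    p.weight = d ∧ p.IsAdmissible ↔ (d Var.y = 0 ∧ d Var.t = d Var.x + 1) ∧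
      seqWeight Var.a Var.x p.1 + seqWeight Var.b Var.y p.2 =
        d + Finsupp.single Var.y (d Var.x) := by
  have hx : p.weight Var.x = seqNorm p.1 := by
    simp [weight, seqWeight_eq, seqWeightCore_apply_of_ne]
  have hy : p.weight Var.y = 0 := by
    simp [weight, seqWeight_eq, seqWeightCore_apply_of_ne]
  have ht : p.weight Var.t = p.1.1.degree + p.2.1.degree := by
    simp [weight, seqWeight_eq, seqWeightCore_apply_t]
  have hsum : seqWeight Var.a Var.x p.1 + seqWeight Var.b Var.y p.2 =
      p.weight + Finsupp.single Var.y (seqNorm p.2) := by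
    rw [weight, seqWeight_eq Var.b, add_assoc]
  rw [hsum]
  constructor
  · rintro ⟨rfl, h1, h2⟩
    refine ⟨⟨hy, ?_⟩, ?_⟩
    · rw [ht, hx, h2]
    · rw [hx, h1]
  · rintro ⟨⟨h1, h2⟩, h3⟩
    have h4 := DFunLike.congr_fun h3 Var.y
    simp only [Finsupp.add_apply, Finsupp.single_eq_same, hy, h1, zero_add] at h4
    rw [h4, add_left_inj] at h3
    subst h3
    rw [hx] at h2 h4
    rw [ht] at h2
    exact ⟨rfl, h4.symm, h2⟩

open Classical in
/-- The coefficient of a pair of degree sequences. -/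
noncomputable def DegreePair.coeff (p : DegreePair) : ℚ :=
  if p.IsAdmissible then seqCoeff p.1 * seqCoeff p.2 else 0

/-- The monomials of the trees with one vertex and of the trees with given degree sequences. -/
noncomputable def passportWeight : Bool ⊕ DegreePair → Var →₀ ℕ
  | .inl c => Finsupp.single (if c then Var.a 0 else Var.b 0) 1 + Finsupp.single Var.t 1
  | .inr p => p.weight

theorem genSeries_sum {α β : Type} {wt : α ⊕ β → Var →₀ ℕ} (hfin : ∀ d, Finite {i // wt i = d})
    (c : α ⊕ β → ℚ) : genSeries wt c =
      genSeries (fun a => wt (.inl a)) (fun a => c (.inl a)) +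
        genSeries (fun b => wt (.inr b)) fun b => c (.inr b) := by
  classical
  ext d
  rw [map_add, coeff_genSeries, coeff_genSeries, coeff_genSeries]
  have := hfin d
  have e : {i // wt i = d} ≃ {a // wt (.inl a) = d} ⊕ {b // wt (.inr b) = d} := Equiv.subtypeSum
  have := Finite.of_equiv _ e
  have h1 : Finite {a // wt (.inl a) = d} := Finite.sum_left {b // wt (.inr b) = d}
  have h2 : Finite {b // wt (.inr b) = d} := Finite.sum_right {a // wt (.inl a) = d}
  have := Fintype.ofFinite {a // wt (.inl a) = d}
  have := Fintype.ofFinite {b // wt (.inr b) = d}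
  rw [← finsum_comp_equiv (Equiv.subtypeSum (p := fun i => wt i = d)).symm,
    finsum_eq_sum_of_fintype, Fintype.sum_sum_type, finsum_eq_sum_of_fintype,
    finsum_eq_sum_of_fintype]
  rfl

theorem DegreePair.weight_injective : Function.Injective DegreePair.weight := by
  rintro ⟨⟨k, hk⟩, ⟨l, hl⟩⟩ ⟨⟨k', hk'⟩, ⟨l', hl'⟩⟩ h
  simp only [weight, seqWeight_eq] at h
  have h1 : k = k' := by
    ext i
    have := DFunLike.congr_fun h (Var.a i)
    simpa [seqWeightCore_apply_self Var.a_injective, seqWeightCore_apply_of_ne Var.b] using this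
  have h2 : l = l' := by
    ext i
    have := DFunLike.congr_fun h (Var.b i)
    simpa [seqWeightCore_apply_self Var.b_injective, seqWeightCore_apply_of_ne Var.a] using this
  subst h1 h2
  rfl

theorem finite_passportWeight (d : Var →₀ ℕ) : Finite {i // passportWeight i = d} := by
  have h1 : Finite {p : DegreePair // p.weight = d} := by
    have : Subsingleton {p : DegreePair // p.weight = d} :=
      ⟨fun a b => Subtype.ext (DegreePair.weight_injective (a.2.trans b.2.symm))⟩
    infer_instance
  exact Finite.of_equiv ({c : Bool // passportWeight (.inl c) = d} ⊕
    {p : DegreePair // p.weight = d}) (Equiv.subtypeSum (p := fun i => passportWeight i = d)).symm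

theorem genSeries_bool (f : Bool → Var →₀ ℕ) :
    genSeries f (fun _ => 1) = MvPowerSeries.monomial (f true) 1 +
      MvPowerSeries.monomial (f false) 1 := by
  classical
  ext d
  rw [coeff_genSeries_eq_finsum_ite, finsum_eq_sum_of_fintype, Fintype.sum_bool,
    map_add, MvPowerSeries.coeff_monomial, MvPowerSeries.coeff_monomial]
  simp only [eq_comm]

/-- The terms of `A · B` are indexed by pairs of nonzero degree sequences; selecting terms by degree
amounts to giving inadmissible pairs the coefficient zero. -/
theorem seriesT_eq_genSeries :
    seriesT = genSeries passportWeight (Sum.elim (fun _ => 1) DegreePair.coeff) := by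
  classical
  rw [genSeries_sum finite_passportWeight]
  simp only [Sum.elim_inl, Sum.elim_inr]
  rw [genSeries_bool, seriesT, add_assoc, add_comm]
  congr 1
  · simp [passportWeight, MvPowerSeries.X_def, MvPowerSeries.monomial_mul_monomial]
  · ext d
    rw [coeff_ofCoeff, coeff_genSeries_eq_finsum_ite, seriesA, seriesB, degreeSeries, degreeSeries,
      genSeries_mul (finite_seqWeight Var.a_injective (by simp) (by simp))
        (finite_seqWeight Var.b_injective (by simp) (by simp)),
      coeff_genSeries_eq_finsum_ite]
    split_ifs with hd
    · refine finsum_congr fun (p : DegreePair) => ?_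
      have h := p.weight_eq_iff d
      rw [and_iff_right hd] at h
      by_cases hp : p.weight = d ∧ p.IsAdmissible
      · rw [if_pos (h.1 hp), passportWeight, if_pos hp.1, DegreePair.coeff, if_pos hp.2]
        rfl
      · rw [if_neg (fun h' => hp (h.2 h')), passportWeight]
        split_ifs with h1
        · rw [DegreePair.coeff, if_neg fun h2 => hp ⟨h1, h2⟩]
        · rfl
    · symm
      apply finsum_eq_zero_of_forall_eq_zero
      intro p
      rw [passportWeight]
      split_ifs with h1
      · rw [DegreePair.coeff, if_neg fun h2 => hd ((p.weight_eq_iff d).1 ⟨h1, h2⟩).1]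
      · rfl

/-! ### The tree side -/

/-- The degree sequence of the white vertices of a map without isolated vertices. -/
noncomputable def BMap.seqW {W B E : Type} [Fintype W] (m : BMap W B E) : ℕ+ →₀ ℕ :=
  ∑ w, Finsupp.single (m.degW w).toPNat' 1

/-- The degree sequence of the black vertices of a map without isolated vertices. -/
noncomputable def BMap.seqB {W B E : Type} [Fintype B] (m : BMap W B E) : ℕ+ →₀ ℕ :=
  ∑ b, Finsupp.single (m.degB b).toPNat' 1

theorem BMap.Conn.degW_pos {W B E : Type} [Finite E] [Nonempty E] {m : BMap W B E} (h : m.Conn)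
    (w : W) : 0 < m.degW w := by
  obtain ⟨e, he⟩ := h.exists_atW_eq w
  have : Nonempty {e // m.atW e = w} := ⟨⟨e, he⟩⟩
  exact Nat.card_pos

theorem BMap.Conn.coe_toPNat'_degW {W B E : Type} [Finite E] [Nonempty E] {m : BMap W B E}
    (h : m.Conn) (w : W) : ((m.degW w).toPNat' : ℕ) = m.degW w := by
  rw [Nat.toPNat'_coe, if_pos (h.degW_pos w)]

theorem BMap.seqW_ne_zero {W B E : Type} [Fintype W] [Nonempty E] (m : BMap W B E) :
    m.seqW ≠ 0 := by
  intro h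
  have := congrArg Finsupp.degree h
  rw [BMap.seqW, degree_sum_single, map_zero, Fintype.card_eq_zero_iff] at this
  exact this.false (m.atW (Classical.arbitrary E))

theorem BMap.Conn.seqNorm_seqW {W B E : Type} [Fintype W] [Finite E] [Nonempty E] {m : BMap W B E}
    (h : m.Conn) : seqNorm m.seqW = Nat.card E := by
  rw [BMap.seqW, seqNorm_sum_single, ← m.sum_degW]
  exact Finset.sum_congr rfl fun w _ => h.coe_toPNat'_degW w

theorem BMap.degree_seqW {W B E : Type} [Fintype W] (m : BMap W B E) :
    m.seqW.degree = Nat.card W := by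
  rw [BMap.seqW, degree_sum_single, Nat.card_eq_fintype_card]

open Classical in
/-- The passport of a tree: its colour if it has one vertex, and its degree sequences otherwise. -/
noncomputable def PlaneTree.passport (S : PlaneTree) : Bool ⊕ DegreePair :=
  if _ : Nonempty (Fin S.nE) then
    .inr (⟨S.map.seqW, S.map.seqW_ne_zero⟩, ⟨S.map.seqB, S.map.swap.seqW_ne_zero⟩)
  else .inl (decide (S.nW = 1))

theorem PlaneTree.isEmpty_cases (S : PlaneTree) (h : S.nE = 0) :
    S.nW = 1 ∧ S.nB = 0 ∨ S.nW = 0 ∧ S.nB = 1 := by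
  have := S.isTree.2
  simp only [Nat.card_eq_fintype_card, Fintype.card_fin] at this
  omega

theorem PlaneTree.passportWeight_passport (S : PlaneTree) :
    passportWeight S.passport = S.colWeight Var.a Var.b := by
  unfold passport
  split_ifs with h
  · have hc := S.isTree.1
    have h1 : seqNorm S.map.seqW = S.nE := by rw [hc.seqNorm_seqW]; simp
    rw [passportWeight, DegreePair.weight, seqWeight_eq]
    dsimp only
    rw [h1, BMap.seqW, BMap.seqB, seqWeightCore_sum_single, seqWeightCore_sum_single]
    simp only [hc.coe_toPNat'_degW]
    have h2 := hc.swap.coe_toPNat'_degW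
    simp only [BMap.degW_swap] at h2
    simp only [h2, Finset.sum_add_distrib, Finset.sum_const, Finset.card_univ, Fintype.card_fin,
      colWeight, BMap.colWeight, Nat.card_eq_fintype_card, Finsupp.smul_single, smul_eq_mul, mul_one,
      Finsupp.single_add]
    abel
  · have h0 : S.nE = 0 := by
      by_contra h0
      exact h ⟨⟨0, Nat.pos_of_ne_zero h0⟩⟩
    have hempty : IsEmpty (Fin S.nE) := not_nonempty_iff.1 h
    have hW : ∀ w, S.map.degW w = 0 := fun w => by simp [BMap.degW]
    have hB : ∀ b, S.map.degB b = 0 := fun w => by simp [BMap.degB]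
    rcases S.isEmpty_cases h0 with ⟨h1, h2⟩ | ⟨h1, h2⟩ <;>
    simp [passportWeight, colWeight, BMap.colWeight, hW, hB, h0, h1, h2]

/-- The map with one vertex. -/
def BMap.point (p q : ℕ) : BMap (Fin p) (Fin q) (Fin 0) :=
  ⟨finZeroElim, finZeroElim, 1, 1, fun e => e.elim0, fun e => e.elim0⟩

theorem BMap.isTree_point {p q : ℕ} (h : p + q = 1) : (BMap.point p q).IsTree := by
  have hc : Fintype.card (Fin p ⊕ Fin q) = 1 := by simpa using h
  obtain ⟨x, hx⟩ := Fintype.card_eq_one_iff.1 hc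
  refine ⟨⟨⟨x⟩, fun P _ y z => ?_⟩, by simpa using h⟩
  rw [hx y, hx z]
  exact id

theorem PlaneTree.eq_point {p q : ℕ} (h : p + q = 1) (S : PlaneTree) (hW : S.nW = p) (hB : S.nB = q)
    (hE : S.nE = 0) : S = PlaneTree.ofIsTree (BMap.point p q) (BMap.isTree_point h) := by
  obtain ⟨p', q', n', m, h1, h2⟩ := S
  dsimp only at hW hB hE
  subst hW hB hE
  obtain rfl : m = BMap.point p' q' := by ext e <;> exact e.elim0
  rfl

theorem PlaneTree.passport_eq_inl_iff (S : PlaneTree) (c : Bool) :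
    S.passport = .inl c ↔ S.nE = 0 ∧ S.nW = c.toNat ∧ S.nB = (!c).toNat := by
  unfold passport
  split_ifs with h
  · have : S.nE ≠ 0 := Fin.pos_iff_nonempty.2 h |>.ne'
    simp [this]
  · have h0 : S.nE = 0 := by
      by_contra h0
      exact h ⟨⟨0, Nat.pos_of_ne_zero h0⟩⟩
    rcases S.isEmpty_cases h0 with ⟨h1, h2⟩ | ⟨h1, h2⟩ <;> cases c <;> simp [h0, h1, h2]

/-- There is only one labelled tree with a single vertex of the given colour, and it has one
relabelling. -/
theorem finsum_passport_inl (c : Bool) :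
    ∑ᶠ S : {S : PlaneTree // S.passport = .inl c}, 1 / (S.1.labellings : ℚ) = 1 := by
  have hc : c.toNat + (!c).toNat = 1 := by cases c <;> rfl
  have : Unique {S : PlaneTree // S.passport = .inl c} :=
    { default := ⟨PlaneTree.ofIsTree _ (BMap.isTree_point hc),
        (PlaneTree.passport_eq_inl_iff _ _).2 ⟨rfl, rfl, rfl⟩⟩
      uniq := fun S => Subtype.ext (by
        obtain ⟨h1, h2, h3⟩ := (PlaneTree.passport_eq_inl_iff _ _).1 S.2
        exact S.1.eq_point hc h2 h3 h1) }
  rw [finsum_unique]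
  obtain ⟨h1, h2, h3⟩ := (PlaneTree.passport_eq_inl_iff _ _).1
    (default : {S : PlaneTree // S.passport = .inl c}).2
  rw [PlaneTree.labellings, h1, h2, h3]
  cases c <;> simp

theorem PlaneTree.passport_eq_inr_iff (S : PlaneTree) (p : DegreePair) :
    S.passport = .inr p ↔ S.nE ≠ 0 ∧ S.map.seqW = p.1 ∧ S.map.seqB = p.2 := by
  unfold passport
  split_ifs with h
  · have : S.nE ≠ 0 := Fin.pos_iff_nonempty.2 h |>.ne'
    simp [this, Prod.ext_iff, Subtype.ext_iff]
  · have h0 : S.nE = 0 := by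
      by_contra h0
      exact h ⟨⟨0, Nat.pos_of_ne_zero h0⟩⟩
    simp [h0]

theorem PlaneTree.sizes_of_passport_eq {S : PlaneTree} {p : DegreePair} (h : S.passport = .inr p) :
    S.nW = p.1.1.degree ∧ S.nB = p.2.1.degree ∧ S.nE = seqNorm p.1 ∧ S.nE = seqNorm p.2 := by
  obtain ⟨h0, h1, h2⟩ := (S.passport_eq_inr_iff p).1 h
  have : Nonempty (Fin S.nE) := Fin.pos_iff_nonempty.1 (Nat.pos_of_ne_zero h0)
  refine ⟨?_, ?_, ?_, ?_⟩
  · rw [← h1, BMap.degree_seqW]; simp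
  · rw [← h2]
    exact (by simp : S.nB = Nat.card (Fin S.nB)).trans S.map.swap.degree_seqW.symm
  · rw [← h1, S.isTree.1.seqNorm_seqW]; simp
  · rw [← h2]
    exact (by simp : S.nE = Nat.card (Fin S.nE)).trans S.isTree.1.swap.seqNorm_seqW.symm

theorem PlaneTree.isAdmissible_of_passport_eq {S : PlaneTree} {p : DegreePair}
    (h : S.passport = .inr p) : p.IsAdmissible := by
  obtain ⟨h1, h2, h3, h4⟩ := sizes_of_passport_eq h
  have := S.isTree.2
  simp only [Nat.card_eq_fintype_card, Fintype.card_fin] at this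
  exact ⟨by omega, by omega⟩

theorem DegreePair.seqNorm_pos (p : DegreePair) : 0 < seqNorm p.1 := by
  obtain ⟨i, hi⟩ := Finsupp.support_nonempty_iff.2 p.1.2
  refine Finset.sum_pos' (fun _ _ => Nat.zero_le _) ⟨i, hi, ?_⟩
  exact Nat.mul_pos (Nat.pos_of_ne_zero (Finsupp.mem_support_iff.1 hi)) i.pos

theorem card_hasDegrees_of_isAdmissible {p : DegreePair} (hp : p.IsAdmissible)
    (f : Fin p.1.1.degree → ℕ+) (hf : ∑ i, Finsupp.single (f i) 1 = p.1.1)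
    (g : Fin p.2.1.degree → ℕ+) (hg : ∑ i, Finsupp.single (g i) 1 = p.2.1) :
    Nat.card {m : BMap (Fin p.1.1.degree) (Fin p.2.1.degree) (Fin (seqNorm p.1)) //
      m.HasDegrees (fun i => f i) fun i => g i} =
        (seqNorm p.1).factorial * (p.1.1.degree - 1).factorial * (p.2.1.degree - 1).factorial := by
  obtain ⟨n, hn⟩ : ∃ n, seqNorm p.1 = n + 1 := ⟨_, (Nat.sub_add_cancel p.seqNorm_pos).symm⟩
  have h1 : ∑ i, (f i : ℕ) = seqNorm p.1 := 
    (seqNorm_sum_single f).symm.trans (congrArg seqNorm hf)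
  have h2 : ∑ i, (g i : ℕ) = seqNorm p.2 := 
    (seqNorm_sum_single g).symm.trans (congrArg seqNorm hg)
  rw [← hp.1] at h2
  have h3 := hp.2
  rw [hn] at h1 h2 h3 ⊢
  rw [BMap.card_hasDegrees n _ _ _ _ _ (by simp) (by simpa using h3) (fun i => (f i).pos)
    (fun i => (g i).pos) h1 h2]
  simp

/-- A labelled tree with degree sequences `k` and `l` determines the degrees of its individual
vertices, so the trees can be sorted by these two words. -/
theorem card_sigma_hasDegrees (P Q N : ℕ) (hN : N ≠ 0) (hV : P + Q = N + 1) (k l : ℕ+ →₀ ℕ) :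
    Nat.card (Σ s : {f : Fin P → ℕ+ // ∑ i, Finsupp.single (f i) 1 = k} ×
        {g : Fin Q → ℕ+ // ∑ i, Finsupp.single (g i) 1 = l},
        {m : BMap (Fin P) (Fin Q) (Fin N) // m.HasDegrees (fun i => s.1.1 i) fun i => s.2.1 i}) =
      Nat.card {S : PlaneTree // (S.nW = P ∧ S.nB = Q ∧ S.nE = N) ∧
        S.map.seqW = k ∧ S.map.seqB = l} := by
  have hne : Nonempty (Fin N) := Fin.pos_iff_nonempty.1 (Nat.pos_of_ne_zero hN)
  have hdeg : ∀ (f : Fin P → ℕ+) (g : Fin Q → ℕ+) (m : BMap (Fin P) (Fin Q) (Fin N)),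
      m.HasDegrees (fun i => f i) (fun i => g i) →
      m.seqW = ∑ i, Finsupp.single (f i) 1 ∧ m.seqB = ∑ i, Finsupp.single (g i) 1 := by
    intro f g m hm
    rw [BMap.seqW, BMap.seqB, hm.2.1, hm.2.2]
    simp
  refine Nat.card_congr (Equiv.ofBijective (fun s =>
    ⟨PlaneTree.ofIsTree s.2.1 ⟨s.2.2.1, by simpa using hV⟩, ⟨rfl, rfl, rfl⟩,
      (hdeg _ _ _ s.2.2).1.trans s.1.1.2, (hdeg _ _ _ s.2.2).2.trans s.1.2.2⟩) ⟨?_, ?_⟩)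
  · rintro ⟨⟨⟨f, hf⟩, ⟨g, hg⟩⟩, m, hm⟩ ⟨⟨⟨f', hf'⟩, ⟨g', hg'⟩⟩, m', hm'⟩ h
    have h1 := congrArg Subtype.val h
    simp only [PlaneTree.ofIsTree, PlaneTree.mk.injEq, heq_eq_eq, true_and] at h1
    subst h1
    have h2 := hm.2.1.symm.trans hm'.2.1
    have h3 := hm.2.2.symm.trans hm'.2.2
    obtain rfl : f = f' := funext fun i => PNat.coe_injective (congrFun h2 i)
    obtain rfl : g = g' := funext fun i => PNat.coe_injective (congrFun h3 i)
    rfl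
  · rintro ⟨S, ⟨h1, h2, h3⟩, h4, h5⟩
    have hT := S.isTree
    obtain ⟨p', q', n', m, hm1, hm2⟩ := S
    dsimp only at h1 h2 h3 h4 h5 hT
    subst h1 h2 h3
    refine ⟨⟨⟨⟨_, h4⟩, ⟨_, h5⟩⟩, m, hT.1, ?_, ?_⟩, rfl⟩
    · exact funext fun w => (hT.1.coe_toPNat'_degW w).symm
    · exact funext fun b => (hT.1.swap.coe_toPNat'_degW b).symm

/-- The two multinomial numbers of degree words times the number of trees with given vertex degrees;
the denominators `k!` and `l!` are cleared to stay in the natural numbers. -/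
theorem card_passport_inr {p : DegreePair} (hp : p.IsAdmissible) :
    Nat.card {S : PlaneTree // S.passport = .inr p} *
      ((p.1.1.prod fun _ m => m.factorial) * (p.2.1.prod fun _ m => m.factorial)) =
    (p.1.1.degree.factorial * p.2.1.degree.factorial * (seqNorm p.1).factorial) *
      ((p.1.1.degree - 1).factorial * (p.2.1.degree - 1).factorial) := by
  have := finite_sum_single_eq p.1.1.degree p.1.1
  have := finite_sum_single_eq p.2.1.degree p.2.1
  have e : Nat.card {S : PlaneTree // S.passport = .inr p} =
      Nat.card {S : PlaneTree // (S.nW = p.1.1.degree ∧ S.nB = p.2.1.degree ∧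
        S.nE = seqNorm p.1) ∧ S.map.seqW = p.1 ∧ S.map.seqB = p.2} := by
    refine Nat.card_congr (Equiv.subtypeEquivRight fun S => ⟨fun h => ?_, fun h => ?_⟩)
    · obtain ⟨h1, h2, h3, -⟩ := PlaneTree.sizes_of_passport_eq h
      exact ⟨⟨h1, h2, h3⟩, ((S.passport_eq_inr_iff p).1 h).2⟩
    · exact (S.passport_eq_inr_iff p).2 ⟨by rw [h.1.2.2]; exact p.seqNorm_pos.ne', h.2⟩
  rw [e, ← card_sigma_hasDegrees _ _ _ p.seqNorm_pos.ne' hp.2, card_sigma_of_card_eq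
    (k := (seqNorm p.1).factorial * (p.1.1.degree - 1).factorial * (p.2.1.degree - 1).factorial),
    Nat.card_prod, ← card_sum_single_eq _ p.1.1 rfl, ← card_sum_single_eq _ p.2.1 rfl]
  · ring
  · exact fun s => card_hasDegrees_of_isAdmissible hp s.1.1 s.1.2 s.2.1 s.2.2

/-- Dividing the count by the number of relabellings leaves `(p-1)!/k! · (q-1)!/l!`. An inadmissible
pair is the passport of no tree. -/
theorem finsum_passport_inr (p : DegreePair) :
    ∑ᶠ S : {S : PlaneTree // S.passport = .inr p}, 1 / (S.1.labellings : ℚ) = p.coeff := by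
  unfold DegreePair.coeff
  split_ifs with hp
  · have h1 : ∀ S : {S : PlaneTree // S.passport = .inr p}, 1 / (S.1.labellings : ℚ) =
        1 / ((p.1.1.degree.factorial * p.2.1.degree.factorial * (seqNorm p.1).factorial : ℕ) : ℚ) :=
      fun S => by
        obtain ⟨h1, h2, h3, -⟩ := PlaneTree.sizes_of_passport_eq S.2
        rw [PlaneTree.labellings, h1, h2, h3]
    have h2 := card_passport_inr hp
    have h3 : p.1.1.degree.factorial * p.2.1.degree.factorial * (seqNorm p.1).factorial ≠ 0 := by
      simp [Nat.factorial_ne_zero]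
    have : Finite {S : PlaneTree // S.passport = .inr p} := by
      apply Nat.finite_of_card_ne_zero
      intro h0
      rw [h0, zero_mul, eq_comm] at h2
      simp [Nat.factorial_ne_zero] at h2
    rw [finsum_congr h1, finsum_const_eq, seqCoeff, seqCoeff]
    have h4 : ∀ k : ℕ+ →₀ ℕ, (k.prod fun _ m => (m.factorial : ℚ)) ≠ 0 := fun k =>
      Finset.prod_ne_zero_iff.2 fun i _ => Nat.cast_ne_zero.2 (Nat.factorial_ne_zero _)
    have h5 := h4 p.1.1
    have h6 := h4 p.2.1
    have h7 : ∀ k : ℕ+ →₀ ℕ, ((k.prod fun _ m => m.factorial : ℕ) : ℚ) =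
        k.prod fun _ m => (m.factorial : ℚ) := fun k => by simp [Finsupp.prod]
    have h8 := congrArg (fun n : ℕ => (n : ℚ)) h2
    rw [Nat.cast_mul, Nat.cast_mul, h7, h7, Nat.cast_mul _ (_ * _)] at h8
    have h9 := Nat.cast_ne_zero (R := ℚ).2 h3
    rw [div_mul_div_comm, mul_one_div, div_eq_div_iff h9 (mul_ne_zero h5 h6), h8]
    push_cast
    ring
  · have : IsEmpty {S : PlaneTree // S.passport = .inr p} :=
      ⟨fun S => hp (PlaneTree.isAdmissible_of_passport_eq S.2)⟩
    exact finsum_of_isEmpty _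

theorem seriesT_eq_planeTreeSeries : seriesT = planeTreeSeries := by
  rw [seriesT_eq_genSeries, ← labelledTreeSeries_ab, labelledTreeSeries]
  symm
  refine genSeries_fiberwise PlaneTree.finite_colWeight_ab _ PlaneTree.passport
    PlaneTree.passportWeight_passport ?_
  rintro (c | p)
  · exact (finsum_passport_inl c).symm
  · exact (finsum_passport_inr p).symm

namespace BMap

variable {W B E W' B' E' W₁ B₁ E₁ W₂ B₂ E₂ W₁' B₁' E₁' W₂' B₂' E₂' : Type}

/-! ### Relabelling and edge insertion -/

/-- The isomorphism to a map that is known to be a relabelling. -/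
def Iso.ofEq {m : BMap W B E} {m' : BMap W' B' E'} {f : W ≃ W'} {g : B ≃ B'} {h : E ≃ E'}
    (H : m' = m.relabel f g h) : Iso m m' where
  onW := f
  onB := g
  onE := h
  map_atW e := by subst H; exact (m.relabelIso f g h).map_atW e
  map_atB e := by subst H; exact (m.relabelIso f g h).map_atB e
  map_rotW e := by subst H; exact (m.relabelIso f g h).map_rotW e
  map_rotB e := by subst H; exact (m.relabelIso f g h).map_rotB e

theorem permCongr_insertNone {α β : Type*} (h : α ≃ β) (c : Option α) (σ : Equiv.Perm α) :
    (Equiv.optionCongr h).permCongr (insertNone c σ) = insertNone (c.map h) (h.permCongr σ) := by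
  classical
  ext1 x
  obtain ⟨y, rfl⟩ := (Equiv.optionCongr h).surjective x
  rw [Equiv.permCongr_apply, Equiv.symm_apply_apply]
  cases y with
  | none => simp [insertNone_none]
  | some a =>
    simp only [Equiv.optionCongr_apply, Option.map_some, insertNone_some, Equiv.permCongr_apply,
      Equiv.symm_apply_apply]
    have : some (h (σ a)) = c.map h ↔ some (σ a) = c := by
      rw [← Option.map_some, (Option.map_injective h.injective).eq_iff]
    simp only [this]
    split_ifs <;> simp

theorem relabel_insertEdge (m : BMap W B E) {u : W} {c : Option E} {v : B} {c' : Option E}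
    (hu : IsCorner m.atW u c) (hv : IsCorner m.atB v c') (f : W ≃ W') (g : B ≃ B') (h : E ≃ E') :
    (m.insertEdge hu hv).relabel f g (Equiv.optionCongr h) =
      (m.relabel f g h).insertEdge (u := f u) (c := c.map h) (v := g v) (c' := c'.map h)
        (isCorner_map (m.relabelIso f g h) hu) (isCorner_map (m.relabelIso f g h).swap hv) := by
  ext1 e
  · cases e <;> rfl
  · cases e <;> rfl
  · exact congrArg (fun σ : Equiv.Perm _ => σ e) (permCongr_insertNone h c m.rotW)
  · exact congrArg (fun σ : Equiv.Perm _ => σ e) (permCongr_insertNone h c' m.rotB)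

theorem insertEdge_congr {m m' : BMap W B E} {u u' : W} {v v' : B} {c c' d d' : Option E}
    {hu : IsCorner m.atW u c} {hv : IsCorner m.atB v d}
    {hu' : IsCorner m'.atW u' c'} {hv' : IsCorner m'.atB v' d'}
    (h1 : m = m') (h2 : u = u') (h3 : v = v') (h4 : c = c') (h5 : d = d') :
    m.insertEdge hu hv = m'.insertEdge hu' hv' := by
  subst h1 h2 h3 h4 h5
  rfl

/-- Isomorphisms extend over an inserted edge. -/
noncomputable def Iso.insertEdge {m : BMap W B E} {m' : BMap W' B' E'} (φ : Iso m m')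
    {u : W} {v : B} {c d : Option E} {u' : W'} {v' : B'} {c' d' : Option E'}
    {hu : IsCorner m.atW u c} {hv : IsCorner m.atB v d}
    {hu' : IsCorner m'.atW u' c'} {hv' : IsCorner m'.atB v' d'}
    (h1 : φ.onW u = u') (h2 : φ.onB v = v') (h3 : c.map φ.onE = c') (h4 : d.map φ.onE = d') :
    Iso (m.insertEdge hu hv) (m'.insertEdge hu' hv') :=
  Iso.ofEq (f := φ.onW) (g := φ.onB) (h := Equiv.optionCongr φ.onE) (by
    rw [relabel_insertEdge]
    exact insertEdge_congr φ.eq_relabel h1.symm h2.symm h3.symm h4.symm)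

theorem exists_eq_optionCongr {α β : Type*} (h : Option α ≃ Option β) (h0 : h none = none) :
    ∃ h', h = Equiv.optionCongr h' := by
  refine ⟨Equiv.removeNone h, ?_⟩
  ext1 x
  cases x with
  | none => simpa using h0
  | some a =>
    have : ∃ b, h (some a) = some b := by
      rw [← Option.ne_none_iff_exists', ← h0]
      exact fun H => by simpa using h.injective H
    rw [Equiv.optionCongr_apply, Option.map_some, Equiv.removeNone_some h this]

/-- Isomorphisms that respect inserted edges restrict. -/
theorem Iso.exists_of_insertEdge {m : BMap W B E} {m' : BMap W' B' E'}
    {u : W} {v : B} {c d : Option E} {u' : W'} {v' : B'} {c' d' : Option E'}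
    {hu : IsCorner m.atW u c} {hv : IsCorner m.atB v d}
    {hu' : IsCorner m'.atW u' c'} {hv' : IsCorner m'.atB v' d'}
    (φ : Iso (m.insertEdge hu hv) (m'.insertEdge hu' hv')) (h0 : φ.onE none = none) :
    ∃ ψ : Iso m m', ψ.onW u = u' ∧ ψ.onB v = v' ∧ c.map ψ.onE = c' ∧ d.map ψ.onE = d' := by
  have H := φ.eq_relabel
  obtain ⟨h, hh⟩ := exists_eq_optionCongr φ.onE h0
  rw [hh, relabel_insertEdge] at H
  obtain ⟨h1, h2, h3, h4, h5⟩ := insertEdge_inj H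
  exact ⟨Iso.ofEq h1, h2.symm, h3.symm, h4.symm, h5.symm⟩

/-! ### Disjoint unions -/

/-- The disjoint union of two maps. -/
def sum (m₁ : BMap W₁ B₁ E₁) (m₂ : BMap W₂ B₂ E₂) : BMap (W₁ ⊕ W₂) (B₁ ⊕ B₂) (E₁ ⊕ E₂) where
  atW := Sum.map m₁.atW m₂.atW
  atB := Sum.map m₁.atB m₂.atB
  rotW := Equiv.sumCongr m₁.rotW m₂.rotW
  rotB := Equiv.sumCongr m₁.rotB m₂.rotB
  atW_eq_iff := by
    rintro (e | e) (e' | e')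
    · simp [sameCycle_sumCongr_inl_inl, m₁.atW_eq_iff]
    · simp [not_sameCycle_sumCongr_inl_inr]
    · rw [Equiv.Perm.sameCycle_comm]
      simp [not_sameCycle_sumCongr_inl_inr]
    · simp [sameCycle_sumCongr_inr_inr, m₂.atW_eq_iff]
  atB_eq_iff := by
    rintro (e | e) (e' | e')
    · simp [sameCycle_sumCongr_inl_inl, m₁.atB_eq_iff]
    · simp [not_sameCycle_sumCongr_inl_inr]
    · rw [Equiv.Perm.sameCycle_comm]
      simp [not_sameCycle_sumCongr_inl_inr]
    · simp [sameCycle_sumCongr_inr_inr, m₂.atB_eq_iff]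

theorem sum_inj {m₁ m₁' : BMap W₁ B₁ E₁} {m₂ m₂' : BMap W₂ B₂ E₂} (h : m₁.sum m₂ = m₁'.sum m₂') :
    m₁ = m₁' ∧ m₂ = m₂' := by
  have h1 := fun e => congrArg (fun m => m.atW e) h
  have h2 := fun e => congrArg (fun m => m.atB e) h
  have h3 := fun e => congrArg (fun m => m.rotW e) h
  have h4 := fun e => congrArg (fun m => m.rotB e) h
  constructor
  · ext1 e
    · simpa [sum] using h1 (.inl e)
    · simpa [sum] using h2 (.inl e)
    · simpa [sum] using h3 (.inl e)
    · simpa [sum] using h4 (.inl e)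
  · ext1 e
    · simpa [sum] using h1 (.inr e)
    · simpa [sum] using h2 (.inr e)
    · simpa [sum] using h3 (.inr e)
    · simpa [sum] using h4 (.inr e)

theorem relabel_sum (m₁ : BMap W₁ B₁ E₁) (m₂ : BMap W₂ B₂ E₂) (f₁ : W₁ ≃ W₁') (g₁ : B₁ ≃ B₁')
    (h₁ : E₁ ≃ E₁') (f₂ : W₂ ≃ W₂') (g₂ : B₂ ≃ B₂') (h₂ : E₂ ≃ E₂') :
    (m₁.sum m₂).relabel (Equiv.sumCongr f₁ f₂) (Equiv.sumCongr g₁ g₂) (Equiv.sumCongr h₁ h₂) =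
      (m₁.relabel f₁ g₁ h₁).sum (m₂.relabel f₂ g₂ h₂) := by
  ext1 e <;> cases e <;> simp [relabel, sum, Equiv.permCongr_apply]

/-- The union of two isomorphisms. -/
def Iso.sum {m₁ : BMap W₁ B₁ E₁} {m₂ : BMap W₂ B₂ E₂} {m₁' : BMap W₁' B₁' E₁'}
    {m₂' : BMap W₂' B₂' E₂'} (φ : Iso m₁ m₁') (ψ : Iso m₂ m₂') :
    Iso (m₁.sum m₂) (m₁'.sum m₂') :=
  Iso.ofEq (f := Equiv.sumCongr φ.onW ψ.onW) (g := Equiv.sumCongr φ.onB ψ.onB)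
    (h := Equiv.sumCongr φ.onE ψ.onE) (by rw [relabel_sum, ← φ.eq_relabel, ← ψ.eq_relabel])

theorem exists_eq_sumCongr {α β α' β' : Type*} (φ : α ⊕ β ≃ α' ⊕ β')
    (h : ∀ x, (φ x).isLeft = x.isLeft) : ∃ φ₁ φ₂, φ = Equiv.sumCongr φ₁ φ₂ := by
  have h1 : ∀ a, ∃ a', φ (.inl a) = .inl a' := fun a => by simpa [Sum.isLeft_iff] using h (.inl a)
  have h2 : ∀ b, ∃ b', φ (.inr b) = .inr b' := fun b => by
    have := h (.inr b)
    rw [Sum.isLeft_inr, Sum.isLeft_eq_false, Sum.isRight_iff] at this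
    exact this
  choose f hf using h1
  choose g hg using h2
  have bf : Function.Bijective f := by
    refine ⟨fun a b hab => ?_, fun a' => ?_⟩
    · have : φ (.inl a) = φ (.inl b) := by rw [hf, hf, hab]
      simpa using this
    · obtain ⟨x | x, hx⟩ := φ.surjective (.inl a')
      · exact ⟨x, by simpa [hf] using hx⟩
      · simp [hg] at hx
  have bg : Function.Bijective g := by
    refine ⟨fun a b hab => ?_, fun a' => ?_⟩
    · have : φ (.inr a) = φ (.inr b) := by rw [hg, hg, hab]
      simpa using this
    · obtain ⟨x | x, hx⟩ := φ.surjective (.inr a')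
      · simp [hf] at hx
      · exact ⟨x, by simpa [hg] using hx⟩
  refine ⟨Equiv.ofBijective f bf, Equiv.ofBijective g bg, ?_⟩
  ext1 x
  rcases x with x | x
  · simp [hf]
  · simp [hg]

theorem isLeft_atW_sum (m₁ : BMap W₁ B₁ E₁) (m₂ : BMap W₂ B₂ E₂) (e : E₁ ⊕ E₂) :
    ((m₁.sum m₂).atW e).isLeft = e.isLeft := by
  cases e <;> rfl

theorem isLeft_atB_sum (m₁ : BMap W₁ B₁ E₁) (m₂ : BMap W₂ B₂ E₂) (e : E₁ ⊕ E₂) :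
    ((m₁.sum m₂).atB e).isLeft = e.isLeft := by
  cases e <;> rfl

/-- The rotations preserve the ends of edges, so if each edge has both ends on its own side, they
preserve the sides too. -/
theorem exists_eq_sum (m : BMap (W₁ ⊕ W₂) (B₁ ⊕ B₂) (E₁ ⊕ E₂))
    (hW : ∀ e, (m.atW e).isLeft = e.isLeft) (hB : ∀ e, (m.atB e).isLeft = e.isLeft) :
    ∃ m₁ m₂, m = sum m₁ m₂ := by
  have hfun : ∀ {α β : Type} (f : E₁ ⊕ E₂ → α ⊕ β), (∀ e, (f e).isLeft = e.isLeft) →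
      ∃ f₁ f₂, f = Sum.map f₁ f₂ := by
    intro α β f hf
    have h1 : ∀ a, ∃ a', f (.inl a) = .inl a' := fun a => by simpa [Sum.isLeft_iff] using hf (.inl a)
    have h2 : ∀ b, ∃ b', f (.inr b) = .inr b' := fun b => by
      have := hf (.inr b)
      rw [Sum.isLeft_inr, Sum.isLeft_eq_false, Sum.isRight_iff] at this
      exact this
    choose f₁ hf₁ using h1
    choose f₂ hf₂ using h2
    exact ⟨f₁, f₂, funext fun x => by cases x <;> simp [hf₁, hf₂]⟩
  obtain ⟨f₁, f₂, hf⟩ := hfun m.atW hW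
  obtain ⟨g₁, g₂, hg⟩ := hfun m.atB hB
  obtain ⟨σ₁, σ₂, hσ⟩ := exists_eq_sumCongr m.rotW fun e => by rw [← hW, m.atW_rotW, hW]
  obtain ⟨τ₁, τ₂, hτ⟩ := exists_eq_sumCongr m.rotB fun e => by rw [← hB, m.atB_rotB, hB]
  have h1 := m.atW_eq_iff
  have h2 := m.atB_eq_iff
  rw [hf, hσ] at h1
  rw [hg, hτ] at h2
  refine ⟨⟨f₁, g₁, σ₁, τ₁, fun e e' => ?_, fun e e' => ?_⟩,
    ⟨f₂, g₂, σ₂, τ₂, fun e e' => ?_, fun e e' => ?_⟩, ?_⟩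
  · simpa [sameCycle_sumCongr_inl_inl] using h1 (.inl e) (.inl e')
  · simpa [sameCycle_sumCongr_inl_inl] using h2 (.inl e) (.inl e')
  · simpa [sameCycle_sumCongr_inr_inr] using h1 (.inr e) (.inr e')
  · simpa [sameCycle_sumCongr_inr_inr] using h2 (.inr e) (.inr e')
  · ext1 e
    · exact congrFun hf e
    · exact congrFun hg e
    · exact congrArg (fun σ : Equiv.Perm _ => σ e) hσ
    · exact congrArg (fun σ : Equiv.Perm _ => σ e) hτ

theorem isCorner_inl {f : E₁ → W₁} {g : E₂ → W₂} {u : W₁} {c : Option E₁} :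
    IsCorner (Sum.map f g) (.inl u) (c.map Sum.inl) ↔ IsCorner f u c := by
  cases c <;> simp [isCorner_none, isCorner_some]

theorem isCorner_inr {f : E₁ → W₁} {g : E₂ → W₂} {u : W₂} {c : Option E₂} :
    IsCorner (Sum.map f g) (.inr u) (c.map Sum.inr) ↔ IsCorner g u c := by
  cases c <;> simp [isCorner_none, isCorner_some]

/-- Join two maps by an edge from a white corner of the first to a black corner of the second. -/
noncomputable def joinCorners (m₁ : BMap W₁ B₁ E₁) (m₂ : BMap W₂ B₂ E₂) {u : W₁} {c : Option E₁}
    {v : B₂} {c' : Option E₂} (hu : IsCorner m₁.atW u c) (hv : IsCorner m₂.atB v c') :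
    BMap (W₁ ⊕ W₂) (B₁ ⊕ B₂) (Option (E₁ ⊕ E₂)) :=
  (m₁.sum m₂).insertEdge (isCorner_inl.2 hu) (isCorner_inr.2 hv)

theorem conn_joinCorners {m₁ : BMap W₁ B₁ E₁} {m₂ : BMap W₂ B₂ E₂} {u : W₁} {c : Option E₁}
    {v : B₂} {c' : Option E₂} (hu : IsCorner m₁.atW u c) (hv : IsCorner m₂.atB v c')
    (h₁ : m₁.Conn) (h₂ : m₂.Conn) : (joinCorners m₁ m₂ hu hv).Conn := by
  refine (conn_insertEdge _ _ _).2 fun P hP huv => ?_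
  have k1 := h₁.2 (fun x => P (x.map .inl .inl)) fun e => hP (.inl e)
  have k2 := h₂.2 (fun x => P (x.map .inr .inr)) fun e => hP (.inr e)
  have key : ∀ x, P x ↔ P (.inl (.inl u)) := by
    rintro ((x | x) | (x | x))
    · exact ⟨k1 (.inl x) (.inl u), k1 (.inl u) (.inl x)⟩
    · rw [huv]
      exact ⟨k2 (.inl x) (.inr v), k2 (.inr v) (.inl x)⟩
    · exact ⟨k1 (.inr x) (.inl u), k1 (.inl u) (.inr x)⟩
    · rw [huv]
      exact ⟨k2 (.inr x) (.inr v), k2 (.inr v) (.inr x)⟩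
  exact fun x y hx => (key y).2 ((key x).1 hx)

theorem isTree_joinCorners [Finite W₁] [Finite B₁] [Finite E₁] [Finite W₂] [Finite B₂] [Finite E₂]
    {m₁ : BMap W₁ B₁ E₁} {m₂ : BMap W₂ B₂ E₂} {u : W₁} {c : Option E₁}
    {v : B₂} {c' : Option E₂} (hu : IsCorner m₁.atW u c) (hv : IsCorner m₂.atB v c')
    (h₁ : m₁.IsTree) (h₂ : m₂.IsTree) : (joinCorners m₁ m₂ hu hv).IsTree := by
  refine ⟨conn_joinCorners hu hv h₁.1 h₂.1, ?_⟩
  have := h₁.2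
  have := h₂.2
  simp only [Finite.card_option, Nat.card_sum]
  omega

/-- Isomorphisms of joined maps that respect the joining edge come from isomorphisms of the
parts. -/
theorem Iso.exists_of_joinCorners {m₁ : BMap W₁ B₁ E₁} {m₂ : BMap W₂ B₂ E₂} {u : W₁}
    {c : Option E₁} {v : B₂} {d : Option E₂} {hu : IsCorner m₁.atW u c} {hv : IsCorner m₂.atB v d}
    {m₁' : BMap W₁' B₁' E₁'} {m₂' : BMap W₂' B₂' E₂'} {u' : W₁'}
    {c' : Option E₁'} {v' : B₂'} {d' : Option E₂'} {hu' : IsCorner m₁'.atW u' c'}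
    {hv' : IsCorner m₂'.atB v' d'} (h₁ : m₁.Conn) (h₂ : m₂.Conn)
    (φ : Iso (joinCorners m₁ m₂ hu hv) (joinCorners m₁' m₂' hu' hv')) (h0 : φ.onE none = none) :
    (∃ φ₁ : Iso m₁ m₁', φ₁.onW u = u' ∧ c.map φ₁.onE = c') ∧
      ∃ φ₂ : Iso m₂ m₂', φ₂.onB v = v' ∧ d.map φ₂.onE = d' := by
  obtain ⟨ψ, hψu, hψv, hψc, hψd⟩ := φ.exists_of_insertEdge h0
  have hside : ∀ e, (ψ.onW ((m₁.sum m₂).atW e)).isLeft = (ψ.onB ((m₁.sum m₂).atB e)).isLeft :=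
    fun e => by rw [ψ.map_atW, ψ.map_atB, isLeft_atW_sum, isLeft_atB_sum]
  -- Without the joining edge, the side on which the image lies is constant on each part, and the
  -- roots fix its value.
  let side : (W₁ ⊕ W₂) ⊕ (B₁ ⊕ B₂) → Bool :=
    Sum.elim (fun w => (ψ.onW w).isLeft) fun b => (ψ.onB b).isLeft
  have k1 : ∀ x : W₁ ⊕ B₁, side (x.map .inl .inl) = true := fun x =>
    h₁.2 (fun x => side (x.map .inl .inl) = true)
      (fun e => by
        have : (ψ.onW (.inl (m₁.atW e))).isLeft = (ψ.onB (.inl (m₁.atB e))).isLeft :=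
          hside (.inl e)
        simp [side, this]) (.inl u) x (by simp [side, hψu])
  have k2 : ∀ x : W₂ ⊕ B₂, side (x.map .inr .inr) = false := fun x =>
    h₂.2 (fun x => side (x.map .inr .inr) = false)
      (fun e => by
        have : (ψ.onW (.inr (m₂.atW e))).isLeft = (ψ.onB (.inr (m₂.atB e))).isLeft :=
          hside (.inr e)
        simp only [side, Sum.map_inl, Sum.map_inr, Sum.elim_inl, Sum.elim_inr, this])
      (.inr v) x (by simp [side, hψv])
  have kW : ∀ w, (ψ.onW w).isLeft = w.isLeft := by
    rintro (w | w)
    · exact k1 (.inl w)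
    · exact k2 (.inl w)
  have kB : ∀ b, (ψ.onB b).isLeft = b.isLeft := by
    rintro (b | b)
    · exact k1 (.inr b)
    · exact k2 (.inr b)
  have kE : ∀ e, (ψ.onE e).isLeft = e.isLeft := fun e => by
    rw [← isLeft_atW_sum m₁' m₂', ← ψ.map_atW, kW, isLeft_atW_sum]
  have H := ψ.eq_relabel
  obtain ⟨f₁, f₂, hf⟩ := exists_eq_sumCongr _ kW
  obtain ⟨g₁, g₂, hg⟩ := exists_eq_sumCongr _ kB
  obtain ⟨e₁, e₂, he⟩ := exists_eq_sumCongr _ kE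
  rw [hf, hg, he, relabel_sum] at H
  obtain ⟨H1, H2⟩ := sum_inj H
  rw [hf] at hψu
  rw [hg] at hψv
  rw [he] at hψc hψd
  refine ⟨⟨Iso.ofEq H1, Sum.inl_injective hψu, ?_⟩, ⟨Iso.ofEq H2, Sum.inr_injective hψv, ?_⟩⟩
  · apply Option.map_injective (Sum.inl_injective (α := E₁') (β := E₂'))
    rw [← hψc, Option.map_map, Option.map_map]
    rfl
  · apply Option.map_injective (Sum.inr_injective (α := E₁') (β := E₂'))
    rw [← hψd, Option.map_map, Option.map_map]
    rfl

/-- Join isomorphisms. -/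
noncomputable def Iso.joinCorners {m₁ : BMap W₁ B₁ E₁} {m₂ : BMap W₂ B₂ E₂} {u : W₁}
    {c : Option E₁} {v : B₂} {d : Option E₂} {hu : IsCorner m₁.atW u c} {hv : IsCorner m₂.atB v d}
    {m₁' : BMap W₁' B₁' E₁'} {m₂' : BMap W₂' B₂' E₂'} {u' : W₁'}
    {c' : Option E₁'} {v' : B₂'} {d' : Option E₂'} {hu' : IsCorner m₁'.atW u' c'}
    {hv' : IsCorner m₂'.atB v' d'} (φ₁ : Iso m₁ m₁') (φ₂ : Iso m₂ m₂')
    (h1 : φ₁.onW u = u') (h2 : c.map φ₁.onE = c') (h3 : φ₂.onB v = v') (h4 : d.map φ₂.onE = d') :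
    Iso (m₁.joinCorners m₂ hu hv) (m₁'.joinCorners m₂' hu' hv') :=
  (φ₁.sum φ₂).insertEdge (congrArg Sum.inl h1) (congrArg Sum.inr h3)
    (by rw [← h2, Option.map_map, Option.map_map]; rfl)
    (by rw [← h4, Option.map_map, Option.map_map]; rfl)

/-! ### Doubling an edge -/

/-- Double an edge, so that a face of perimeter two arises. -/
noncomputable def doubleEdge (m : BMap W B E) (i : E) : BMap W B (Option E) :=
  m.insertEdge (u := m.atW i) (c := some (m.rotW i)) (v := m.atB i) (c' := some i)
    (isCorner_some.2 (m.atW_rotW i)) (isCorner_some.2 rfl)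

/-- The copy precedes `i` around the black end and follows it around the white end. A walk that
passes the copy from white to black therefore returns along `i` and closes up. -/
theorem facePerm_doubleEdge_none (m : BMap W B E) (i : E) :
    (m.doubleEdge i).facePerm none = none := by
  change insertNone (some (m.rotW i)) m.rotW (insertNone (some i) m.rotB none) = none
  rw [insertNone_none, insertNone_some, if_pos rfl]

/-- A walk that used to return to the white end along `i` now returns along the copy and continues
with the same edge; all other steps are unchanged. -/
theorem facePerm_doubleEdge_some (m : BMap W B E) (i e : E) :
    (m.doubleEdge i).facePerm (some e) = some (m.facePerm e) := by
  change insertNone (some (m.rotW i)) m.rotW (insertNone (some i) m.rotB (some e)) =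
    some (m.rotW (m.rotB e))
  rw [insertNone_some]
  split_ifs with h
  · rw [insertNone_none]
    rw [Option.some_inj] at h
    rw [h]
  · rw [insertNone_some, if_neg]
    intro h'
    exact h (congrArg some (m.rotW.injective (Option.some_injective _ h')))

theorem sameCycle_doubleEdge (m : BMap W B E) (i a b : E) (h : m.facePerm.SameCycle a b) :
    (m.doubleEdge i).facePerm.SameCycle (some a) (some b) := by
  rw [sameCycle_iff_forall] at h ⊢
  intro P hP
  exact h (fun e => P (some e)) fun e => by rw [← facePerm_doubleEdge_some, hP]

theorem conn_doubleEdge (m : BMap W B E) (i : E) : (m.doubleEdge i).Conn ↔ m.Conn := by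
  unfold doubleEdge
  rw [conn_insertEdge]
  constructor
  · intro h
    exact ⟨⟨.inl (m.atW i)⟩, fun P hP => h P hP (hP i)⟩
  · intro h P hP _
    exact h.2 P hP

/-- Isomorphisms extend to doubled edges. -/
noncomputable def Iso.doubleEdge {m : BMap W B E} {m' : BMap W' B' E'} (φ : Iso m m') {i : E}
    {i' : E'} (h : φ.onE i = i') : Iso (m.doubleEdge i) (m'.doubleEdge i') :=
  φ.insertEdge (by rw [φ.map_atW, h]) (by rw [φ.map_atB, h])
    (by rw [Option.map_some, φ.map_rotW, h]) (by rw [Option.map_some, h])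

theorem Iso.exists_of_doubleEdge {m : BMap W B E} {m' : BMap W' B' E'} {i : E} {i' : E'}
    (φ : Iso (m.doubleEdge i) (m'.doubleEdge i')) (h0 : φ.onE none = none) :
    ∃ ψ : Iso m m', ψ.onE i = i' := by
  obtain ⟨ψ, -, -, -, h⟩ := φ.exists_of_insertEdge h0
  exact ⟨ψ, by simpa using h⟩

/-- A face of perimeter two of a connected map with other edges arises by doubling an edge. -/
theorem exists_eq_doubleEdge (m : BMap W B (Option E)) (hm : m.Conn) [Nonempty E]
    (h : m.facePerm none = none) : ∃ (m' : BMap W B E) (i : E), m = m'.doubleEdge i := by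
  obtain ⟨m', u, c, v, c', hu, hv, rfl⟩ := m.exists_eq_insertEdge
  change insertNone c _ (insertNone c' _ none) = none at h
  rw [insertNone_none] at h
  cases c' with
  | none =>
    exfalso
    rw [insertNone_none] at h
    subst h
    -- Here both ends of the removed edge would be isolated, so that edge would be a whole
    -- component.
    have hu' := isCorner_none.1 hu
    have hv' := isCorner_none.1 hv
    obtain ⟨e⟩ := ‹Nonempty E›
    have := (conn_insertEdge _ _ _).1 hm (fun x => x = .inl u ∨ x = .inr v)
      (fun e => by simp [hu' e, hv' e]) (by simp) (.inl u) (.inl (m'.atW e)) (Or.inl rfl)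
    simp [hu' e] at this
  | some i =>
    rw [insertNone_some] at h
    -- For the face to close after `i`, the removed edge must come right after `i` around the white
    -- end.
    have hc : some (m'.rotW i) = c := by
      by_contra hc
      rw [if_neg hc] at h
      cases h
    subst hc
    refine ⟨m', i, insertEdge_congr rfl ?_ ?_ rfl rfl⟩
    · rw [← isCorner_some.1 hu, m'.atW_rotW]
    · rw [← isCorner_some.1 hv]

end BMap

/-! ### Cutting a tree at an edge -/

theorem exists_equiv_sum_fin {α : Type} [Finite α] (R : α → Prop) :
    ∃ (p q : ℕ) (f : α ≃ Fin p ⊕ Fin q), ∀ a, (f a).isLeft = true ↔ R a := by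
  classical
  refine ⟨_, _, (Equiv.sumCompl R).symm.trans (Equiv.sumCongr (Finite.equivFin {a // R a})
    (Finite.equivFin {a // ¬ R a})), fun a => ?_⟩
  by_cases h : R a
  · simp [Equiv.sumCompl_symm_apply_of_pos h, h]
  · simp [Equiv.sumCompl_symm_apply_of_neg h, h]

theorem eq_and_eq_of_le_of_add_eq {p₁ p₂ q₁ q₂ n₁ n₂ : ℕ} (h₁ : p₁ + q₁ ≤ n₁ + 1)
    (h₂ : p₂ + q₂ ≤ n₂ + 1) (h : p₁ + p₂ + (q₁ + q₂) = n₁ + n₂ + 1 + 1) :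
    p₁ + q₁ = n₁ + 1 ∧ p₂ + q₂ = n₂ + 1 := by
  omega

namespace CornerTree

/-- The tree rooted at a corner, from a labelled tree. -/
def mk' {p q n : ℕ} (m : BMap (Fin p) (Fin q) (Fin n)) (hm : m.IsTree) {u : Fin p}
    {c : Option (Fin n)} (h : BMap.IsCorner m.atW u c) : CornerTree :=
  ⟨PlaneTree.ofIsTree m hm, ⟨(u, c), h⟩⟩

/-- Join the white root of `S` and the root of `T`, with its colours interchanged, by an edge. -/
noncomputable def join (S T : CornerTree) : BMap (Fin S.1.nW ⊕ Fin T.1.nB)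
    (Fin S.1.nB ⊕ Fin T.1.nW) (Option (Fin S.1.nE ⊕ Fin T.1.nE)) :=
  S.1.map.joinCorners T.1.map.swap S.2.2 T.2.2

theorem isTree_join (S T : CornerTree) : (S.join T).IsTree :=
  BMap.isTree_joinCorners S.2.2 T.2.2 S.1.isTree T.1.isTree.swap

end CornerTree

/-- Deleting the edge `none` separates its ends, since a connected map with the remaining edges
would have too many vertices. Each side is connected and has at most one vertex more than edges; the
total forces equality on both sides, so both are trees. -/
theorem BMap.IsTree.exists_iso_join {W B E : Type} [Finite W] [Finite B] [Finite E]
    {m : BMap W B (Option E)} (hm : m.IsTree) :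
    ∃ (S T : CornerTree) (φ : m.Iso (S.join T)), φ.onE none = none := by
  obtain ⟨m₀, u, c, v, d, hu, hv, rfl⟩ := m.exists_eq_insertEdge
  have hconn := (conn_insertEdge _ _ _).1 hm.1
  have hcard := hm.2
  rw [Finite.card_option] at hcard
  let closed : (W ⊕ B → Prop) → Prop := fun P => ∀ e, P (.inl (m₀.atW e)) ↔ P (.inr (m₀.atB e))
  -- The component of `u` after the deletion.
  let R : W ⊕ B → Prop := fun x => ∀ P, closed P → P (.inl u) → P x
  have hR : closed R := fun e =>
    ⟨fun h P hP hPu => (hP e).1 (h P hP hPu), fun h P hP hPu => (hP e).2 (h P hP hPu)⟩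
  have hRu : R (.inl u) := fun P _ h => h
  have hRv : ¬ R (.inr v) := fun h => by
    have : m₀.Conn := ⟨⟨.inl u⟩, fun P hP => hconn P hP ⟨h P hP, fun hPv => by
      by_contra hPu
      exact h (fun x => ¬ P x) (fun e => not_congr (hP e)) hPu hPv⟩⟩
    have := this.card_le
    omega
  obtain ⟨p₁, p₂, f, hf⟩ := exists_equiv_sum_fin fun w => R (.inl w)
  obtain ⟨q₁, q₂, g, hg⟩ := exists_equiv_sum_fin fun b => R (.inr b)
  obtain ⟨n₁, n₂, h, hh⟩ := exists_equiv_sum_fin fun e => R (.inl (m₀.atW e))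
  have hfW : ∀ e, ((m₀.relabel f g h).atW e).isLeft = e.isLeft := fun e => by
    rw [Bool.eq_iff_iff]
    conv_rhs => rw [← h.apply_symm_apply e]
    rw [hh]
    exact hf _
  have hgB : ∀ e, ((m₀.relabel f g h).atB e).isLeft = e.isLeft := fun e => by
    rw [Bool.eq_iff_iff]
    conv_rhs => rw [← h.apply_symm_apply e]
    rw [hh, hR]
    exact hg _
  obtain ⟨m₁, m₂, hsum⟩ := exists_eq_sum _ hfW hgB
  obtain ⟨u₁, hu₁⟩ := Sum.isLeft_iff.1 ((hf u).2 hRu)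
  obtain ⟨v₂, hv₂⟩ : ∃ v₂, g v = .inr v₂ := by
    rw [← Sum.isRight_iff, ← Sum.isLeft_eq_false, Bool.eq_false_iff]
    exact fun h' => hRv ((hg v).1 h')
  let φ₀ : m₀.Iso (m₁.sum m₂) := Iso.ofEq hsum.symm
  have hcu : IsCorner (m₁.sum m₂).atW (.inl u₁) (c.map h) := hu₁ ▸ isCorner_map φ₀ hu
  have hcv : IsCorner (m₁.sum m₂).atB (.inr v₂) (d.map h) := hv₂ ▸ isCorner_map φ₀.swap hv
  obtain ⟨c₁, hc₁⟩ : ∃ c₁ : Option (Fin n₁), c.map h = c₁.map .inl := by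
    cases hc : c.map h with
    | none => exact ⟨none, rfl⟩
    | some e =>
      rw [hc, isCorner_some] at hcu
      rcases e with e | e
      · exact ⟨some e, rfl⟩
      · simp [BMap.sum] at hcu
  obtain ⟨d₂, hd₂⟩ : ∃ d₂ : Option (Fin n₂), d.map h = d₂.map .inr := by
    cases hd : d.map h with
    | none => exact ⟨none, rfl⟩
    | some e =>
      rw [hd, isCorner_some] at hcv
      rcases e with e | e
      · simp [BMap.sum] at hcv
      · exact ⟨some e, rfl⟩
  rw [hc₁] at hcu
  rw [hd₂] at hcv
  have hu' : IsCorner m₁.atW u₁ c₁ := isCorner_inl.1 hcu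
  have hv' : IsCorner m₂.atB v₂ d₂ := isCorner_inr.1 hcv
  let s : W ⊕ B → (Fin p₁ ⊕ Fin p₂) ⊕ (Fin q₁ ⊕ Fin q₂) := Sum.map f g
  have hclosed : ∀ Q : (Fin p₁ ⊕ Fin p₂) ⊕ (Fin q₁ ⊕ Fin q₂) → Prop,
      (∀ e, Q (.inl ((m₁.sum m₂).atW e)) ↔ Q (.inr ((m₁.sum m₂).atB e))) →
        closed fun x => Q (s x) := fun Q hQ e => by
    have := hQ (φ₀.onE e)
    rw [← φ₀.map_atW, ← φ₀.map_atB] at this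
    exact this
  have hconn₁ : m₁.Conn := by
    refine ⟨⟨.inl u₁⟩, fun P hP => ?_⟩
    -- `Q` holds at `u` and is shared along the remaining edges, so it holds throughout the
    -- component of `u`, which is the first part.
    let Q : (Fin p₁ ⊕ Fin p₂) ⊕ (Fin q₁ ⊕ Fin q₂) → Prop :=
      Sum.elim (Sum.elim (fun w => P (.inl w) ↔ P (.inl u₁)) fun _ => True)
        (Sum.elim (fun b => P (.inr b) ↔ P (.inl u₁)) fun _ => True)
    have hQ := hclosed Q (by
      rintro (e | e)
      · simp [Q, BMap.sum, hP e]
      · simp [Q, BMap.sum])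
    have key : ∀ x, P x ↔ P (.inl u₁) := by
      rintro (x | x)
      · have := (hf (f.symm (.inl x))).1 (by simp) (fun x => Q (s x)) hQ (by simp [Q, s, hu₁])
        simpa [Q, s] using this
      · have := (hg (g.symm (.inl x))).1 (by simp) (fun x => Q (s x)) hQ (by simp [Q, s, hu₁])
        simpa [Q, s] using this
    exact fun x y hx => (key y).2 ((key x).1 hx)
  have hconn₂ : m₂.Conn := by
    refine ⟨⟨.inr v₂⟩, fun P hP => ?_⟩
    -- Giving the whole first part the value of `P` at `v₂` makes `Q` respect the deleted edge as
    -- well, so connectedness of the original tree applies.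
    let Q : (Fin p₁ ⊕ Fin p₂) ⊕ (Fin q₁ ⊕ Fin q₂) → Prop :=
      Sum.elim (Sum.elim (fun _ => P (.inr v₂)) fun w => P (.inl w))
        (Sum.elim (fun _ => P (.inr v₂)) fun b => P (.inr b))
    have hQ := hclosed Q (by
      rintro (e | e)
      · simp [Q, BMap.sum]
      · simp [Q, BMap.sum, hP e])
    have key := hconn (fun x => Q (s x)) hQ (by simp [Q, s, hu₁, hv₂])
    rintro (x | x) (y | y)
    · simpa [Q, s] using key (.inl (f.symm (.inr x))) (.inl (f.symm (.inr y)))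
    · simpa [Q, s] using key (.inl (f.symm (.inr x))) (.inr (g.symm (.inr y)))
    · simpa [Q, s] using key (.inr (g.symm (.inr x))) (.inl (f.symm (.inr y)))
    · simpa [Q, s] using key (.inr (g.symm (.inr x))) (.inr (g.symm (.inr y)))
  have hle₁ := hconn₁.card_le
  have hle₂ := hconn₂.card_le
  rw [Nat.card_congr f, Nat.card_congr g, Nat.card_congr h] at hcard
  rw [Nat.card_sum, Nat.card_sum, Nat.card_sum] at hcard
  obtain ⟨k₁, k₂⟩ := eq_and_eq_of_le_of_add_eq hle₁ hle₂ hcard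
  have ht₁ : m₁.IsTree := ⟨hconn₁, k₁⟩
  have ht₂ : m₂.IsTree := ⟨hconn₂, k₂⟩
  exact ⟨CornerTree.mk' m₁ ht₁ hu', CornerTree.mk' m₂.swap ht₂.swap hv',
    φ₀.insertEdge (hu' := hcu) (hv' := hcv) hu₁ hv₂ hc₁ hd₂, rfl⟩

/-! ### Gluing two rooted trees to a `2^1`-map -/

theorem card_sum_map_fiber_inl {α β γ δ : Type} (f : α → γ) (g : β → δ) (c : γ) :
    Nat.card {x // Sum.map f g x = .inl c} = Nat.card {x // f x = c} :=
  Nat.card_congr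
    { toFun := fun x => match x with
        | ⟨.inl x, h⟩ => ⟨x, Sum.inl_injective h⟩
        | ⟨.inr _, h⟩ => by simp at h
      invFun := fun x => ⟨.inl x.1, congrArg Sum.inl x.2⟩
      left_inv := by
        rintro ⟨x | x, h⟩
        · rfl
        · simp at h
      right_inv := fun _ => rfl }

theorem card_sum_map_fiber_inr {α β γ δ : Type} (f : α → γ) (g : β → δ) (d : δ) :
    Nat.card {x // Sum.map f g x = .inr d} = Nat.card {x // g x = d} := by
  rw [← card_sum_map_fiber_inl g f d]
  refine Nat.card_congr ((Equiv.sumComm α β).subtypeEquiv ?_)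
  rintro (x | x) <;> simp

/-! ### Degrees in disjoint unions. -/

section degrees

variable {W₁ B₁ E₁ W₂ B₂ E₂ : Type} (m₁ : BMap W₁ B₁ E₁) (m₂ : BMap W₂ B₂ E₂)

theorem BMap.degW_sum_inl (w : W₁) : (m₁.sum m₂).degW (.inl w) = m₁.degW w :=
  card_sum_map_fiber_inl _ _ _

theorem BMap.degW_sum_inr (w : W₂) : (m₁.sum m₂).degW (.inr w) = m₂.degW w :=
  card_sum_map_fiber_inr _ _ _

theorem BMap.degB_sum_inl (b : B₁) : (m₁.sum m₂).degB (.inl b) = m₁.degB b :=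
  card_sum_map_fiber_inl _ _ _

theorem BMap.degB_sum_inr (b : B₂) : (m₁.sum m₂).degB (.inr b) = m₂.degB b :=
  card_sum_map_fiber_inr _ _ _

end degrees

theorem BMap.Iso.sameCycle_facePerm {W B E W' B' E' : Type} {m : BMap W B E} {m' : BMap W' B' E'}
    (φ : m.Iso m') (x y : E) :
    m'.facePerm.SameCycle (φ.onE x) (φ.onE y) ↔ m.facePerm.SameCycle x y := by
  have : m'.facePerm = φ.onE.permCongr m.facePerm := by
    ext1 e
    rw [Equiv.permCongr_apply, φ.map_facePerm, Equiv.apply_symm_apply]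
  rw [this, sameCycle_permCongr, Equiv.symm_apply_apply, Equiv.symm_apply_apply]

namespace TwoOneMap

/-- `e` is the edge that is passed from white to black on the boundary of the inner face. -/
def IsInner (S : TwoOneMap) (e : Fin S.nE) : Prop := ∀ x, S.map.faceOf x = S.outer ↔ x ≠ e

/-- A face of perimeter two is passed from white to black along a single edge, a fixed point of the
face permutation. Every other edge is passed in that direction on the outer face, which is nonempty
and provides `e'`. -/
theorem exists_isInner (S : TwoOneMap) : ∃ e, S.IsInner e ∧ S.map.facePerm e = e ∧
    ∃ e', e' ≠ e := by
  have h2 := S.twoFaces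
  unfold BMap.numFaces at h2
  split_ifs at h2 with hE
  · omega
  obtain ⟨f, hf⟩ : ∃ f, f ≠ S.outer := by
    obtain ⟨a, b, hab, -⟩ := Nat.card_eq_two_iff.1 h2
    by_cases ha : a = S.outer
    · exact ⟨b, fun hb => hab (ha.trans hb.symm)⟩
    · exact ⟨a, ha⟩
  have huniq : ∀ f', f' ≠ S.outer → f' = f := by
    intro f' hf'
    by_contra hne
    classical
    have h3 : ({S.outer, f, f'} : Finset S.map.Face).card ≤ 2 := by
      have := Fintype.ofFinite S.map.Face
      rw [← h2, Nat.card_eq_fintype_card]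
      exact Finset.card_le_univ _
    rw [Finset.card_eq_three.2 ⟨_, _, _, hf.symm, hf'.symm, Ne.symm hne, rfl⟩] at h3
    omega
  have hp := S.perimeter_eq f hf
  unfold BMap.perimeter at hp
  have hp1 : Nat.card {e // S.map.faceOf e = f} = 1 := by omega
  rw [Nat.card_eq_one_iff_unique] at hp1
  obtain ⟨hss, ⟨e, he⟩⟩ := hp1
  have hu : ∀ x, S.map.faceOf x = f → x = e := fun x hx =>
    congrArg Subtype.val (Subsingleton.elim (⟨x, hx⟩ : {e // S.map.faceOf e = f}) ⟨e, he⟩)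
  obtain ⟨e', he'⟩ := S.map.faceOf_surjective S.outer
  refine ⟨e, fun x => ⟨?_, fun hx => ?_⟩, ?_, e', ?_⟩
  · rintro hx rfl
    exact hf (he.symm.trans hx)
  · by_contra hx'
    exact hx (hu x (huniq _ hx'))
  · apply hu
    rw [← he, BMap.faceOf_eq_iff, Equiv.Perm.sameCycle_apply_left]
  · rintro rfl
    exact hf (he.symm.trans he')

theorem equiv_of_iso {S T : TwoOneMap} {e : Fin S.nE} {e' : Fin T.nE} (he : S.IsInner e)
    (he' : T.IsInner e') (φ : S.map.Iso T.map) (h : φ.onE e = e') : S ≈ T :=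
  ⟨φ, fun x => by rw [he, he', ← h, Ne, Ne, φ.onE.apply_eq_iff_eq]⟩

theorem exists_iso_of_equiv {S T : TwoOneMap} {e : Fin S.nE} {e' : Fin T.nE} (he : S.IsInner e)
    (he' : T.IsInner e') (h : S ≈ T) : ∃ φ : S.map.Iso T.map, φ.onE e = e' := by
  obtain ⟨φ, hφ⟩ := h
  refine ⟨φ, ?_⟩
  by_contra hne
  exact (he e).1 ((hφ e).2 ((he' _).2 hne)) rfl

/-- One fixed point and one cycle through everything else are exactly two faces, and Euler's formula
then reads vertices = edges. -/
theorem exists_of_facePerm {p q n : ℕ} (m : BMap (Fin p) (Fin q) (Fin n)) (hm : m.Conn)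
    (hV : p + q = n) (e₀ e₁ : Fin n) (hne : e₁ ≠ e₀) (h0 : m.facePerm e₀ = e₀)
    (h : ∀ x y, x ≠ e₀ → y ≠ e₀ → m.facePerm.SameCycle x y) :
    ∃ hS : m.IsPlane ∧ m.numFaces = 2 ∧ ∀ f, f ≠ m.faceOf e₁ → m.perimeter f = 2,
      IsInner ⟨p, q, n, m, m.faceOf e₁, hS.1, hS.2.1, hS.2.2⟩ e₀ := by
  have h1 : ∀ x, m.faceOf x = m.faceOf e₀ ↔ x = e₀ := fun x => by
    rw [BMap.faceOf_eq_iff, Equiv.Perm.sameCycle_comm, sameCycle_iff_forall]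
    constructor
    · intro H
      exact H (fun z => z = e₀) (fun z => by
        rw [← h0, m.facePerm.apply_eq_iff_eq, h0]) rfl
    · rintro rfl P _ hx
      exact hx
  have h2 : ∀ x, m.faceOf x = m.faceOf e₁ ↔ x ≠ e₀ := fun x => by
    constructor
    · rintro hx rfl
      exact hne ((h1 e₁).1 hx.symm)
    · intro hx
      rw [BMap.faceOf_eq_iff]
      exact h x e₁ hx hne
  have h3 : m.numFaces = 2 := by
    unfold BMap.numFaces
    rw [if_neg (not_isEmpty_iff.2 ⟨e₀⟩), Nat.card_eq_two_iff]
    refine ⟨m.faceOf e₁, m.faceOf e₀, fun H => hne ((h1 e₁).1 H), ?_⟩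
    rw [Set.eq_univ_iff_forall]
    intro f
    obtain ⟨x, rfl⟩ := m.faceOf_surjective f
    by_cases hx : x = e₀
    · right; rw [hx]; rfl
    · left; exact (h2 x).2 hx
  refine ⟨⟨⟨m.connected_graph_iff.2 hm, by simp [h3, hV]⟩, h3, fun f hf => ?_⟩, h2⟩
  obtain ⟨x, rfl⟩ := m.faceOf_surjective f
  obtain rfl : x = e₀ := by
    by_contra hx
    exact hf ((h2 x).2 hx)
  unfold BMap.perimeter
  have : Nat.card {e // m.faceOf e = m.faceOf x} = 1 := Nat.card_eq_one_iff_unique.2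
    ⟨⟨fun a b => Subtype.ext (((h1 _).1 a.2).trans ((h1 _).1 b.2).symm)⟩, ⟨⟨x, rfl⟩⟩⟩
  rw [this]

theorem exists_iso_doubleEdge {W B E : Type} [Finite W] [Finite B] [Finite E] {m : BMap W B E}
    (hm : m.IsTree) (i : E) :
    ∃ (S : TwoOneMap) (φ : (m.doubleEdge i).Iso S.map), S.IsInner (φ.onE none) := by
  let φ := (m.doubleEdge i).relabelIso (Finite.equivFin W) (Finite.equivFin B)
    (Finite.equivFin (Option E))
  obtain ⟨hS, hin⟩ := exists_of_facePerm ((m.doubleEdge i).relabel (Finite.equivFin W)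
    (Finite.equivFin B) (Finite.equivFin (Option E)))
    (φ.conn ((m.conn_doubleEdge i).2 hm.1)) (by rw [hm.2, Finite.card_option])
    (φ.onE none) (φ.onE (some i)) (by simp)
    (by rw [← φ.map_facePerm, m.facePerm_doubleEdge_none]) (by
      intro x y hx hy
      obtain ⟨x, rfl⟩ := φ.onE.surjective x
      obtain ⟨y, rfl⟩ := φ.onE.surjective y
      rw [φ.sameCycle_facePerm]
      cases x with
      | none => exact absurd rfl hx
      | some x =>
        cases y with
        | none => exact absurd rfl hy
        | some y => exact m.sameCycle_doubleEdge i x y (hm.sameCycle_facePerm x y))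
  exact ⟨⟨_, _, _, _, _, hS.1, hS.2.1, hS.2.2⟩, φ, hin⟩

/-- Undoing the doubling at the inner face removes one edge and leaves a tree with a marked edge;
cutting the tree there gives the two rooted trees. -/
theorem exists_iso_join (U : TwoOneMap) : ∃ (S T : CornerTree)
    (φ : U.map.Iso ((S.join T).doubleEdge none)), U.IsInner (φ.onE.symm none) := by
  obtain ⟨e, he, hfix, e', hne⟩ := U.exists_isInner
  let h : Option {x // x ≠ e} ≃ Fin U.nE := Equiv.optionSubtypeNe e
  let φ₁ := U.map.relabelIso (Equiv.refl _) (Equiv.refl _) h.symm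
  have hconn : U.map.Conn := U.map.connected_graph_iff.1 U.isPlane.1
  have hcard := U.isPlane.2
  rw [U.twoFaces, ← Nat.card_congr h, Finite.card_option] at hcard
  have : Nonempty {x // x ≠ e} := ⟨⟨e', hne⟩⟩
  have h1 : h.symm e = none := by simp [h]
  obtain ⟨m, i, hm⟩ := (U.map.relabel (Equiv.refl _) (Equiv.refl _) h.symm).exists_eq_doubleEdge
    (φ₁.conn hconn) (by
      have h1' : φ₁.onE e = none := h1
      have := φ₁.map_facePerm e
      rw [hfix, h1'] at this
      exact this.symm)
  have hmt : m.IsTree := by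
    refine ⟨(m.conn_doubleEdge i).1 ?_, by omega⟩
    rw [← hm]
    exact φ₁.conn hconn
  classical
  -- The marked edge is renamed `none`, so that the tree can be cut there.
  let k : Option {x // x ≠ i} ≃ {x // x ≠ e} := Equiv.optionSubtypeNe i
  let φ₂ := m.relabelIso (Equiv.refl _) (Equiv.refl _) k.symm
  obtain ⟨S, T, φ₃, h3⟩ := (φ₂.isTree hmt).exists_iso_join
  have h2 : (φ₂.trans φ₃).onE i = none := by
    change φ₃.onE (k.symm i) = none
    rw [show k.symm i = none by simp [k], h3]
  let φ₀ : U.map.Iso (m.doubleEdge i) := BMap.Iso.ofEq hm.symm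
  refine ⟨S, T, φ₀.trans ((φ₂.trans φ₃).doubleEdge h2), ?_⟩
  have h4 : (φ₀.trans ((φ₂.trans φ₃).doubleEdge h2)).onE e = none := by
    change ((φ₂.trans φ₃).doubleEdge h2).onE (h.symm e) = none
    rw [h1]
    rfl
  rwa [← h4, Equiv.symm_apply_apply]

/-- The `2^1`-map glued from two rooted trees. -/
noncomputable def glue (S T : CornerTree) : TwoOneMap :=
  (exists_iso_doubleEdge (S.isTree_join T) none).choose

/-- The glued map is the join with the joining edge doubled. -/
noncomputable def glueIso (S T : CornerTree) : ((S.join T).doubleEdge none).Iso (glue S T).map :=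
  (exists_iso_doubleEdge (S.isTree_join T) none).choose_spec.choose

theorem isInner_glue (S T : CornerTree) : (glue S T).IsInner ((glueIso S T).onE none) :=
  (exists_iso_doubleEdge (S.isTree_join T) none).choose_spec.choose_spec

theorem glue_equiv {S S' T T' : CornerTree} (hS : S ≈ S') (hT : T ≈ T') :
    glue S T ≈ glue S' T' := by
  obtain ⟨φ, h1, h2⟩ := hS
  obtain ⟨ψ, h3, h4⟩ := hT
  let χ : (S.join T).Iso (S'.join T') := φ.joinCorners ψ.swap h1 h2 h3 h4
  refine equiv_of_iso (isInner_glue S T) (isInner_glue S' T')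
    ((glueIso S T).symm.trans ((χ.doubleEdge (i := none) (i' := none) rfl).trans (glueIso S' T'))) ?_
  change (glueIso S' T').onE ((χ.doubleEdge (i := none) (i' := none) rfl).onE
    ((glueIso S T).onE.symm ((glueIso S T).onE none))) = _
  rw [Equiv.symm_apply_apply]
  rfl

/-- An isomorphism of `2^1`-maps matches the inner edges, hence restricts to the joins and matches
the joining edges, and so splits into isomorphisms of the two rooted parts. -/
theorem equiv_of_glue_equiv {S S' T T' : CornerTree} (h : glue S T ≈ glue S' T') :
    S ≈ S' ∧ T ≈ T' := by
  obtain ⟨φ, hφ⟩ := exists_iso_of_equiv (isInner_glue S T) (isInner_glue S' T') h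
  obtain ⟨ψ, hψ⟩ := BMap.Iso.exists_of_doubleEdge
    ((glueIso S T).trans (φ.trans (glueIso S' T').symm)) (by
      change (glueIso S' T').onE.symm (φ.onE ((glueIso S T).onE none)) = none
      rw [hφ, Equiv.symm_apply_apply])
  obtain ⟨⟨φ₁, h1, h2⟩, ⟨φ₂, h3, h4⟩⟩ := ψ.exists_of_joinCorners S.1.isTree.1 T.1.isTree.1.swap hψ
  exact ⟨⟨φ₁, h1, h2⟩, ⟨φ₂.swap, h3, h4⟩⟩

theorem exists_equiv_glue (U : TwoOneMap) : ∃ S T, glue S T ≈ U := by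
  obtain ⟨S, T, φ, h⟩ := U.exists_iso_join
  exact ⟨S, T, equiv_of_iso (isInner_glue S T) h ((glueIso S T).symm.trans φ.symm) (by
    change φ.onE.symm ((glueIso S T).onE.symm ((glueIso S T).onE none)) = _
    rw [Equiv.symm_apply_apply])⟩

/-- Pairs of classes of rooted trees correspond to classes of `2^1`-maps. -/
noncomputable def glueEquiv : Quotient CornerTree.isoSetoid × Quotient CornerTree.isoSetoid ≃
    Quotient TwoOneMap.isoSetoid :=
  Equiv.ofBijective (fun p => ⟦glue p.1.out p.2.out⟧) ⟨by
    rintro ⟨s, t⟩ ⟨s', t'⟩ h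
    obtain ⟨h1, h2⟩ := equiv_of_glue_equiv (Quotient.exact h)
    exact Prod.ext (Quotient.out_equiv_out.1 h1) (Quotient.out_equiv_out.1 h2),
  by
    intro U
    induction U using Quotient.inductionOn with
    | h U =>
      obtain ⟨S, T, h⟩ := U.exists_equiv_glue
      exact ⟨(⟦S⟧, ⟦T⟧), Quotient.sound (Setoid.trans
        (glue_equiv (Quotient.mk_out S) (Quotient.mk_out T)) h)⟩⟩

/-- The joining edge and its copy each add one to the degree of either root. Of these two edges, one
is counted in each `rootWeight`. -/
theorem weight_glue (S T : CornerTree) : (glue S T).map.weight =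
    S.rootWeight Var.a Var.b + T.rootWeight Var.b Var.a := by
  rw [BMap.weight_eq_colWeight, (glueIso S T).colWeight_eq]
  have hW : ∀ w, ((S.join T).doubleEdge none).degW w =
      Sum.elim (fun w => S.1.map.degW w + if S.2.1.1 = w then 2 else 0) T.1.map.degB w := by
    intro w
    rw [BMap.doubleEdge, BMap.degW_insertEdge]
    change (S.join T).degW w + (if Sum.inl S.2.1.1 = w then 1 else 0) = _
    rw [show (S.join T).degW w = (S.1.map.sum T.1.map.swap).degW w +
      if Sum.inl S.2.1.1 = w then 1 else 0 from
        BMap.degW_insertEdge _ (BMap.isCorner_inl.2 S.2.2) (BMap.isCorner_inr.2 T.2.2) _]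
    rcases w with w | w
    · rw [BMap.degW_sum_inl]
      by_cases h : S.2.1.1 = w <;> simp [h]
    · rw [BMap.degW_sum_inr, BMap.degW_swap]
      simp
  have hB : ∀ b, ((S.join T).doubleEdge none).degB b =
      Sum.elim S.1.map.degB (fun b => T.1.map.degW b + if T.2.1.1 = b then 2 else 0) b := by
    intro b
    rw [BMap.doubleEdge, BMap.degB_insertEdge]
    change (S.join T).degB b + (if Sum.inr T.2.1.1 = b then 1 else 0) = _
    rw [show (S.join T).degB b = (S.1.map.sum T.1.map.swap).degB b +
      if Sum.inr T.2.1.1 = b then 1 else 0 from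
        BMap.degB_insertEdge _ (BMap.isCorner_inl.2 S.2.2) (BMap.isCorner_inr.2 T.2.2) _]
    rcases b with b | b
    · rw [BMap.degB_sum_inl]
      simp
    · rw [BMap.degB_sum_inr, BMap.degB_swap]
      by_cases h : T.2.1.1 = b <;> simp [h]
  have hE : Nat.card (Option (Option (Fin S.1.nE ⊕ Fin T.1.nE))) =
      (S.1.nE + 1) + (T.1.nE + 1) := by
    simp only [Finite.card_option, Nat.card_sum, Nat.card_fin]
    omega
  have hV : Nat.card (Fin S.1.nW ⊕ Fin T.1.nB) + Nat.card (Fin S.1.nB ⊕ Fin T.1.nW) =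
      (S.1.nW + S.1.nB) + (T.1.nW + T.1.nB) := by
    simp only [Nat.card_sum, Nat.card_fin]
    omega
  rw [BMap.colWeight, hE, hV, Finsupp.single_add (a := Var.t),
    Finsupp.single_add (a := Var.x), Fintype.sum_sum_type,
    Fintype.sum_sum_type, CornerTree.rootWeight, CornerTree.rootWeight]
  simp only [hW, hB, Sum.elim_inl, Sum.elim_inr]
  abel

end TwoOneMap

/-- The gluing bijection is multiplicative on monomials. The second factor has its variables
interchanged because its trees are stored with a white root that becomes black when glued. -/
theorem twoOneSeries_eq_mul :
    twoOneSeries = rootedSeries Var.a Var.b * rootedSeries Var.b Var.a := by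
  have hfin : ∀ v₁ v₂ : ℕ → Var, (∀ d, Finite {S : CornerTree // S.rootWeight v₁ v₂ = d}) →
      ∀ d, Finite {τ : Quotient CornerTree.isoSetoid // τ.out.rootWeight v₁ v₂ = d} :=
    fun v₁ v₂ h d => by
      have := h d
      exact Finite.of_injective (fun τ : {τ : Quotient CornerTree.isoSetoid //
        τ.out.rootWeight v₁ v₂ = d} => (⟨τ.1.out, τ.2⟩ : {S : CornerTree // S.rootWeight v₁ v₂ = d}))
        fun a b hab => Subtype.ext (Quotient.out_injective (congrArg Subtype.val hab))
  rw [rootedSeries, rootedSeries, genSeries_mul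
    (hfin _ _ (CornerTree.finite_rootWeight Var.a_injective PlaneTree.finite_colWeight_ab))
    (hfin _ _ (CornerTree.finite_rootWeight Var.b_injective PlaneTree.finite_colWeight_ba)),
    twoOneSeries]
  symm
  refine genSeries_equiv TwoOneMap.glueEquiv (fun p => ?_) fun p => by simp
  rw [← TwoOneMap.weight_glue, BMap.weight_eq_colWeight, BMap.weight_eq_colWeight]
  obtain ⟨φ, -⟩ : (TwoOneMap.glueEquiv p).out ≈ TwoOneMap.glue p.1.out p.2.out :=
    Quotient.mk_out (TwoOneMap.glue p.1.out p.2.out)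
  exact (φ.colWeight_eq _ _).symm

/-- The series `T` is the generating function of plane bipartite trees, and the generating function
of `2^1`-maps is `D_a(T) * D_b(T)`. -/
theorem theorem2p1 :
    seriesT = planeTreeSeries ∧ twoOneSeries = opDa seriesT * opDb seriesT := by
  refine ⟨seriesT_eq_planeTreeSeries, ?_⟩
  rw [twoOneSeries_eq_mul, opDa, opDb, seriesT_eq_planeTreeSeries]
  congr 1
  · rw [← labelledTreeSeries_ab, diffOp_labelledTreeSeries Var.a_injective
      PlaneTree.finite_colWeight_ab (by simp) (by simp) (by simp)]
  · rw [← labelledTreeSeries_ba, diffOp_labelledTreeSeries Var.b_injective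
      PlaneTree.finite_colWeight_ba (by simp) (by simp) (by simp)]
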